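/- Let $D=(V,E)$ be a finite directed graph and let $s,t\in V$. A directed path is identified with its sequence of vertices, which are pairwise distinct; if $s=t$, the only $s$-$t$ path is $(s)$. For a directed $s$-$s'$ path $P$ and a directed $s'$-$t$ path $Q$ let $P\circ Q$ be their concatenation at $s'$. Consider the following recursive procedure $\mathrm{EnumSTP}(D,P,d)$, where $P$ is a directed path from $s$ to some vertex $s'$ and $d\ge 0$ is the depth of the recursion. 1. Find a directed $s'$-$t$ path $Q=(s'=v_1,v_2,\dots,v_k=t)$ in $D[V\setminus(V(P)\setminus\{s'\})]$. If there is none, return without output. 2. If $d$ is even, output $P\circ Q$. 3. For $i=k-1,\dots,1$, let $Q_i=(v_1,\dots,v_i)$; if $D[V\setminus(V(P\circ Q_i)\setminus\{v_i\})]-(v_i,v_{i+1})$ has a directed $v_i$-$t$ path, call $\mathrm{EnumSTP}(D-(v_i,v_{i+1}),\,P\circ Q_i,\,d+1)$. 4. If $d$ is odd, output $P\circ Q$. The algorithm is the call $\mathrm{EnumSTP}(D,(s),0)$. For an undirected graph $G$ it is applied to the directed graph that has the two arcs $(u,v)$, $(v,u)$ for every edge $\{u,v\}$ of $G$. **Theorem.**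 (Correctness.) Whatever deterministic rule (a function of the current graph and the current path) is used to find the path $Q$ in step 1, the algorithm terminates, and it outputs every $s$-$t$ path of the given directed (respectively undirected) graph exactly once, and nothing else. (Complexity.) The algorithm can be implemented in $O(n+m)$ delay and $O(n+m)$ space, for directed and for undirected graphs with $n$ vertices and $m$ edges. That is, in each of the two cases there are a random access machine program (with finitely many registers and an addressable memory, built from elementary instructions by sequencing, if-then-else and while) and a constant $C$, neither depending on the graph, such that for every graph on the vertices $0,\dots,n-1$, given by $n$, $m$, $s$, $t$ and a list of its $m$ edges in arbitrary order, and all vertices $s,t$, the following holds. The program halts, and it outputs, one after another, exactly the paths that the above algorithm outputs, in the same order, for some rule of finding the paths $Q$. The time before the first solution is completed, between the completions of two consecutive solutions, and after the last one until the program halts is at most $C(n+m)$ (if there is no solution, the program halts within this time). The program uses only the first $C(n+m)$ words of the memory, and every register and every memory word always contains a number of at most $C(\lfloor\log_2 n\rfloor+1)$ bits. Here each elementary instruction (constant, copy, addition, truncated subtraction, load, store, writing one word to the write-only output tape, ending a solution) and each comparison takes one unit of time; the output tape does not count as space. -/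

import Mathlib

namespace PathEnum

/-! ## Paths in directed graphs -/

section Paths

variable {V : Type*}

/-- `l` is the vertex sequence of a directed `u`-`t` path of `D` none of whose vertices lies in
`X`, that is, of a directed `u`-`t` path of the induced subgraph `D[V ∖ X]`. -/
structure IsPathAvoiding (D : Digraph V) (X : List V) (u t : V) (l : List V) : Prop where
  head : l.head? = some u
  last : l.getLast? = some t
  chain : l.IsChain D.Adj
  nodup : l.Nodup
  avoids : ∀ x ∈ l, x ∉ X

/-- `l` is the vertex sequence of a directed `s`-`t` path of `D`. -/
def IsDiPath (D : Digraph V) (s t : V) (l : List V) : Prop := IsPathAvoiding D [] s t l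

/-- `l` is the vertex sequence, read from `s` to `t`, of an `s`-`t` path of the undirected
graph `G`. -/
def IsUndirPath (G : SimpleGraph V) (s t : V) (l : List V) : Prop :=
  ∃ w : G.Walk s t, w.IsPath ∧ w.support = l

/-- `D - (a, b)`. -/
def deleteArc (D : Digraph V) (a b : V) : Digraph V where
  Adj x y := D.Adj x y ∧ ¬ (x = a ∧ y = b)

/-- The directed graph with the two arcs `(u, v)`, `(v, u)` for every edge `{u, v}` of `G`. -/
def symmetricDigraph (G : SimpleGraph V) : Digraph V where
  Adj := G.Adj

/-- `L` lists the solutions described by `S`: each of them exactly once, and nothing else. -/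
def Enumerates (L : List (List V)) (S : List V → Prop) : Prop :=
  L.Nodup ∧ ∀ l, l ∈ L ↔ S l

end Paths

/-! ## The recursive algorithm -/

section Algorithm

variable {V : Type*}

/-- A rule for the step "find a directed path from the current end vertex `u` to `t`" in the
current graph `D`, avoiding the vertices `pre` of the current path that precede `u`. -/
abbrev PathRule (V : Type*) := Digraph V → List V → V → List V

/-- The rule finds a path to `t` whenever there is one. -/
def PathRule.Valid (find : PathRule V) (t : V) : Prop :=
  ∀ (D : Digraph V) (pre : List V) (u : V),
    (∃ l, IsPathAvoiding D pre u t l) → IsPathAvoiding D pre u t (find D pre u)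

mutual

/-- `EnumSTP find t D pre u d L`: the procedure, called in the graph `D` with the path
`P = pre ++ [u]` and the recursion depth `d`, terminates and has then output the list `L`.
It finds a path `Q` from `u` to `t` in `D[V ∖ pre]` (and does nothing if there is none), outputs
`P ∘ Q = pre ++ Q` before the loop if `d` is even and after the loop if `d` is odd. -/
inductive EnumSTP (find : PathRule V) (t : V) :
    Digraph V → List V → V → ℕ → List (List V) → Prop
  | noPath {D : Digraph V} {pre : List V} {u : V} {d : ℕ}
      (h : ¬ ∃ l, IsPathAvoiding D pre u t l) :
      EnumSTP find t D pre u d []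
  | path {D : Digraph V} {pre : List V} {u : V} {d : ℕ} {L : List (List V)}
      (h : ∃ l, IsPathAvoiding D pre u t l)
      (hL : EnumLoop find t D pre (find D pre u) d ((find D pre u).length - 1) L) :
      EnumSTP find t D pre u d
        ((if Even d then [pre ++ find D pre u] else []) ++ L ++
          (if Odd d then [pre ++ find D pre u] else []))

/-- `EnumLoop find t D pre Q d i L`: the part of the loop of the procedure that handles the
indices `i, i - 1, …, 1`, in this order, terminates and outputs the list `L`. With
`Q = (v₁, …, v_k)`, index `i + 1` concerns the vertex `v = v_{i+1}` (`Q[i]`) and the arc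
from `v` to `w = v_{i+2}` (`Q[i + 1]`), and `pre ++ Q.take i` lists the vertices that precede `v`
on the path `P ∘ (v₁, …, v_{i+1})`. If `v` still reaches `t` after removing the
arc `(v, w)` and these vertices, the procedure is called in the graph `D - (v, w)`. -/
inductive EnumLoop (find : PathRule V) (t : V) :
    Digraph V → List V → List V → ℕ → ℕ → List (List V) → Prop
  | done {D : Digraph V} {pre Q : List V} {d : ℕ} : EnumLoop find t D pre Q d 0 []
  | call {D : Digraph V} {pre Q : List V} {d i : ℕ} {v w : V} {L₁ L₂ : List (List V)}
      (hv : Q[i]? = some v) (hw : Q[i + 1]? = some w)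
      (h : ∃ l, IsPathAvoiding (deleteArc D v w) (pre ++ Q.take i) v t l)
      (h₁ : EnumSTP find t (deleteArc D v w) (pre ++ Q.take i) v (d + 1) L₁)
      (h₂ : EnumLoop find t D pre Q d i L₂) :
      EnumLoop find t D pre Q d (i + 1) (L₁ ++ L₂)
  | skip {D : Digraph V} {pre Q : List V} {d i : ℕ} {v w : V} {L : List (List V)}
      (hv : Q[i]? = some v) (hw : Q[i + 1]? = some w)
      (h : ¬ ∃ l, IsPathAvoiding (deleteArc D v w) (pre ++ Q.take i) v t l)
      (h₂ : EnumLoop find t D pre Q d i L) :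
      EnumLoop find t D pre Q d (i + 1) L

end

/-- The main call: the list `L` is output by the algorithm on the instance `(D, s, t)`. -/
def AlgorithmOutputs (find : PathRule V) (D : Digraph V) (s t : V) (L : List (List V)) : Prop :=
  EnumSTP find t D [] s 0 L

end Algorithm

/-! ## Random access machine

A program works on finitely many registers and on an addressable memory. Every elementary
instruction and every evaluation of a test takes one unit of time. The output tape is write-only. -/

inductive Test where
  | lt (x y : ℕ)
  | eq (x y : ℕ)

inductive Prog where
  | skip
  | const (x c : ℕ)
  | copy (x y : ℕ)
  | add (x y z : ℕ)
  | sub (x y z : ℕ)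
  | load (x y : ℕ)
  | store (x y : ℕ)
  | write (x : ℕ)
  | endSolution
  | seq (p q : Prog)
  | ite (b : Test) (p q : Prog)
  | while (b : Test) (p : Prog)

/-- A configuration: the program text that remains to be executed (a stack of parts of the
program; there are no procedures, so its height is bounded in terms of the program), the
registers, the memory, the unfinished current solution and the finished solutions. -/
structure Config where
  todo : List Prog
  reg : ℕ → ℕ
  mem : ℕ → ℕ
  current : List ℕ
  out : List (List ℕ)

def Test.holds (b : Test) (reg : ℕ → ℕ) : Bool :=
  match b with
  | .lt x y => decide (reg x < reg y)
  | .eq x y => decide (reg x = reg y)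

/-- One unit of time. -/
def Config.step (c : Config) : Config :=
  match c.todo with
  | [] => c
  | .skip :: k => { c with todo := k }
  | .const x a :: k => { c with todo := k, reg := Function.update c.reg x a }
  | .copy x y :: k => { c with todo := k, reg := Function.update c.reg x (c.reg y) }
  | .add x y z :: k => { c with todo := k, reg := Function.update c.reg x (c.reg y + c.reg z) }
  | .sub x y z :: k => { c with todo := k, reg := Function.update c.reg x (c.reg y - c.reg z) }
  | .load x y :: k => { c with todo := k, reg := Function.update c.reg x (c.mem (c.reg y)) }
  | .store x y :: k => { c with todo := k, mem := Function.update c.mem (c.reg x) (c.reg y) }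
  | .write x :: k => { c with todo := k, current := c.current ++ [c.reg x] }
  | .endSolution :: k => { c with todo := k, current := [], out := c.out ++ [c.current] }
  | .seq p q :: k => { c with todo := p :: q :: k }
  | .ite b p q :: k => { c with todo := (if b.holds c.reg then p else q) :: k }
  | .while b p :: k =>
      { c with todo := if b.holds c.reg then p :: .while b p :: k else k }

/-- The memory address that the next instruction accesses, if it accesses the memory. -/
def Config.address (c : Config) : Option ℕ :=
  match c.todo with
  | .load _ y :: _ => some (c.reg y)
  | .store x _ :: _ => some (c.reg x)
  | _ => none

def Config.Halted (c : Config) : Prop := c.todo = []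

/-- Initially the memory holds the input, followed by zeros, and all registers are zero. -/
def Prog.init (p : Prog) (input : List ℕ) : Config where
  todo := [p]
  reg := fun _ => 0
  mem := fun a => input.getD a 0
  current := []
  out := []

/-- The configuration at time `k`. -/
def Prog.run (p : Prog) (input : List ℕ) (k : ℕ) : Config := Config.step^[k] (p.init input)

/-- The program halts, having output exactly the solutions in `L`, in this order. -/
def Prog.Produces (p : Prog) (input : List ℕ) (L : List (List ℕ)) : Prop :=
  ∃ k, (p.run input k).Halted ∧ (p.run input k).out = L

/-- From any moment on, a further solution is completed or the program halts within `B` units of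
time: the times before the first solution, between two consecutive solutions, and after the last
solution are all at most `B`. -/
def Prog.DelayAtMost (p : Prog) (input : List ℕ) (B : ℕ) : Prop :=
  ∀ k, ∃ j ≤ k + B, (p.run input j).Halted ∨
    (p.run input k).out.length < (p.run input j).out.length

/-- All memory accesses are to the first `B` memory words. -/
def Prog.SpaceAtMost (p : Prog) (input : List ℕ) (B : ℕ) : Prop :=
  ∀ k, ∀ a ∈ (p.run input k).address, a < B

/-- Every register and every memory word always holds a number of at most `b` bits. -/
def Prog.WordBitsAtMost (p : Prog) (input : List ℕ) (b : ℕ) : Prop :=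
  ∀ k a, (p.run input k).reg a < 2 ^ b ∧ (p.run input k).mem a < 2 ^ b

/-! ## Input of the machine -/

/-- `es` lists the arcs of `D`, each of them once, in an arbitrary order. -/
def ListsArcs {n : ℕ} (es : List (Fin n × Fin n)) (D : Digraph (Fin n)) : Prop :=
  es.Nodup ∧ ∀ u v, (u, v) ∈ es ↔ D.Adj u v

/-- `es` lists the edges of `G`, each of them once, in an arbitrary order, and the two ends of
each edge in an arbitrary order. -/
def ListsEdges {n : ℕ} (es : List (Fin n × Fin n)) (G : SimpleGraph (Fin n)) : Prop :=
  (es.map fun e => s(e.1, e.2)).Nodup ∧ ∀ e, e ∈ es.map (fun e => s(e.1, e.2)) ↔ e ∈ G.edgeSet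

/-- The input words `n, m, s, t, u₁, v₁, …, u_m, v_m`. -/
def encode {n : ℕ} (es : List (Fin n × Fin n)) (s t : Fin n) : List ℕ :=
  [n, es.length, s.val, t.val] ++ es.flatMap fun e => [e.1.val, e.2.val]

/-- Started on the given instance, the program outputs exactly the vertex lists in `L`, in this
order, with delay at most `C * (n + m)` and in at most `C * (n + m)` memory words of
at most `C * (log₂ n + 1)` bits. -/
def Prog.LinearDelayLinearSpace (p : Prog) (C : ℕ) {n : ℕ} (es : List (Fin n × Fin n))
    (s t : Fin n) (L : List (List (Fin n))) : Prop :=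
  p.Produces (encode es s t) (L.map fun l => l.map Fin.val) ∧
  p.DelayAtMost (encode es s t) (C * (n + es.length)) ∧
  p.SpaceAtMost (encode es s t) (C * (n + es.length)) ∧
  p.WordBitsAtMost (encode es s t) (C * (Nat.log 2 n + 1))

end PathEnum

open PathEnum

/-!
Correctness. A path from `u` to `t` other than the path `Q` that a call has found follows `Q` up to
exactly one vertex `v = Q[i]` and then takes another arc than the one to `w = Q[i + 1]`. The paths
that leave `Q` at `v` are the paths found below the recursive call for the index `i`, in which the
arc `(v, w)` is deleted and the vertices before `v` are forbidden (`isPathAvoiding_branch_iff`,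
`exists_branch`, `enumerates_of_enumSTP`). Every recursive call deletes an arc, so the recursion
terminates (`exists_enumSTP`).

Delay. A call is made only if there is a path for it to find, so every call outputs a solution:
before its loop at even depth, and after its loop at odd depth. Consider the run as a walk through
the tree of calls, each step of which begins a call or returns from one (`TourState.next`). Among
three consecutive steps one produces an output or ends the run (`productive_three`). It remains to
perform one step in linear time.

Linear time for a step. The path of a call is found by a backward search from `t`. For the loop, let
the search from `t` run with all vertices of the current path blocked except for `t`, counting for
every blocked vertex the arcs that lead from it to reached vertices. With the vertices up to
`v = Q[i]` blocked, a path from `v` that avoids the arc to `w` exists if and only if that number of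
`v` is at least two, since the arc to `w` is always counted (`branch_iff_cnt_eq_two`). To
proceed from `i` to `i - 1`, unblock `v` and continue the search from there
(`searchInvAt_restart`). So all tests of the loop together scan every arc once; the number of
search steps is bounded by the number of vertices and arcs (`SearchInvAt.le`).

Linear space. A suspended call is stored in two words, the arc that it has deleted and the length of
its prefix. When it is resumed, the arc is restored and the same deterministic search is made again;
it finds the same path (`Net.find`), and the indices from the deleted arc on are skipped. The
suspended calls have deleted distinct arcs, so there are at most as many of them as there are arcs
(`StateRep.room`).

The machine program. A small language with named registers and arrays is translated to
machine programs; `vc` computes verification conditions that guarantee termination, the time and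
the safety of all memory accesses and words (`vc_sound`). The program `eventCmd` performs one step
of the walk (`vc_eventCmd`), and `HeadRep.enumerating` derives the delay of the whole run from
`productive_three`. For undirected graphs, a preliminary program replaces every edge of the input by
two arcs (`wp1_symmetrizeProg`).
-/

namespace PathEnum

/-! ### Vertex lists of directed paths -/

section PathLemmas

variable {V : Type*} {D D' : Digraph V} {X X' : List V} {u v w t z : V} {l q Q : List V}

theorem IsPathAvoiding.exists_cons (h : IsPathAvoiding D X u t l) : ∃ l', l = u :: l' := by
  rcases l with _ | ⟨a, l⟩
  · simpa using h.head
  · exact ⟨l, by simpa using h.head⟩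

theorem IsPathAvoiding.length_pos (h : IsPathAvoiding D X u t l) : 0 < l.length := by
  obtain ⟨l', rfl⟩ := h.exists_cons
  simp

theorem IsPathAvoiding.mono (h : IsPathAvoiding D X u t l) (hD : ∀ a b, D.Adj a b → D'.Adj a b)
    (hX : ∀ x ∈ l, x ∉ X') : IsPathAvoiding D' X' u t l :=
  ⟨h.head, h.last, h.chain.imp hD, h.nodup, hX⟩

theorem IsPathAvoiding.cons (h : IsPathAvoiding D X v t l) (ha : D.Adj u v) (hu : u ∉ l)
    (hX : u ∉ X) : IsPathAvoiding D X u t (u :: l) := by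
  obtain ⟨l', rfl⟩ := h.exists_cons
  refine ⟨rfl, by simpa using h.last, ?_, List.nodup_cons.2 ⟨hu, h.nodup⟩, ?_⟩
  · exact List.isChain_cons_cons.2 ⟨ha, h.chain⟩
  · simpa [hX] using h.avoids

theorem IsPathAvoiding.singleton (D : Digraph V) (h : t ∉ X) : IsPathAvoiding D X t t [t] :=
  ⟨rfl, rfl, by simp, by simp, by simpa using h⟩

theorem IsPathAvoiding.drop (h : IsPathAvoiding D X u t l) {i : ℕ} (hi : l[i]? = some v) :
    IsPathAvoiding D X v t (l.drop i) := by
  obtain ⟨hi', rfl⟩ := List.getElem?_eq_some_iff.1 hi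
  refine ⟨by simp [hi], ?_, h.chain.drop i, h.nodup.sublist (List.drop_sublist _ _),
    fun x hx => h.avoids x (List.mem_of_mem_drop hx)⟩
  rw [List.getLast?_drop, if_neg (by omega), h.last]

theorem IsPathAvoiding.getElem?_eq_last (h : IsPathAvoiding D X u t l) {i : ℕ}
    (hi : l[i]? = some t) : i + 1 = l.length := by
  have hp := h.length_pos
  have h1 := h.last
  rw [List.getLast?_eq_getElem?] at h1
  have := (List.getElem?_inj (by
    obtain ⟨hi', -⟩ := List.getElem?_eq_some_iff.1 hi; exact hi') h.nodup).1 (hi.trans h1.symm)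
  omega

/-- The vertices of a path that precede the vertex number `i`, followed by a path from that
vertex that avoids them, form a path. -/
theorem IsPathAvoiding.splice (hQ : IsPathAvoiding D X u t Q) {i : ℕ} (hi : Q[i]? = some v)
    (hq : IsPathAvoiding D (X ++ Q.take i) v t q) : IsPathAvoiding D X u t (Q.take i ++ q) := by
  obtain ⟨q', rfl⟩ := hq.exists_cons
  obtain ⟨hi', hv⟩ := List.getElem?_eq_some_iff.1 hi
  have hav := hq.avoids
  simp only [List.mem_append, not_or] at hav
  refine ⟨?_, ?_, ?_, ?_, ?_⟩
  · rcases i with _ | i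
    · have := hQ.head
      rw [List.head?_eq_getElem?, hi] at this
      simpa using this
    · rw [List.head?_append, List.head?_take, if_neg (by omega), hQ.head]
      rfl
  · rw [List.getLast?_append, hq.last]; rfl
  · rw [List.isChain_append]
    refine ⟨hQ.chain.take i, hq.chain, ?_⟩
    rintro x hx y hy
    obtain rfl : v = y := by simpa using hy
    rcases i with _ | i
    · simp at hx
    · have h2 := List.isChain_iff_getElem.1 hQ.chain i (by omega)
      rw [List.getLast?_eq_getElem?, List.length_take, min_eq_left (by omega)] at hx
      rw [Option.mem_def] at hx
      have : Q[i]? = some x := by simpa [List.getElem?_take] using hx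
      obtain ⟨_, h3⟩ := List.getElem?_eq_some_iff.1 this
      rw [← h3, ← hv]; exact h2
  · rw [List.nodup_append']
    refine ⟨hQ.nodup.sublist (List.take_sublist _ _), hq.nodup, ?_⟩
    intro x hx hx'
    exact (hav x hx').2 hx
  · intro x hx
    rcases List.mem_append.1 hx with hx | hx
    · exact hQ.avoids x (List.mem_of_mem_take hx)
    · exact (hav x hx).1

/-- The rest of a path avoids what comes before. -/
theorem IsPathAvoiding.drop_take (h : IsPathAvoiding D X u t l) {i : ℕ} (hi : l[i]? = some v) :
    IsPathAvoiding D (X ++ l.take i) v t (l.drop i) := by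
  have hd := h.drop hi
  refine hd.mono (fun _ _ h => h) fun z hz hm => ?_
  have hnd := h.nodup
  rw [← List.take_append_drop i l, List.nodup_append'] at hnd
  rcases List.mem_append.1 hm with hm | hm
  · exact hd.avoids z hz hm
  · exact hnd.2.2 hm hz

theorem IsPathAvoiding.adj_getElem (h : IsPathAvoiding D X u t l) {i : ℕ} (hv : l[i]? = some v)
    (hw : l[i + 1]? = some w) : D.Adj v w := by
  obtain ⟨h1, rfl⟩ := List.getElem?_eq_some_iff.1 hv
  obtain ⟨h2, rfl⟩ := List.getElem?_eq_some_iff.1 hw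
  exact List.isChain_iff_getElem.1 h.chain i h2

/-- Deleting the arc from `v = Q[i]` to `w = Q[i + 1]` and forbidding the vertices before `v`
leaves the tails of the paths that follow `Q` exactly up to `v`. -/
theorem isPathAvoiding_branch_iff (hQ : IsPathAvoiding D X u t Q) {i : ℕ}
    (hv : Q[i]? = some v) :
    (∃ q', IsPathAvoiding (deleteArc D v w) (X ++ Q.take i) v t q' ∧ q = Q.take i ++ q') ↔
      IsPathAvoiding D X u t q ∧ q.take (i + 1) = Q.take (i + 1) ∧ q[i + 1]? ≠ some w := by
  obtain ⟨hi', hv'⟩ := List.getElem?_eq_some_iff.1 hv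
  have hlen : (Q.take i).length = i := by simp; omega
  have htk : Q.take (i + 1) = Q.take i ++ [v] := by rw [List.take_add_one, hv]; rfl
  constructor
  · rintro ⟨q', hq', rfl⟩
    refine ⟨hQ.splice hv (hq'.mono (fun a b h => h.1) hq'.avoids), ?_, ?_⟩
    · obtain ⟨r, rfl⟩ := hq'.exists_cons
      rw [List.take_append, hlen, htk]
      simp
    · obtain ⟨r, rfl⟩ := hq'.exists_cons
      rw [List.getElem?_append_right (by omega), hlen]
      intro h
      have := hq'.adj_getElem (i := 0) (v := v) (w := w) rfl (by simpa using h)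
      exact this.2 ⟨rfl, rfl⟩
  · rintro ⟨hq, htake, hne⟩
    have hqi : q[i]? = some v := by
      have := congrArg (fun m => m[i]?) htake
      simpa [List.getElem?_take, hv] using this
    have htake' : q.take i = Q.take i := by
      have := congrArg (List.take i) htake
      simpa [List.take_take] using this
    refine ⟨q.drop i, ?_, by rw [← htake', List.take_append_drop]⟩
    have hd := hq.drop hqi
    have hnd := hq.nodup
    rw [← List.take_append_drop i q, List.nodup_append'] at hnd
    refine ⟨hd.head, hd.last, ?_, hd.nodup, ?_⟩
    · rw [List.isChain_iff_getElem]
      intro j hj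
      refine ⟨List.isChain_iff_getElem.1 hd.chain j hj, ?_⟩
      rintro ⟨h1, h2⟩
      have h0 : (q.drop i)[0]? = some v := by simpa using hqi
      have h1' : (q.drop i)[j]? = some v := List.getElem?_eq_some_iff.2 ⟨by omega, h1⟩
      have hj0 := (List.getElem?_inj (by omega) hd.nodup).1 (h1'.trans h0.symm)
      subst hj0
      apply hne
      rw [← h2]
      rw [List.getElem_drop, ← List.getElem?_eq_getElem]
    · intro x hx
      rw [List.mem_append, not_or, ← htake']
      exact ⟨hq.avoids x (List.mem_of_mem_drop hx), fun h => hnd.2.2 h hx⟩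

/-- A path other than `Q` leaves `Q` at a definite vertex. -/
theorem exists_branch (hQ : IsPathAvoiding D X u t Q) (hq : IsPathAvoiding D X u t q)
    (hne : q ≠ Q) :
    ∃ j < Q.length - 1, q.take (j + 1) = Q.take (j + 1) ∧ q[j + 1]? ≠ Q[j + 1]? := by
  have hex : ∃ j : ℕ, q[j]? ≠ Q[j]? := by
    by_contra! h
    exact hne (List.ext_getElem? h)
  classical
  obtain ⟨hj, hmin⟩ := And.intro (Nat.find_spec hex) (fun k => Nat.find_min hex (m := k))
  set j := Nat.find hex
  have hQp := hQ.length_pos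
  have hj0 : j ≠ 0 := by
    intro h0
    rw [h0] at hj
    apply hj
    rw [← List.head?_eq_getElem?, ← List.head?_eq_getElem?, hq.head, hQ.head]
  have hjQ : j < Q.length := by
    by_contra! hle
    have h1 : Q[Q.length - 1]? = some t := by rw [← List.getLast?_eq_getElem?, hQ.last]
    have h2 := hmin (Q.length - 1) (by omega)
    rw [not_not, h1] at h2
    have h3 := hq.getElem?_eq_last h2
    apply hj
    rw [List.getElem?_eq_none (by omega), List.getElem?_eq_none (by omega)]
  refine ⟨j - 1, by omega, ?_, by rwa [show j - 1 + 1 = j by omega]⟩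
  apply List.ext_getElem?
  intro k
  rw [List.getElem?_take, List.getElem?_take]
  split_ifs with hk
  · exact not_not.1 (hmin k (by omega))
  · rfl

end PathLemmas

/-! ### The recursive algorithm terminates and enumerates -/

section Correctness

variable {V : Type*} {find : PathRule V} {t : V}

/-- The solutions that the indices below `i` of the loop are responsible for: the paths that
leave `Q` right after one of its first `i` vertices. -/
def BranchesBelow (D : Digraph V) (pre : List V) (u t : V) (Q : List V) (i : ℕ)
    (l : List V) : Prop :=
  ∃ q, l = pre ++ q ∧ IsPathAvoiding D pre u t q ∧
    ∃ j < i, q.take (j + 1) = Q.take (j + 1) ∧ q[j + 1]? ≠ Q[j + 1]?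

theorem enumerates_of_enumSTP (hf : find.Valid t) {D : Digraph V} {pre : List V} {u : V} {d : ℕ}
    {L : List (List V)} (h : EnumSTP find t D pre u d L) :
    Enumerates L fun l => ∃ q, l = pre ++ q ∧ IsPathAvoiding D pre u t q := by
  refine EnumSTP.rec (find := find) (t := t)
    (motive_1 := fun D pre u d L _ =>
      Enumerates L fun l => ∃ q, l = pre ++ q ∧ IsPathAvoiding D pre u t q)
    (motive_2 := fun D pre Q d i L _ => ∀ u, IsPathAvoiding D pre u t Q → i ≤ Q.length - 1 →
      Enumerates L (BranchesBelow D pre u t Q i)) ?_ ?_ ?_ ?_ ?_ h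
  · intro D pre u d hno
    refine ⟨List.nodup_nil, fun l => ?_⟩
    simp only [List.not_mem_nil, false_iff]
    rintro ⟨q, -, hq⟩
    exact hno ⟨q, hq⟩
  · -- the path `Q` is output once, before or after the loop
    intro D pre u d L hex _ ih
    have hQ := hf D pre u hex
    set Q := find D pre u
    obtain ⟨hnd, hmem⟩ := ih u hQ le_rfl
    have hnot : pre ++ Q ∉ L := by
      rw [hmem]
      rintro ⟨q, h1, -, j, hj, -, h2⟩
      exact h2 (by rw [List.append_cancel_left h1])
    constructor
    · rcases Nat.even_or_odd d with hd | hd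
      · simp [hd, Nat.not_odd_iff_even.2 hd, hnd, hnot]
      · simp only [Nat.not_even_iff_odd.2 hd, hd, if_true, if_false, List.nil_append]
        rw [List.nodup_append']
        refine ⟨hnd, by simp, by simpa using hnot⟩
    · intro l
      have : (l ∈ (if Even d then [pre ++ Q] else []) ++ L ++ (if Odd d then [pre ++ Q] else []))
          ↔ l = pre ++ Q ∨ l ∈ L := by
        rcases Nat.even_or_odd d with hd | hd
        · simp [hd, Nat.not_odd_iff_even.2 hd]
        · simp [hd, Nat.not_even_iff_odd.2 hd, or_comm]
      rw [this, hmem]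
      constructor
      · rintro (rfl | ⟨q, rfl, hq, -⟩)
        exacts [⟨Q, rfl, hQ⟩, ⟨q, rfl, hq⟩]
      · rintro ⟨q, rfl, hq⟩
        by_cases hqQ : q = Q
        · left; rw [hqQ]
        · right
          exact ⟨q, rfl, hq, exists_branch hQ hq hqQ⟩
  · intro D pre Q d u _ _
    refine ⟨List.nodup_nil, fun l => ?_⟩
    simp [BranchesBelow]
  · -- the recursive call yields the paths that leave `Q` at `v`, the rest of the loop those that
    -- leave it earlier
    intro D pre Q d i v w L₁ L₂ hv hw hex _ _ ih₁ ih₂ u hQ hi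
    obtain ⟨hnd₁, hm₁⟩ := ih₁
    obtain ⟨hnd₂, hm₂⟩ := ih₂ u hQ (by omega)
    have hm₁' : ∀ l, l ∈ L₁ ↔ ∃ q, l = pre ++ q ∧ IsPathAvoiding D pre u t q ∧
        q.take (i + 1) = Q.take (i + 1) ∧ q[i + 1]? ≠ Q[i + 1]? := by
      intro l
      rw [hm₁, hw]
      simp only [← isPathAvoiding_branch_iff hQ hv]
      constructor
      · rintro ⟨q, rfl, hq⟩
        exact ⟨_, by rw [List.append_assoc], q, hq, rfl⟩
      · rintro ⟨q, rfl, q', hq', rfl⟩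
        exact ⟨q', by rw [List.append_assoc], hq'⟩
    constructor
    · rw [List.nodup_append']
      refine ⟨hnd₁, hnd₂, ?_⟩
      intro l h1 h2
      obtain ⟨q, rfl, -, h3, h4⟩ := (hm₁' l).1 h1
      obtain ⟨q', h5, -, j, hj, h6, h7⟩ := (hm₂ _).1 h2
      obtain rfl := List.append_cancel_left h5
      apply h7
      have := congrArg (fun m => m[j + 1]?) h3
      simpa [List.getElem?_take, show j + 1 < i + 1 by omega] using this
    · intro l
      rw [List.mem_append, hm₁', hm₂]
      constructor
      · rintro (⟨q, rfl, hq, h3, h4⟩ | ⟨q, rfl, hq, j, hj, h3⟩)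
        · exact ⟨q, rfl, hq, i, by omega, h3, h4⟩
        · exact ⟨q, rfl, hq, j, by omega, h3⟩
      · rintro ⟨q, rfl, hq, j, hj, h3⟩
        rcases Nat.lt_succ_iff_lt_or_eq.1 hj with hj | rfl
        · exact Or.inr ⟨q, rfl, hq, j, hj, h3⟩
        · exact Or.inl ⟨q, rfl, hq, h3⟩
  · intro D pre Q d i v w L hv hw hno _ ih u hQ hi
    obtain ⟨hnd, hm⟩ := ih u hQ (by omega)
    refine ⟨hnd, fun l => ?_⟩
    rw [hm]
    constructor
    · rintro ⟨q, rfl, hq, j, hj, h3⟩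
      exact ⟨q, rfl, hq, j, by omega, h3⟩
    · rintro ⟨q, rfl, hq, j, hj, h3⟩
      rcases Nat.lt_succ_iff_lt_or_eq.1 hj with hj | rfl
      · exact ⟨q, rfl, hq, j, hj, h3⟩
      · obtain ⟨q', hq', -⟩ := (isPathAvoiding_branch_iff hQ hv).2 ⟨hq, h3.1, hw ▸ h3.2⟩
        exact absurd ⟨q', hq'⟩ hno

/-- Every recursive call deletes an arc, so the recursion terminates. -/
theorem exists_enumSTP [Finite V] (hf : find.Valid t) (D : Digraph V) (pre : List V) (u : V)
    (d : ℕ) : ∃ L, EnumSTP find t D pre u d L := by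
  induction hN : Set.ncard {e : V × V | D.Adj e.1 e.2} using Nat.strong_induction_on
    generalizing D pre u d with
  | _ N ih =>
    by_cases hex : ∃ l, IsPathAvoiding D pre u t l
    · have hQ := hf D pre u hex
      have hloop : ∀ i ≤ (find D pre u).length - 1,
          ∃ L, EnumLoop find t D pre (find D pre u) d i L := by
        intro i
        induction i with
        | zero => exact fun _ => ⟨[], .done⟩
        | succ i ihi =>
          intro hi
          obtain ⟨L₂, h₂⟩ := ihi (by omega)
          have hv : (find D pre u)[i]? = some ((find D pre u)[i]'(by omega)) :=
            List.getElem?_eq_getElem _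
          have hw : (find D pre u)[i + 1]? = some ((find D pre u)[i + 1]'(by omega)) :=
            List.getElem?_eq_getElem _
          generalize (find D pre u)[i]'(by omega) = v at hv
          generalize (find D pre u)[i + 1]'(by omega) = w at hw
          by_cases h : ∃ l, IsPathAvoiding (deleteArc D v w) (pre ++ (find D pre u).take i) v t l
          · have hlt : Set.ncard {e : V × V | (deleteArc D v w).Adj e.1 e.2} < N := by
              rw [← hN]
              apply Set.ncard_lt_ncard _ (Set.toFinite _)
              refine ⟨fun e he => he.1, fun hsub => ?_⟩
              exact (hsub (a := (v, w)) (hQ.adj_getElem hv hw)).2 ⟨rfl, rfl⟩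
            obtain ⟨L₁, h₁⟩ := ih _ hlt (deleteArc D v w) (pre ++ (find D pre u).take i) v
              (d + 1) rfl
            exact ⟨_, .call hv hw h h₁ h₂⟩
          · exact ⟨_, .skip hv hw h h₂⟩
      obtain ⟨L, hL⟩ := hloop _ le_rfl
      exact ⟨_, .path hex hL⟩
    · exact ⟨_, .noPath hex⟩

theorem isDiPath_symmetricDigraph_iff (G : SimpleGraph V) (s t : V) (l : List V) :
    IsDiPath (symmetricDigraph G) s t l ↔ IsUndirPath G s t l := by
  constructor
  · intro h
    induction l generalizing s with
    | nil => simpa using h.head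
    | cons a l ih =>
      obtain rfl : a = s := by simpa using h.head
      rcases l with _ | ⟨b, l⟩
      · obtain rfl : a = t := by simpa using h.last
        exact ⟨.nil, by simp, by simp⟩
      · have hc := List.isChain_cons_cons.1 h.chain
        have hn := List.nodup_cons.1 h.nodup
        obtain ⟨w, hw, hs⟩ := ih b ⟨rfl, by simpa using h.last, hc.2, hn.2, by simp⟩
        have hab : G.Adj a b := hc.1
        refine ⟨.cons hab w, ?_, by simp [hs]⟩
        rw [SimpleGraph.Walk.cons_isPath_iff, hs]
        exact ⟨hw, hn.1⟩
  · rintro ⟨w, hw, rfl⟩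
    refine ⟨?_, ?_, w.isChain_adj_support, hw.support_nodup, by simp⟩
    · rw [List.head?_eq_some_head w.support_ne_nil, w.head_support]
    · rw [List.getLast?_eq_some_getLast w.support_ne_nil, w.getLast_support]

theorem algorithmOutputs_enumerates (hf : find.Valid t) {D : Digraph V} {s : V}
    {L : List (List V)} (h : AlgorithmOutputs find D s t L) : Enumerates L (IsDiPath D s t) := by
  have := enumerates_of_enumSTP hf h
  simp only [List.nil_append, exists_eq_left'] at this
  exact this

end Correctness

/-! ### Program logic for the random access machine -/

section RawLogic

/-- The data part of a configuration. -/
structure Mach where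
  reg : ℕ → ℕ
  mem : ℕ → ℕ
  current : List ℕ
  out : List (List ℕ)

/-- The configuration with data `σ` in which the program parts `k` remain to be executed. -/
def Mach.cfg (σ : Mach) (k : List Prog) : Config := ⟨k, σ.reg, σ.mem, σ.current, σ.out⟩

/-- All registers and memory words are below `M`. -/
def Mach.Bdd (M : ℕ) (σ : Mach) : Prop := ∀ a, σ.reg a < M ∧ σ.mem a < M

/-- The next memory access is below `A`, and all registers and memory words are below `M`. -/
def Config.Safe (A M : ℕ) (c : Config) : Prop :=
  (∀ a ∈ c.address, a < A) ∧ ∀ a, c.reg a < M ∧ c.mem a < M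

/-- Total correctness with time and space: started with bounded data `σ` at time `t`, the
program `p` terminates, all configurations on the way are safe, and `Q` holds of the final data
and the final time. -/
def WP1 (A M : ℕ) (p : Prog) (Q : Mach → ℕ → Prop) (σ : Mach) (t : ℕ) : Prop :=
  σ.Bdd M → ∀ k, ∃ j σ', Config.step^[j] (σ.cfg (p :: k)) = σ'.cfg k ∧
    (∀ i < j, (Config.step^[i] (σ.cfg (p :: k))).Safe A M) ∧ σ'.Bdd M ∧ Q σ' (t + j)

variable {A M : ℕ} {p q : Prog} {Q Q' : Mach → ℕ → Prop} {σ : Mach} {t : ℕ} {x y z a : ℕ}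

theorem Mach.Bdd.update_reg (h : σ.Bdd M) (ha : a < M) :
    ({ σ with reg := Function.update σ.reg x a } : Mach).Bdd M := by
  intro b
  refine ⟨?_, (h b).2⟩
  by_cases hb : b = x
  · subst hb; simpa using ha
  · simpa [hb] using (h b).1

theorem Mach.Bdd.update_mem (h : σ.Bdd M) (ha : a < M) :
    ({ σ with mem := Function.update σ.mem x a } : Mach).Bdd M := by
  intro b
  refine ⟨(h b).1, ?_⟩
  by_cases hb : b = x
  · subst hb; simpa using ha
  · simpa [hb] using (h b).2

theorem wp1_mono (h : WP1 A M p Q σ t) (hQ : ∀ σ' t', Q σ' t' → Q' σ' t') :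
    WP1 A M p Q' σ t := by
  intro hb k
  obtain ⟨j, σ', h1, h2, h3, h4⟩ := h hb k
  exact ⟨j, σ', h1, h2, h3, hQ _ _ h4⟩

/-- The rule for a single instruction. -/
theorem wp1_of_step (σ' : Mach) (hs : ∀ k, (σ.cfg (p :: k)).step = σ'.cfg k)
    (ha : ∀ k, ∀ a ∈ (σ.cfg (p :: k)).address, a < A) (hb : σ.Bdd M → σ'.Bdd M)
    (hQ : Q σ' (t + 1)) : WP1 A M p Q σ t := by
  intro h k
  refine ⟨1, σ', by simpa using hs k, ?_, hb h, hQ⟩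
  intro i hi
  obtain rfl : i = 0 := by omega
  exact ⟨ha k, h⟩

theorem wp1_skip (hQ : Q σ (t + 1)) : WP1 A M .skip Q σ t :=
  wp1_of_step σ (fun _ => rfl) (fun _ => by simp [Config.address, Mach.cfg]) id hQ

theorem wp1_const (ha : a < M) (hQ : Q { σ with reg := Function.update σ.reg x a } (t + 1)) :
    WP1 A M (.const x a) Q σ t :=
  wp1_of_step _ (fun _ => rfl) (fun _ => by simp [Config.address, Mach.cfg])
    (fun h => h.update_reg ha) hQ

theorem wp1_copy (hQ : Q { σ with reg := Function.update σ.reg x (σ.reg y) } (t + 1)) :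
    WP1 A M (.copy x y) Q σ t :=
  wp1_of_step _ (fun _ => rfl) (fun _ => by simp [Config.address, Mach.cfg])
    (fun h => h.update_reg (h y).1) hQ

theorem wp1_add (ha : σ.reg y + σ.reg z < M)
    (hQ : Q { σ with reg := Function.update σ.reg x (σ.reg y + σ.reg z) } (t + 1)) :
    WP1 A M (.add x y z) Q σ t :=
  wp1_of_step _ (fun _ => rfl) (fun _ => by simp [Config.address, Mach.cfg])
    (fun h => h.update_reg ha) hQ

theorem wp1_sub (hQ : Q { σ with reg := Function.update σ.reg x (σ.reg y - σ.reg z) } (t + 1)) :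
    WP1 A M (.sub x y z) Q σ t :=
  wp1_of_step _ (fun _ => rfl) (fun _ => by simp [Config.address, Mach.cfg])
    (fun h => h.update_reg ((Nat.sub_le _ _).trans_lt (h y).1)) hQ

theorem wp1_load (ha : σ.reg y < A)
    (hQ : Q { σ with reg := Function.update σ.reg x (σ.mem (σ.reg y)) } (t + 1)) :
    WP1 A M (.load x y) Q σ t :=
  wp1_of_step _ (fun _ => rfl) (fun _ => by simpa [Config.address, Mach.cfg] using ha)
    (fun h => h.update_reg (h _).2) hQ

theorem wp1_store (ha : σ.reg x < A)
    (hQ : Q { σ with mem := Function.update σ.mem (σ.reg x) (σ.reg y) } (t + 1)) :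
    WP1 A M (.store x y) Q σ t :=
  wp1_of_step _ (fun _ => rfl) (fun _ => by simpa [Config.address, Mach.cfg] using ha)
    (fun h => h.update_mem (h _).1) hQ

theorem wp1_write (hQ : Q { σ with current := σ.current ++ [σ.reg x] } (t + 1)) :
    WP1 A M (.write x) Q σ t :=
  wp1_of_step { σ with current := σ.current ++ [σ.reg x] } (fun _ => rfl)
    (fun _ => by simp [Config.address, Mach.cfg]) (fun h => h) hQ

theorem wp1_endSolution
    (hQ : Q { σ with current := [], out := σ.out ++ [σ.current] } (t + 1)) :
    WP1 A M .endSolution Q σ t :=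
  wp1_of_step { σ with current := [], out := σ.out ++ [σ.current] } (fun _ => rfl)
    (fun _ => by simp [Config.address, Mach.cfg]) (fun h => h) hQ

/-- A step that only rearranges the remaining program, followed by a safe run. -/
theorem exists_run_of_step {c c' : Config} {k : List Prog} (h1 : c.step = c') (hs : c.Safe A M)
    (h : ∃ j σ', Config.step^[j] c' = σ'.cfg k ∧
      (∀ i < j, (Config.step^[i] c').Safe A M) ∧ σ'.Bdd M ∧ Q σ' (t + 1 + j)) :
    ∃ j σ', Config.step^[j] c = σ'.cfg k ∧
      (∀ i < j, (Config.step^[i] c).Safe A M) ∧ σ'.Bdd M ∧ Q σ' (t + j) := by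
  obtain ⟨j, σ', h2, h3, h4, h5⟩ := h
  refine ⟨j + 1, σ', by rw [Function.iterate_succ_apply, h1, h2], ?_, h4, by
    rwa [show t + (j + 1) = t + 1 + j by omega]⟩
  intro i hi
  rcases i with _ | i
  · exact hs
  · rw [Function.iterate_succ_apply, h1]
    exact h3 i (by omega)

/-- Two runs one after the other. -/
theorem exists_run_trans {c : Config} {k k' : List Prog} {R : Mach → ℕ → Prop}
    (h : ∃ j σ', Config.step^[j] c = σ'.cfg k' ∧
      (∀ i < j, (Config.step^[i] c).Safe A M) ∧ σ'.Bdd M ∧ R σ' (t + j))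
    (h' : ∀ σ' t', σ'.Bdd M → R σ' t' → ∃ j σ'', Config.step^[j] (σ'.cfg k') = σ''.cfg k ∧
      (∀ i < j, (Config.step^[i] (σ'.cfg k')).Safe A M) ∧ σ''.Bdd M ∧ Q σ'' (t' + j)) :
    ∃ j σ', Config.step^[j] c = σ'.cfg k ∧
      (∀ i < j, (Config.step^[i] c).Safe A M) ∧ σ'.Bdd M ∧ Q σ' (t + j) := by
  obtain ⟨j, σ', h1, h2, h3, h4⟩ := h
  obtain ⟨j', σ'', h1', h2', h3', h4'⟩ := h' _ _ h3 h4
  refine ⟨j' + j, σ'', by rw [Function.iterate_add_apply, h1, h1'], ?_, h3', by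
    rwa [show t + (j' + j) = t + j + j' by omega]⟩
  intro i hi
  rcases lt_or_ge i j with hij | hij
  · exact h2 i hij
  · obtain ⟨r, rfl⟩ := Nat.exists_eq_add_of_le' hij
    rw [Function.iterate_add_apply, h1]
    exact h2' r (by omega)

theorem wp1_seq (h : WP1 A M p (fun σ' t' => WP1 A M q Q σ' t') σ (t + 1)) :
    WP1 A M (.seq p q) Q σ t := by
  intro hb k
  refine exists_run_of_step (c' := σ.cfg (p :: q :: k)) rfl
    ⟨by simp [Config.address, Mach.cfg], hb⟩ ?_
  exact exists_run_trans (h hb (q :: k)) fun σ' t' hb' h' => h' hb' k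

theorem wp1_ite {b : Test} (h₁ : b.holds σ.reg = true → WP1 A M p Q σ (t + 1))
    (h₂ : b.holds σ.reg = false → WP1 A M q Q σ (t + 1)) : WP1 A M (.ite b p q) Q σ t := by
  intro hb k
  refine exists_run_of_step (c' := σ.cfg ((if b.holds σ.reg then p else q) :: k)) rfl
    ⟨by simp [Config.address, Mach.cfg], hb⟩ ?_
  cases h : b.holds σ.reg
  · simpa using h₂ h hb k
  · simpa using h₁ h hb k

/-- The rule for loops, with an invariant that contains a variant. -/
theorem wp1_while {b : Test} (I : ℕ → Mach → ℕ → Prop) {v : ℕ} (h0 : I v σ t)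
    (h1 : ∀ v σ t, I v σ t → b.holds σ.reg = true →
      WP1 A M p (fun σ' t' => ∃ v' < v, I v' σ' t') σ (t + 1))
    (h2 : ∀ v σ t, I v σ t → b.holds σ.reg = false → Q σ (t + 1)) :
    WP1 A M (.while b p) Q σ t := by
  induction v using Nat.strong_induction_on generalizing σ t with
  | _ v ih =>
    intro hb k
    cases h : b.holds σ.reg
    · refine exists_run_of_step (c' := σ.cfg k) ?_ ⟨by simp [Config.address, Mach.cfg], hb⟩
        ⟨0, σ, rfl, by simp, hb, h2 v σ t h0 h⟩
      simp [Config.step, Mach.cfg, h]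
    · refine exists_run_of_step (c' := σ.cfg (p :: .while b p :: k)) ?_
        ⟨by simp [Config.address, Mach.cfg], hb⟩ ?_
      · simp [Config.step, Mach.cfg, h]
      · exact exists_run_trans (R := fun σ' t' => ∃ v' < v, I v' σ' t') (h1 v σ t h0 h hb _)
          fun σ' t' hb' ⟨v', hv', hI⟩ => ih v' hv' hI hb' k

end RawLogic

/-! ### Programs with named registers and arrays -/

/-- The registers of the enumeration program. -/
inductive Reg where
  /-- constants and data of the instance -/
  | zero | one | two | size | target | cap
  /-- the current call -/
  | base | lim | depth | parity | fin | plen | bound | found | pos | low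
  /-- temporary values -/
  | val | flag | mark | arc | top | vtx | nbr | ctr
  deriving DecidableEq

/-- The arrays of the enumeration program: the input; for every vertex the first arc of the list
of the arcs that enter it, and for every arc the next one in its list; for every arc whether it is
deleted; for every vertex whether it is blocked, how many of its arcs lead to reached vertices, and
the arc through which it was reached; the worklist of the search; the vertices and the arcs of the
current path; the deleted arc and the start position of every suspended call. -/
inductive Arr where
  | inp | first | nxt | del | blk | cnt | par | work | path | arcAt | stackArc | stackBase
  deriving DecidableEq

/-- The place of an array in the memory. -/
def Arr.pos : Arr → ℕ
  | .inp => 0 | .first => 1 | .nxt => 2 | .del => 3 | .blk => 4 | .cnt => 5 | .par => 6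
  | .work => 7 | .path => 8 | .arcAt => 9 | .stackArc => 10 | .stackBase => 11

/-- The machine register that holds the first address of an array. Machine register `0` is
reserved for the computation of addresses. -/
def Arr.idx (A : Arr) : ℕ := 1 + A.pos

/-- The machine register for a named register. -/
def Reg.idx : Reg → ℕ
  | .zero => 13 | .one => 14 | .two => 15 | .size => 16 | .target => 17 | .cap => 18
  | .base => 19 | .lim => 20 | .depth => 21 | .parity => 22 | .fin => 23 | .plen => 24
  | .bound => 25 | .found => 26 | .pos => 27 | .low => 28 | .val => 29 | .flag => 30
  | .mark => 31 | .arc => 32 | .top => 33 | .vtx => 34 | .nbr => 35 | .ctr => 36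

theorem Arr.pos_le (A : Arr) : A.pos ≤ 11 := by cases A <;> decide

theorem Arr.pos_injective : Function.Injective Arr.pos := by
  intro A B h
  cases A <;> cases B <;> first | rfl | exact absurd h (by decide)

theorem Reg.idx_ge (x : Reg) : 13 ≤ x.idx := by cases x <;> decide

theorem Reg.idx_injective : Function.Injective Reg.idx := by
  intro x y h
  have : ∀ z : Reg, z = (match z.idx with
    | 13 => .zero | 14 => .one | 15 => .two | 16 => .size | 17 => .target | 18 => .cap
    | 19 => .base | 20 => .lim | 21 => .depth | 22 => .parity | 23 => .fin | 24 => .plen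
    | 25 => .bound | 26 => .found | 27 => .pos | 28 => .low | 29 => .val | 30 => .flag
    | 31 => .mark | 32 => .arc | 33 => .top | 34 => .vtx | 35 => .nbr | _ => .ctr : Reg) := by
    intro z; cases z <;> rfl
  rw [this x, this y, h]

/-- Tests on named registers. -/
inductive Cond where
  | lt (x y : Reg)
  | eq (x y : Reg)

/-- Programs with named registers and arrays: `ld x A y` is `x := A[y]`, `st A x y` is
`A[x] := y`. -/
inductive Cmd where
  | skip
  | const (x : Reg) (c : ℕ)
  | copy (x y : Reg)
  | add (x y z : Reg)
  | sub (x y z : Reg)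
  | ld (x : Reg) (A : Arr) (y : Reg)
  | st (A : Arr) (x y : Reg)
  | write (x : Reg)
  | endSol
  | seq (p q : Cmd)
  | ite (b : Cond) (p q : Cmd)
  | while (b : Cond) (p : Cmd)

def Cond.compile : Cond → Test
  | .lt x y => .lt x.idx y.idx
  | .eq x y => .eq x.idx y.idx

/-- The machine program: an array access takes an address computation and a memory access. -/
def Cmd.compile : Cmd → Prog
  | .skip => .skip
  | .const x c => .const x.idx c
  | .copy x y => .copy x.idx y.idx
  | .add x y z => .add x.idx y.idx z.idx
  | .sub x y z => .sub x.idx y.idx z.idx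
  | .ld x A y => .seq (.add 0 A.idx y.idx) (.load x.idx 0)
  | .st A x y => .seq (.add 0 A.idx x.idx) (.store 0 y.idx)
  | .write x => .write x.idx
  | .endSol => .endSolution
  | .seq p q => .seq p.compile q.compile
  | .ite b p q => .ite b.compile p.compile q.compile
  | .while b p => .while b.compile p.compile

/-- The state of a program with named registers and arrays. -/
structure Store where
  reg : Reg → ℕ
  arr : Arr → ℕ → ℕ
  current : List ℕ
  out : List (List ℕ)

namespace Store

/-- Assign to a register. -/
def setR (s : Store) (x : Reg) (a : ℕ) : Store := { s with reg := Function.update s.reg x a }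

/-- Assign to an array entry. -/
def setA (s : Store) (A : Arr) (i a : ℕ) : Store :=
  { s with arr := Function.update s.arr A (Function.update (s.arr A) i a) }

/-- Write a word of the current solution. -/
def emit (s : Store) (a : ℕ) : Store := { s with current := s.current ++ [a] }

/-- End the current solution. -/
def finish (s : Store) : Store := { s with current := [], out := s.out ++ [s.current] }

variable (s : Store) (x y : Reg) (A B : Arr) (i a : ℕ)

@[simp] theorem reg_setR : (s.setR x a).reg y = if y = x then a else s.reg y := by
  simp [setR, Function.update_apply]
@[simp] theorem arr_setR : (s.setR x a).arr = s.arr := rfl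
@[simp] theorem current_setR : (s.setR x a).current = s.current := rfl
@[simp] theorem out_setR : (s.setR x a).out = s.out := rfl
@[simp] theorem reg_setA : (s.setA A i a).reg = s.reg := rfl
@[simp] theorem arr_setA :
    (s.setA A i a).arr B = if B = A then Function.update (s.arr A) i a else s.arr B := by
  simp [setA, Function.update_apply]
@[simp] theorem current_setA : (s.setA A i a).current = s.current := rfl
@[simp] theorem out_setA : (s.setA A i a).out = s.out := rfl
@[simp] theorem reg_emit : (s.emit a).reg = s.reg := rfl
@[simp] theorem arr_emit : (s.emit a).arr = s.arr := rfl
@[simp] theorem current_emit : (s.emit a).current = s.current ++ [a] := rfl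
@[simp] theorem out_emit : (s.emit a).out = s.out := rfl
@[simp] theorem reg_finish : s.finish.reg = s.reg := rfl
@[simp] theorem arr_finish : s.finish.arr = s.arr := rfl
@[simp] theorem current_finish : s.finish.current = [] := rfl
@[simp] theorem out_finish : s.finish.out = s.out ++ [s.current] := rfl

end Store

def Cond.Holds (s : Store) : Cond → Prop
  | .lt x y => s.reg x < s.reg y
  | .eq x y => s.reg x = s.reg y

/-- `σ` represents `s`: every array has length `N`, array number `j` starts at address `j * N`,
and words are below `M`. -/
structure Rep (N M : ℕ) (s : Store) (σ : Mach) : Prop where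
  four_le : 4 ≤ N
  bound : 12 * N ≤ M
  reg : ∀ x : Reg, σ.reg x.idx = s.reg x
  base : ∀ A : Arr, σ.reg A.idx = A.pos * N
  mem : ∀ A : Arr, ∀ i < N, σ.mem (A.pos * N + i) = s.arr A i
  current : σ.current = s.current
  out : σ.out = s.out

/-- Total correctness of programs with named registers and arrays. -/
def WP (N M : ℕ) (p : Cmd) (Q : Store → ℕ → Prop) (s : Store) (t : ℕ) : Prop :=
  ∀ σ, Rep N M s σ →
    WP1 (12 * N) M p.compile (fun σ' t' => ∃ s', Rep N M s' σ' ∧ Q s' t') σ t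

/-- Verification conditions: a sufficient condition for total correctness that is computed from
the program text, except that loops are left to the loop rule. -/
def vc (N M : ℕ) : Cmd → (Store → ℕ → Prop) → Store → ℕ → Prop
  | .skip, Q, s, t => Q s (t + 1)
  | .const x c, Q, s, t => c ≤ 4 ∧ Q (s.setR x c) (t + 1)
  | .copy x y, Q, s, t => Q (s.setR x (s.reg y)) (t + 1)
  | .add x y z, Q, s, t =>
      s.reg y + s.reg z ≤ 2 * N ∧ Q (s.setR x (s.reg y + s.reg z)) (t + 1)
  | .sub x y z, Q, s, t => Q (s.setR x (s.reg y - s.reg z)) (t + 1)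
  | .ld x A y, Q, s, t => s.reg y < N ∧ Q (s.setR x (s.arr A (s.reg y))) (t + 3)
  | .st A x y, Q, s, t => s.reg x < N ∧ Q (s.setA A (s.reg x) (s.reg y)) (t + 3)
  | .write x, Q, s, t => Q (s.emit (s.reg x)) (t + 1)
  | .endSol, Q, s, t => Q s.finish (t + 1)
  | .seq p q, Q, s, t => vc N M p (fun s' t' => vc N M q Q s' t') s (t + 1)
  | .ite b p q, Q, s, t =>
      (b.Holds s → vc N M p Q s (t + 1)) ∧ (¬ b.Holds s → vc N M q Q s (t + 1))
  | .while b p, Q, s, t => WP N M (.while b p) Q s t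

section Soundness

variable {N M : ℕ} {s : Store} {σ : Mach}

theorem Rep.holds_iff (h : Rep N M s σ) (b : Cond) :
    b.compile.holds σ.reg = true ↔ b.Holds s := by
  cases b <;> simp [Cond.compile, Test.holds, Cond.Holds, h.reg]

theorem Rep.setR (h : Rep N M s σ) (x : Reg) (a : ℕ) :
    Rep N M (s.setR x a) { σ with reg := Function.update σ.reg x.idx a } := by
  refine ⟨h.four_le, h.bound, ?_, ?_, h.mem, h.current, h.out⟩
  · intro y
    by_cases hy : y = x
    · simp [hy]
    · simp [hy, Reg.idx_injective.ne hy, h.reg]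
  · intro A
    have h1 := A.pos_le
    have h2 := x.idx_ge
    have : A.idx ≠ x.idx := by unfold Arr.idx; omega
    simp [this, h.base]

/-- Register `0` holds addresses and belongs to no named register. -/
theorem Rep.setTmp (h : Rep N M s σ) (a : ℕ) :
    Rep N M s { σ with reg := Function.update σ.reg 0 a } := by
  refine ⟨h.four_le, h.bound, ?_, ?_, h.mem, h.current, h.out⟩
  · intro y
    have := y.idx_ge
    simp [show y.idx ≠ 0 by omega, h.reg]
  · intro A
    have : A.idx ≠ 0 := by unfold Arr.idx; omega
    simp [this, h.base]

theorem Arr.address_inj {A B : Arr} {i j : ℕ} (hi : i < N) (hj : j < N)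
    (h : A.pos * N + i = B.pos * N + j) : A = B ∧ i = j := by
  have h1 : (A.pos * N + i) / N = A.pos := by
    rw [mul_comm, Nat.mul_add_div (by omega), Nat.div_eq_of_lt hi, add_zero]
  have h2 : (B.pos * N + j) / N = B.pos := by
    rw [mul_comm, Nat.mul_add_div (by omega), Nat.div_eq_of_lt hj, add_zero]
  have h3 : A.pos = B.pos := by rw [← h1, h, h2]
  rw [h3] at h
  exact ⟨Arr.pos_injective h3, by omega⟩

theorem Rep.setA (h : Rep N M s σ) (A : Arr) {i : ℕ} (hi : i < N) (a : ℕ) :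
    Rep N M (s.setA A i a) { σ with mem := Function.update σ.mem (A.pos * N + i) a } := by
  refine ⟨h.four_le, h.bound, h.reg, h.base, ?_, h.current, h.out⟩
  intro B j hj
  simp only [Function.update_apply, Store.arr_setA]
  by_cases hBA : B = A
  · subst hBA
    by_cases hij : j = i
    · simp [hij]
    · simp [hij, h.mem B j hj]
  · rw [if_neg fun e => hBA (Arr.address_inj hj hi e).1, if_neg hBA, h.mem B j hj]

theorem Arr.address_lt (A : Arr) {i : ℕ} (hi : i < N) : A.pos * N + i < 12 * N := by
  have := Nat.mul_le_mul_right N A.pos_le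
  omega

theorem vc_sound (p : Cmd) (Q : Store → ℕ → Prop) (s : Store) (t : ℕ) (h : vc N M p Q s t) :
    WP N M p Q s t := by
  induction p generalizing Q s t with
  | skip => exact fun σ hσ => wp1_skip ⟨s, hσ, h⟩
  | const x c =>
    intro σ hσ
    have h1 := hσ.four_le
    have h2 := hσ.bound
    exact wp1_const (by have := h.1; omega) ⟨_, hσ.setR x c, h.2⟩
  | copy x y =>
    intro σ hσ
    exact wp1_copy ⟨_, hσ.setR x _, by rw [hσ.reg]; exact h⟩
  | add x y z =>
    intro σ hσ
    have h1 := hσ.four_le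
    have h2 := hσ.bound
    have h3 := h.1
    refine wp1_add ?_ ⟨_, hσ.setR x _, ?_⟩
    · rw [hσ.reg, hσ.reg]; omega
    · rw [hσ.reg, hσ.reg]; exact h.2
  | sub x y z =>
    intro σ hσ
    refine wp1_sub ⟨_, hσ.setR x _, ?_⟩
    rw [hσ.reg, hσ.reg]; exact h
  | ld x A y =>
    intro σ hσ
    have h1 := hσ.four_le
    have h2 := hσ.bound
    have h3 := A.address_lt h.1
    refine wp1_seq (wp1_add ?_ (wp1_load ?_ ?_))
    · rw [hσ.base, hσ.reg]; omega
    · simpa [hσ.base, hσ.reg] using h3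
    · refine ⟨_, (hσ.setTmp _).setR x _, ?_⟩
      simp only [Function.update_self]
      rw [hσ.base, hσ.reg, hσ.mem A _ h.1]
      exact h.2
  | st A x y =>
    intro σ hσ
    have h1 := hσ.four_le
    have h2 := hσ.bound
    have h3 := A.address_lt h.1
    have hy : y.idx ≠ 0 := by have := y.idx_ge; omega
    refine wp1_seq (wp1_add ?_ (wp1_store ?_ ?_))
    · rw [hσ.base, hσ.reg]; omega
    · simpa [hσ.base, hσ.reg] using h3
    · refine ⟨_, ?_, h.2⟩
      have := (hσ.setTmp (A.pos * N + s.reg x)).setA A h.1 (s.reg y)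
      simpa [hσ.base, hσ.reg, hy] using this
  | write x =>
    intro σ hσ
    refine wp1_write ⟨_, ?_, h⟩
    exact ⟨hσ.four_le, hσ.bound, hσ.reg, hσ.base, hσ.mem, by simp [hσ.current, hσ.reg], hσ.out⟩
  | endSol =>
    intro σ hσ
    refine wp1_endSolution ⟨_, ?_, h⟩
    exact ⟨hσ.four_le, hσ.bound, hσ.reg, hσ.base, hσ.mem, rfl, by simp [hσ.current, hσ.out]⟩
  | seq p q ihp ihq =>
    intro σ hσ
    refine wp1_seq (wp1_mono (ihp _ _ _ h σ hσ) ?_)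
    rintro σ' t' ⟨s', hs', h'⟩
    exact ihq _ _ _ h' σ' hs'
  | ite b p q ihp ihq =>
    intro σ hσ
    refine wp1_ite (fun hb => ihp _ _ _ (h.1 ((hσ.holds_iff b).1 hb)) σ hσ)
      (fun hb => ihq _ _ _ (h.2 fun hb' => ?_) σ hσ)
    rw [(hσ.holds_iff b).2 hb'] at hb
    exact absurd hb (by decide)
  | _ => exact h

/-- The rule for loops, with an invariant that contains a variant. -/
theorem vc_while {b : Cond} {p : Cmd} {Q : Store → ℕ → Prop} {t : ℕ}
    (I : ℕ → Store → ℕ → Prop) {v : ℕ} (h0 : I v s t)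
    (h1 : ∀ v s t, I v s t → b.Holds s →
      vc N M p (fun s' t' => ∃ v' < v, I v' s' t') s (t + 1))
    (h2 : ∀ v s t, I v s t → ¬ b.Holds s → Q s (t + 1)) :
    vc N M (.while b p) Q s t := by
  intro σ hσ
  refine wp1_while (fun v σ t => ∃ s, Rep N M s σ ∧ I v s t) ⟨s, hσ, h0⟩ ?_ ?_
  · rintro v σ t ⟨s, hs, hI⟩ hb
    refine wp1_mono (vc_sound _ _ _ _ (h1 v s t hI ((hs.holds_iff b).1 hb)) σ hs) ?_
    rintro σ' t' ⟨s', hs', v', hv', hI'⟩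
    exact ⟨v', hv', s', hs', hI'⟩
  · rintro v σ t ⟨s, hs, hI⟩ hb
    refine ⟨s, hs, h2 v s t hI fun hb' => ?_⟩
    rw [(hs.holds_iff b).2 hb'] at hb
    exact absurd hb (by decide)

end Soundness

/-! ### Backward search -/

/-- A directed graph given by a list of arc names, with the tail and the head of every arc. The
number `0` names no arc. -/
structure Net (n : ℕ) where
  D : Digraph (Fin n)
  ids : List ℕ
  tl : ℕ → Fin n
  hd : ℕ → Fin n
  nodup : ids.Nodup
  ne_zero : ∀ q ∈ ids, q ≠ 0
  adj_iff : ∀ u v, D.Adj u v ↔ ∃ q ∈ ids, tl q = u ∧ hd q = v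
  inj : ∀ q ∈ ids, ∀ q' ∈ ids, tl q = tl q' → hd q = hd q' → q = q'

/-- The arcs that enter a vertex, in the order in which the search scans them. -/
def Net.ins {n : ℕ} (G : Net n) (y : Fin n) : List ℕ := (G.ids.filter fun q => G.hd q = y).reverse

/-- The state of a backward search: `cnt z` is the number, capped at `2`, of scanned arcs that
leave `z`, and it is also positive for a vertex at which the search was started; `par z` is the
arc through which `z` was reached; `work` lists the vertices that are still to be expanded, and
`arcs` lists the arcs that are still to be scanned for the vertex being expanded. -/
structure SearchState (n : ℕ) where
  cnt : Fin n → ℕ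
  par : Fin n → ℕ
  work : List (Fin n)
  arcs : List ℕ

section Search

variable {n : ℕ} (G : Net n) (D' : Digraph (Fin n)) (X : List (Fin n)) {t : Fin n}

open Classical in
/-- One step of the search in the subgraph `D'`: blocked vertices, those in `X`, are counted but
not reached. -/
noncomputable def searchStep (x : SearchState n) : SearchState n :=
  match x.arcs with
  | [] =>
    match x.work with
    | [] => x
    | y :: W => { x with work := W, arcs := G.ins y }
  | q :: l =>
    if D'.Adj (G.tl q) (G.hd q) then
      if x.cnt (G.tl q) = 0 then
        if G.tl q ∈ X then
          { x with cnt := Function.update x.cnt (G.tl q) 1, arcs := l }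
        else
          { cnt := Function.update x.cnt (G.tl q) 1
            par := Function.update x.par (G.tl q) q
            work := G.tl q :: x.work
            arcs := l }
      else
        { x with cnt := Function.update x.cnt (G.tl q) 2, arcs := l }
    else
      { x with arcs := l }

/-- `l` is the path that starts in `z` and follows the arcs in `par` until there is none. -/
inductive Follows (par : Fin n → ℕ) : Fin n → List (Fin n) → Prop
  | last {z : Fin n} (h : par z = 0) : Follows par z [z]
  | step {z : Fin n} {l : List (Fin n)} (h : par z ∈ G.ids) (htl : G.tl (par z) = z)
      (hl : Follows par (G.hd (par z)) l) : Follows par z (z :: l)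

variable {G D' X}

theorem Follows.update {par : Fin n → ℕ} {z x : Fin n} {a : ℕ} {l : List (Fin n)}
    (h : Follows G par z l) (hx : x ∉ l) : Follows G (Function.update par x a) z l := by
  induction h with
  | last h => exact .last (by rwa [Function.update_of_ne fun e => hx (by simp [e])])
  | @step z l h htl _ ih =>
    have hz : z ≠ x := fun e => hx (by simp [e])
    have he : Function.update par x a z = par z := Function.update_of_ne hz _ _
    refine .step (by rwa [he]) (by rwa [he]) ?_
    rw [he]
    exact ih fun hm => hx (List.mem_cons_of_mem _ hm)

variable (G D' X t)

open Classical in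
/-- The invariant of the search; `Pd` is the set of expanded vertices and `Pq` the set of scanned
arcs. The last clause says that the arcs in `par` lead from every reached vertex to `t`. -/
structure SearchInv (x : SearchState n) (Pd : Finset (Fin n)) (Pq : Finset ℕ) : Prop where
  work_nodup : x.work.Nodup
  arcs_nodup : x.arcs.Nodup
  disj : ∀ z ∈ x.work, z ∉ Pd
  reached_iff : ∀ z, (z ∉ X ∧ x.cnt z ≠ 0) ↔ z ∈ x.work ∨ z ∈ Pd
  arcs_mem : ∀ q ∈ x.arcs, q ∈ G.ids ∧ G.hd q ∈ Pd
  scanned_iff : ∀ q, q ∈ Pq ↔ q ∈ G.ids ∧ G.hd q ∈ Pd ∧ q ∉ x.arcs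
  cnt_ne : ∀ q ∈ Pq, D'.Adj (G.tl q) (G.hd q) → x.cnt (G.tl q) ≠ 0
  cnt_eq : ∀ z ∈ X, x.cnt z = min 2 (Pq.filter fun q => G.tl q = z ∧ D'.Adj z (G.hd q)).card
  target : t ∉ X ∧ x.cnt t ≠ 0
  follows : ∀ z ∉ X, x.cnt z ≠ 0 →
    ∃ l, Follows G x.par z l ∧ IsPathAvoiding D' X z t l ∧ ∀ y ∈ l, x.cnt y ≠ 0

/-- The search invariant after `k` steps. -/
def SearchInvAt (x : SearchState n) (k : ℕ) : Prop :=
  ∃ Pd Pq, SearchInv G D' X t x Pd Pq ∧ Pd.card + Pq.card = k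

/-- The search is finished. -/
def SearchState.Done (x : SearchState n) : Prop := x.work = [] ∧ x.arcs = []

variable {G D' X t} {x : SearchState n} {k : ℕ}

theorem SearchInvAt.le (h : SearchInvAt G D' X t x k) : k ≤ n + G.ids.length := by
  obtain ⟨Pd, Pq, h, rfl⟩ := h
  have h1 : Pd.card ≤ n := by simpa using Finset.card_le_univ Pd
  have h2 : Pq.card ≤ G.ids.length := by
    rw [← List.toFinset_card_of_nodup G.nodup]
    exact Finset.card_le_card fun q hq => by simpa using ((h.scanned_iff q).1 hq).1
  omega

theorem SearchInvAt.length_work_le (h : SearchInvAt G D' X t x k) : x.work.length ≤ n := by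
  obtain ⟨Pd, Pq, h, rfl⟩ := h
  simpa using h.work_nodup.length_le_card

/-- Reaching a new vertex through an arc to a reached vertex keeps the paths in `par` valid. -/
theorem follows_update {cnt par cnt' : Fin n → ℕ} {z : Fin n} {q : ℕ} (hq : q ∈ G.ids)
    (htl : G.tl q = z) (hadj : D'.Adj z (G.hd q)) (hz : z ∉ X)
    (hz0 : ∀ y, y ≠ z → cnt y ≠ 0 → cnt' y ≠ 0) (hz1 : cnt' z ≠ 0)
    (h : ∀ y ∉ X, y ≠ z → cnt' y ≠ 0 → ∃ l, Follows G par y l ∧ IsPathAvoiding D' X y t l ∧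
      ∀ y' ∈ l, y' ≠ z ∧ cnt y' ≠ 0)
    (hhd : ∃ l, Follows G par (G.hd q) l ∧ IsPathAvoiding D' X (G.hd q) t l ∧
      ∀ y' ∈ l, y' ≠ z ∧ cnt y' ≠ 0) :
    ∀ y ∉ X, cnt' y ≠ 0 → ∃ l, Follows G (Function.update par z q) y l ∧
      IsPathAvoiding D' X y t l ∧ ∀ y' ∈ l, cnt' y' ≠ 0 := by
  intro y hy hy0
  by_cases hyz : y = z
  · subst hyz
    obtain ⟨l, h1, h2, h3⟩ := hhd
    have hzl : y ∉ l := fun hm => (h3 y hm).1 rfl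
    refine ⟨y :: l, ?_, h2.cons hadj hzl hz, ?_⟩
    · refine .step (by simpa using hq) (by simpa using htl) ?_
      simpa using h1.update hzl
    · intro y' hy'
      rcases List.mem_cons.1 hy' with rfl | hy'
      · exact hz1
      · exact hz0 _ (h3 _ hy').1 (h3 _ hy').2
  · obtain ⟨l, h1, h2, h3⟩ := h y hy hyz hy0
    exact ⟨l, h1.update fun hm => (h3 z hm).1 rfl, h2,
      fun y' hy' => hz0 _ (h3 _ hy').1 (h3 _ hy').2⟩

/-- A search step preserves the invariant and uses up either a vertex to be expanded or an arc to
be scanned; this is why a search takes linear time. -/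
theorem searchInvAt_step (h : SearchInvAt G D' X t x k) (hx : ¬ x.Done) :
    SearchInvAt G D' X t (searchStep G D' X x) (k + 1) := by
  classical
  obtain ⟨Pd, Pq, h, rfl⟩ := h
  obtain ⟨cnt, par, work, arcs⟩ := x
  rcases arcs with _ | ⟨q, arcs⟩
  · rcases work with _ | ⟨y, W⟩
    · exact absurd ⟨rfl, rfl⟩ hx
    · have hy : y ∉ Pd := h.disj y (by simp)
      have hW := List.nodup_cons.1 h.work_nodup
      refine ⟨insert y Pd, Pq, ?_, by rw [Finset.card_insert_of_notMem hy]; omega⟩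
      have hs := h.scanned_iff
      refine ⟨hW.2, ?_, ?_, ?_, ?_, ?_, h.cnt_ne, h.cnt_eq, h.target, h.follows⟩
      · exact List.nodup_reverse.2 (G.nodup.filter _)
      · intro z hz
        rw [Finset.mem_insert, not_or]
        exact ⟨fun e => hW.1 (e ▸ hz), h.disj z (List.mem_cons_of_mem _ hz)⟩
      · intro z
        have := h.reached_iff z
        simp only [searchStep, Finset.mem_insert]
        simp only [List.mem_cons] at this
        rw [this]
        tauto
      · intro q hq
        have : q ∈ G.ids ∧ G.hd q = y := by simpa [searchStep, Net.ins] using hq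
        exact ⟨this.1, by simp [this.2]⟩
      · intro q
        have h1 := hs q
        simp only [List.not_mem_nil, not_false_eq_true, and_true] at h1
        simp only [searchStep, Net.ins, List.mem_reverse, List.mem_filter, decide_eq_true_eq,
          Finset.mem_insert, h1]
        constructor
        · rintro ⟨h2, h3⟩
          exact ⟨h2, Or.inr h3, fun h4 => hy (h4.2 ▸ h3)⟩
        · rintro ⟨h2, h3 | h3, h4⟩
          · exact absurd ⟨h2, h3⟩ h4
          · exact ⟨h2, h3⟩
  · have hA := List.nodup_cons.1 h.arcs_nodup
    have hq := h.arcs_mem q (by simp)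
    have hqP : q ∉ Pq := fun hm => ((h.scanned_iff q).1 hm).2.2 (by simp)
    have hscan : ∀ q', q' ∈ insert q Pq ↔ q' ∈ G.ids ∧ G.hd q' ∈ Pd ∧ q' ∉ arcs := by
      intro q'
      rw [Finset.mem_insert, h.scanned_iff, List.mem_cons, not_or]
      constructor
      · rintro (rfl | h1)
        · exact ⟨hq.1, hq.2, hA.1⟩
        · exact ⟨h1.1, h1.2.1, h1.2.2.2⟩
      · rintro ⟨h1, h2, h3⟩
        by_cases e : q' = q
        · exact Or.inl e
        · exact Or.inr ⟨h1, h2, e, h3⟩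
    have harcs : ∀ q' ∈ arcs, q' ∈ G.ids ∧ G.hd q' ∈ Pd :=
      fun q' h' => h.arcs_mem q' (List.mem_cons_of_mem _ h')
    have hhd := (h.reached_iff (G.hd q)).2 (Or.inr hq.2)
    refine ⟨Pd, insert q Pq, ?_, by rw [Finset.card_insert_of_notMem hqP]; omega⟩
    -- the counter of a blocked vertex after the arc `q` has been scanned
    have hcard : ∀ z, ((insert q Pq).filter fun q => G.tl q = z ∧ D'.Adj z (G.hd q)).card =
        (Pq.filter fun q => G.tl q = z ∧ D'.Adj z (G.hd q)).card +
          (if G.tl q = z ∧ D'.Adj z (G.hd q) then 1 else 0) := by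
      intro z
      rw [Finset.filter_insert]
      split_ifs with hc
      · rw [Finset.card_insert_of_notMem (by simp [hqP])]
      · rfl
    simp only [searchStep]
    split_ifs with hadj h0 hX
    · -- a blocked vertex is met for the first time
      have htz : t ≠ G.tl q := fun e => h.target.1 (e ▸ hX)
      refine ⟨h.work_nodup, hA.2, h.disj, ?_, harcs, hscan, ?_, ?_, ?_, ?_⟩
      · intro z
        rw [← h.reached_iff]
        by_cases hz : z = G.tl q
        · subst hz; simp [hX]
        · simp [hz]
      · intro q' hq' hadj'
        by_cases hz : G.tl q' = G.tl q
        · simp [hz]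
        · rw [Finset.mem_insert] at hq'
          rcases hq' with rfl | hq'
          · exact absurd rfl hz
          · simpa [hz] using h.cnt_ne q' hq' hadj'
      · intro z hz
        have h1 := h.cnt_eq z hz
        dsimp only at h1 ⊢
        rw [hcard]
        by_cases hzq : z = G.tl q
        · subst hzq
          simp only [Function.update_self, true_and, hadj, if_true]
          omega
        · rw [Function.update_of_ne hzq, h1, if_neg fun e => hzq e.1.symm, add_zero]
      · exact ⟨h.target.1, by simpa [htz] using h.target.2⟩
      · intro z hz hz0
        have hzq : z ≠ G.tl q := fun e => hz (e ▸ hX)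
        obtain ⟨l, h1, h2, h3⟩ := h.follows z hz (by simpa [hzq] using hz0)
        refine ⟨l, h1, h2, fun y hy => ?_⟩
        by_cases hyq : y = G.tl q
        · simp [hyq]
        · simpa [hyq] using h3 y hy
    · -- a new vertex is reached
      have hnew : G.tl q ∉ work ∧ G.tl q ∉ Pd := by
        have := (h.reached_iff (G.tl q)).not.1 (by simp [hX, h0])
        simpa [not_or] using this
      have htz : t ≠ G.tl q := fun e => h.target.2 (e ▸ h0)
      refine ⟨List.nodup_cons.2 ⟨hnew.1, h.work_nodup⟩, hA.2, ?_, ?_, harcs, hscan, ?_, ?_, ?_, ?_⟩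
      · intro z hz
        rcases List.mem_cons.1 hz with rfl | hz
        · exact hnew.2
        · exact h.disj z hz
      · intro z
        by_cases hz : z = G.tl q
        · subst hz; simp [hX]
        · have := h.reached_iff z
          simp only [List.mem_cons, hz, false_or]
          rw [← this]
          simp [hz]
      · intro q' hq' hadj'
        by_cases hz : G.tl q' = G.tl q
        · simp [hz]
        · rw [Finset.mem_insert] at hq'
          rcases hq' with rfl | hq'
          · exact absurd rfl hz
          · simpa [hz] using h.cnt_ne q' hq' hadj'
      · intro z hz
        have hzq : z ≠ G.tl q := fun e => hX (e ▸ hz)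
        have h1 := h.cnt_eq z hz
        dsimp only at h1 ⊢
        rw [hcard, Function.update_of_ne hzq, h1, if_neg fun e => hzq e.1.symm, add_zero]
      · exact ⟨h.target.1, by simpa [htz] using h.target.2⟩
      · have key : ∀ y ∉ X, cnt y ≠ 0 → ∃ l, Follows G par y l ∧ IsPathAvoiding D' X y t l ∧
            ∀ y' ∈ l, y' ≠ G.tl q ∧ cnt y' ≠ 0 := by
          intro y hy hy0
          obtain ⟨l, h1, h2, h3⟩ := h.follows y hy hy0
          exact ⟨l, h1, h2, fun y' hy' => ⟨fun e => h3 y' hy' (e ▸ h0), h3 y' hy'⟩⟩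
        exact follows_update hq.1 rfl hadj hX (fun y hy hy0 => by simpa [hy] using hy0) (by simp)
          (fun y hy hyz hy0 => key y hy (by simpa [hyz] using hy0)) (key _ hhd.1 hhd.2)
    · -- a further arc from a vertex that was met before
      have hne : ∀ z, Function.update cnt (G.tl q) 2 z ≠ 0 ↔ cnt z ≠ 0 := by
        intro z
        by_cases hz : z = G.tl q
        · subst hz; simpa using h0
        · simp [hz]
      refine ⟨h.work_nodup, hA.2, h.disj, ?_, harcs, hscan, ?_, ?_, ?_, ?_⟩
      · intro z
        dsimp only
        rw [hne]
        exact h.reached_iff z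
      · intro q' hq' hadj'
        dsimp only
        rw [hne]
        rw [Finset.mem_insert] at hq'
        rcases hq' with rfl | hq'
        · exact h0
        · exact h.cnt_ne q' hq' hadj'
      · intro z hz
        have h1 := h.cnt_eq z hz
        dsimp only at h1 ⊢
        rw [hcard]
        by_cases hzq : z = G.tl q
        · subst hzq
          simp only [Function.update_self, true_and, hadj, if_true]
          omega
        · rw [Function.update_of_ne hzq, h1, if_neg fun e => hzq e.1.symm, add_zero]
      · exact ⟨h.target.1, (hne t).2 h.target.2⟩
      · intro z hz hz0
        obtain ⟨l, h1, h2, h3⟩ := h.follows z hz ((hne z).1 hz0)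
        exact ⟨l, h1, h2, fun y hy => (hne y).2 (h3 y hy)⟩
    · -- a deleted arc
      refine ⟨h.work_nodup, hA.2, h.disj, h.reached_iff, harcs, hscan, ?_, ?_, h.target, h.follows⟩
      · intro q' hq' hadj'
        rw [Finset.mem_insert] at hq'
        rcases hq' with rfl | hq'
        · exact absurd hadj' hadj
        · exact h.cnt_ne q' hq' hadj'
      · intro z hz
        rw [hcard, if_neg, add_zero]
        · exact h.cnt_eq z hz
        · rintro ⟨rfl, h1⟩
          exact hadj h1

/-- The search begins at the target. -/
noncomputable def SearchState.init (t : Fin n) : SearchState n where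
  cnt := Function.update (fun _ => 0) t 1
  par := fun _ => 0
  work := [t]
  arcs := []

theorem searchInvAt_init (ht : t ∉ X) : SearchInvAt G D' X t (.init t) 0 := by
  classical
  have hc : ∀ z, (SearchState.init t).cnt z ≠ 0 ↔ z = t := by
    intro z
    by_cases h : z = t
    · simp [SearchState.init, h]
    · simp [SearchState.init, h]
  refine ⟨∅, ∅, ⟨by simp [SearchState.init], by simp [SearchState.init], by simp, ?_,
    by simp [SearchState.init], by simp, by simp, ?_, ⟨ht, (hc t).2 rfl⟩, ?_⟩, rfl⟩
  · intro z
    rw [hc]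
    simp only [SearchState.init, List.mem_singleton, Finset.notMem_empty, or_false]
    exact ⟨fun h => h.2, fun h => ⟨h ▸ ht, h⟩⟩
  · intro z hz
    have : z ≠ t := fun e => ht (e ▸ hz)
    simpa using not_not.1 ((hc z).not.2 this)
  · intro z hz hz0
    obtain rfl := (hc z).1 hz0
    exact ⟨[z], .last rfl, .singleton _ hz, by simpa using hz0⟩

/-- Unblock the vertex `v`, whose arc `q` leads to a reached vertex, and continue the search
from there. -/
noncomputable def SearchState.restart (x : SearchState n) (v : Fin n) (q : ℕ) : SearchState n where
  cnt := Function.update x.cnt v 1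
  par := Function.update x.par v q
  work := [v]
  arcs := []

theorem searchInvAt_restart {v : Fin n} {q : ℕ} (h : SearchInvAt G D' (X ++ [v]) t x k)
    (hx : x.Done) (hv : v ∉ X) (hq : q ∈ G.ids) (htl : G.tl q = v) (hadj : D'.Adj v (G.hd q))
    (hr : G.hd q ∉ X ++ [v]) (hr' : x.cnt (G.hd q) ≠ 0) :
    SearchInvAt G D' X t (x.restart v q) k := by
  classical
  obtain ⟨Pd, Pq, h, rfl⟩ := h
  obtain ⟨cnt, par, work, arcs⟩ := x
  obtain ⟨rfl, rfl⟩ := hx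
  have hvP : v ∉ Pd := fun hm => ((h.reached_iff v).2 (Or.inr hm)).1 (by simp)
  have htv : t ≠ v := fun e => h.target.1 (by simp [e])
  have hne : ∀ z, z ≠ v → Function.update cnt v 1 z = cnt z :=
    fun z hz => Function.update_of_ne hz _ _
  refine ⟨Pd, Pq, ⟨by simp [SearchState.restart], by simp [SearchState.restart], ?_, ?_,
    by simp [SearchState.restart], by simpa [SearchState.restart] using h.scanned_iff, ?_, ?_, ?_,
    ?_⟩, rfl⟩
  · simpa [SearchState.restart] using hvP
  · intro z
    by_cases hz : z = v
    · subst hz; simp [SearchState.restart, hv]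
    · have := h.reached_iff z
      simpa [SearchState.restart, hz] using this
  · intro q' hq' hadj'
    by_cases hz : G.tl q' = v
    · simp [SearchState.restart, hz]
    · simpa [SearchState.restart, hz] using h.cnt_ne q' hq' hadj'
  · intro z hz
    have hzv : z ≠ v := fun e => hv (e ▸ hz)
    simpa [SearchState.restart, hzv] using h.cnt_eq z (by simp [hz])
  · refine ⟨fun hm => h.target.1 (by simp [hm]), ?_⟩
    simpa [SearchState.restart, htv] using h.target.2
  · have key : ∀ y ∉ X, y ≠ v → cnt y ≠ 0 → ∃ l, Follows G par y l ∧ IsPathAvoiding D' X y t l ∧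
        ∀ y' ∈ l, y' ≠ v ∧ cnt y' ≠ 0 := by
      intro y hy hyv hy0
      obtain ⟨l, h1, h2, h3⟩ := h.follows y (by simp [hy, hyv]) hy0
      refine ⟨l, h1, h2.mono (fun _ _ h => h) fun z hz hm => h2.avoids z hz (by simp [hm]),
        fun y' hy' => ⟨fun e => h2.avoids y' hy' (by simp [e]), h3 y' hy'⟩⟩
    have hr2 : G.hd q ∉ X ∧ G.hd q ≠ v := by simpa [not_or] using hr
    exact follows_update hq htl hadj hv (fun y hy hy0 => (hne y hy).trans_ne hy0)
      (by simp [SearchState.restart])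
      (fun y hy hyv hy0 => key y hy hyv (by simpa [SearchState.restart, hyv] using hy0))
      (key _ hr2.1 hr2.2 hr')

/-! ### What a finished search says -/

/-- The reached vertices are those that are joined to `t` outside `X`. -/
theorem reached_iff_exists_path (h : SearchInvAt G D' X t x k) (hx : x.Done)
    (hD : ∀ a b, D'.Adj a b → G.D.Adj a b) (z : Fin n) :
    (z ∉ X ∧ x.cnt z ≠ 0) ↔ ∃ l, IsPathAvoiding D' X z t l := by
  obtain ⟨Pd, Pq, h, rfl⟩ := h
  constructor
  · rintro ⟨h1, h2⟩
    obtain ⟨l, -, hl, -⟩ := h.follows z h1 h2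
    exact ⟨l, hl⟩
  · rintro ⟨l, hl⟩
    induction l generalizing z with
    | nil => simpa using hl.head
    | cons a l ih =>
      obtain rfl : a = z := by simpa using hl.head
      rcases l with _ | ⟨b, l⟩
      · obtain rfl : a = t := by simpa using hl.last
        exact h.target
      · have hb := ih b (hl.drop (i := 1) rfl)
        have hab : D'.Adj a b := (List.isChain_cons_cons.1 hl.chain).1
        obtain ⟨q, hq, rfl, rfl⟩ := (G.adj_iff a b).1 (hD a b hab)
        have hbP : G.hd q ∈ Pd := by simpa [hx.1] using (h.reached_iff _).1 hb
        refine ⟨hl.avoids _ (by simp), h.cnt_ne q ?_ hab⟩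
        rw [h.scanned_iff]
        exact ⟨hq, hbP, by simp [hx.2]⟩

/-- The test of the loop: with the first `i + 1` vertices of `Q` blocked, the vertex `v = Q[i]`
reaches `t` without its arc to `w = Q[i + 1]` if and only if at least two arcs from `v` lead to
reached vertices, one of them being the arc to `w`. -/
theorem branch_iff_cnt_eq_two {pre Q : List (Fin n)} {u v w : Fin n} {i : ℕ}
    (hQ : IsPathAvoiding D' pre u t Q) (hv : Q[i]? = some v) (hw : Q[i + 1]? = some w)
    (h : SearchInvAt G D' (pre ++ Q.take (i + 1)) t x k) (hx : x.Done)
    (hD : ∀ a b, D'.Adj a b → G.D.Adj a b) :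
    (∃ l, IsPathAvoiding (deleteArc D' v w) (pre ++ Q.take i) v t l) ↔ x.cnt v = 2 := by
  classical
  have hreach := reached_iff_exists_path h hx hD
  obtain ⟨Pd, Pq, h, rfl⟩ := h
  have htk : Q.take (i + 1) = Q.take i ++ [v] := by rw [List.take_add_one, hv]; rfl
  have hvX : v ∈ pre ++ Q.take (i + 1) := by simp [htk]
  have hcard := h.cnt_eq v hvX
  have hvw := hQ.adj_getElem hv hw
  have hmem : ∀ q, q ∈ Pq ↔
      q ∈ G.ids ∧ ∃ l, IsPathAvoiding D' (pre ++ Q.take (i + 1)) (G.hd q) t l := by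
    intro q
    rw [h.scanned_iff, ← hreach, h.reached_iff]
    simp [hx.1, hx.2]
  have hwpath : ∃ l, IsPathAvoiding D' (pre ++ Q.take (i + 1)) w t l :=
    ⟨_, hQ.drop_take hw⟩
  have hvt : v ≠ t := by
    rintro rfl
    have := hQ.getElem?_eq_last hv
    obtain ⟨h', -⟩ := List.getElem?_eq_some_iff.1 hw
    omega
  have htwo : x.cnt v = 2 ↔ 1 < (Pq.filter fun q => G.tl q = v ∧ D'.Adj v (G.hd q)).card := by
    omega
  rw [htwo, Finset.one_lt_card]
  constructor
  · rintro ⟨l, hl⟩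
    obtain ⟨l', rfl⟩ := hl.exists_cons
    rcases l' with _ | ⟨y, l'⟩
    · exact absurd (by simpa using hl.last) hvt
    · have hvy := hl.adj_getElem (i := 0) rfl rfl
      have hn := List.nodup_cons.1 hl.nodup
      have hy : ∃ l, IsPathAvoiding D' (pre ++ Q.take (i + 1)) y t l := by
        have hd : IsPathAvoiding (deleteArc D' v w) (pre ++ Q.take i) y t (y :: l') :=
          hl.drop (i := 1) rfl
        refine ⟨y :: l', hd.mono (fun _ _ h => h.1) fun z hz hm => ?_⟩
        rw [htk, ← List.append_assoc] at hm
        rcases List.mem_append.1 hm with hm | hm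
        · exact hd.avoids z hz hm
        · obtain rfl : z = v := by simpa using hm
          exact hn.1 hz
      obtain ⟨q, hq, hq1, hq2⟩ := (G.adj_iff v y).1 (hD _ _ hvy.1)
      obtain ⟨q', hq', hq1', hq2'⟩ := (G.adj_iff v w).1 (hD _ _ hvw)
      refine ⟨q, ?_, q', ?_, ?_⟩
      · rw [Finset.mem_filter, hmem]
        exact ⟨⟨hq, hq2 ▸ hy⟩, hq1, hq2 ▸ hvy.1⟩
      · rw [Finset.mem_filter, hmem]
        exact ⟨⟨hq', hq2' ▸ hwpath⟩, hq1', hq2' ▸ hvw⟩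
      · rintro rfl
        exact hvy.2 ⟨rfl, hq2.symm.trans hq2'⟩
  · rintro ⟨q, hq, q', hq', hne⟩
    rw [Finset.mem_filter, hmem] at hq hq'
    -- one of the two arcs has a head other than `w`
    have : ∃ y ≠ w, D'.Adj v y ∧ ∃ l, IsPathAvoiding D' (pre ++ Q.take (i + 1)) y t l := by
      by_cases hqw : G.hd q = w
      · refine ⟨G.hd q', fun e => hne ?_, hq'.2.2, hq'.1.2⟩
        exact G.inj q hq.1.1 q' hq'.1.1 (hq.2.1.trans hq'.2.1.symm) (hqw.trans e.symm)
      · exact ⟨G.hd q, hqw, hq.2.2, hq.1.2⟩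
    obtain ⟨y, hyw, hvy, l, hl⟩ := this
    have hvl : v ∉ l := fun hm => hl.avoids v hm hvX
    obtain ⟨l', rfl⟩ := hl.exists_cons
    refine ⟨v :: y :: l', rfl, by simpa using hl.last, ?_, List.nodup_cons.2 ⟨hvl, hl.nodup⟩, ?_⟩
    · refine List.isChain_cons_cons.2 ⟨⟨hvy, fun e => hyw e.2⟩, ?_⟩
      rw [List.isChain_iff_getElem]
      intro j hj
      refine ⟨List.isChain_iff_getElem.1 hl.chain j hj, fun e => hvl ?_⟩
      rw [← e.1]
      exact List.getElem_mem _
    · intro z hz hm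
      rcases List.mem_cons.1 hz with rfl | hz
      · rcases List.mem_append.1 hm with hm | hm
        · exact hQ.avoids z (List.mem_iff_getElem?.2 ⟨_, hv⟩) hm
        · obtain ⟨j, hj, he⟩ := List.mem_take_iff_getElem.1 hm
          have h2 := (List.getElem?_inj (by omega) hQ.nodup).1
            ((List.getElem?_eq_some_iff.2 ⟨by omega, he⟩).trans hv.symm)
          omega
      · refine hl.avoids z hz ?_
        rw [htk, ← List.append_assoc]
        exact List.mem_append_left _ hm

/-! ### The rule by which the program finds paths -/

variable (G D' X t)

/-- The state of the finished search from `t`. -/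
noncomputable def searchResult : SearchState n :=
  (searchStep G D' X)^[n + G.ids.length] (.init t)

variable {G D' X t}

theorem searchStep_of_done (hx : x.Done) : searchStep G D' X x = x := by
  obtain ⟨cnt, par, work, arcs⟩ := x
  obtain ⟨rfl, rfl⟩ := hx
  rfl

theorem eq_searchResult (h : SearchInvAt G D' X t x k) (hx : x.Done)
    (hk : x = (searchStep G D' X)^[k] (.init t)) : x = searchResult G D' X t := by
  obtain ⟨r, hr⟩ := Nat.exists_eq_add_of_le h.le
  rw [searchResult, hr, add_comm, Function.iterate_add_apply, ← hk,
    Function.iterate_fixed (searchStep_of_done hx)]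

open Classical in
/-- The rule by which the program finds paths: follow the arcs found by the backward search.
(For graphs that do not occur in the run of the program, any path will do.) -/
noncomputable def Net.find (G : Net n) (t : Fin n) : PathRule (Fin n) := fun D' X u =>
  if h : ∃ l, Follows G (searchResult G D' X t).par u l ∧ IsPathAvoiding D' X u t l then h.choose
  else if h : ∃ l, IsPathAvoiding D' X u t l then h.choose else []

theorem Net.find_valid (G : Net n) (t : Fin n) : (G.find t).Valid t := by
  intro D' X u h
  unfold Net.find
  split_ifs with h1
  · exact h1.choose_spec.2
  · exact h.choose_spec

theorem Net.follows_find {u : Fin n} (hinv : SearchInvAt G D' X t (searchResult G D' X t) k)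
    (hu : u ∉ X) (hu' : (searchResult G D' X t).cnt u ≠ 0) :
    Follows G (searchResult G D' X t).par u (G.find t D' X u) := by
  obtain ⟨Pd, Pq, hinv, -⟩ := hinv
  obtain ⟨l, h1, h2, -⟩ := hinv.follows u hu hu'
  have h : ∃ l, Follows G (searchResult G D' X t).par u l ∧ IsPathAvoiding D' X u t l :=
    ⟨l, h1, h2⟩
  unfold Net.find
  rw [dif_pos h]
  exact h.choose_spec.1

end Search

/-! ### The recursion as a walk through the tree of calls -/

section Tour

variable {V : Type*}

/-- A suspended call: it was made in the graph `D` with the path `pre ++ [u]`, and is waiting for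
the recursive call for the index `i` of its loop. -/
structure Frame (V : Type*) where
  D : Digraph V
  pre : List V
  u : V
  i : ℕ

/-- A moment in the run of the algorithm. In a running state, the call in the graph `D` with the
path `pre ++ [u]` either begins (`lim = none`) or has just handled the index `i` of its loop
(`lim = some i`); `stack` lists the suspended calls, so that its length is the recursion depth. -/
inductive TourState (V : Type*) where
  | run (stack : List (Frame V)) (D : Digraph V) (pre : List V) (u : V) (lim : Option ℕ)
      (out : List (List V))
  | halt (out : List (List V))

/-- The solutions that have been output so far. -/
def TourState.out : TourState V → List (List V)
  | .run _ _ _ _ _ out => out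
  | .halt out => out

def TourState.IsHalt : TourState V → Prop
  | .run _ _ _ _ _ _ => False
  | .halt _ => True

variable (find : PathRule V) (t : V)

/-- The loop makes a recursive call for the index `i`. -/
def Branches (D : Digraph V) (pre : List V) (u : V) (i : ℕ) : Prop :=
  ∃ v w, (find D pre u)[i]? = some v ∧ (find D pre u)[i + 1]? = some w ∧
    ∃ l, IsPathAvoiding (deleteArc D v w) (pre ++ (find D pre u).take i) v t l

open Classical in
/-- The largest index below `i` for which the loop makes a recursive call. -/
noncomputable def lastBranch (D : Digraph V) (pre : List V) (u : V) : ℕ → Option ℕ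
  | 0 => none
  | i + 1 => if Branches find t D pre u i then some i else lastBranch D pre u i

/-- Return from a call. -/
def TourState.ret : List (Frame V) → List (List V) → TourState V
  | [], out => .halt out
  | f :: st, out => .run st f.D f.pre f.u (some f.i) out

open Classical in
/-- Make the next recursive call for an index below `i`, or else return. (`lastBranch` only
yields indices at which both vertices exist, so the third case does not occur.) -/
noncomputable def TourState.resume (stack : List (Frame V)) (D : Digraph V) (pre : List V) (u : V)
    (i : ℕ) (out : List (List V)) : TourState V :=
  match lastBranch find t D pre u i with
  | some j =>
    match (find D pre u)[j]?, (find D pre u)[j + 1]? with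
    | some v, some w =>
      .run (⟨D, pre, u, j⟩ :: stack) (deleteArc D v w) (pre ++ (find D pre u).take j) v none out
    | _, _ => .halt out
  | none => .ret stack (out ++ if Odd stack.length then [pre ++ find D pre u] else [])

open Classical in
/-- Proceed to the beginning of the next recursive call or to the next return from a call. Only
the main call can be without a path: a recursive call is made only if there is one. -/
noncomputable def TourState.next : TourState V → TourState V
  | .halt out => .halt out
  | .run stack D pre u lim out =>
    if ∃ l, IsPathAvoiding D pre u t l then
      .resume find t stack D pre u (lim.getD ((find D pre u).length - 1))
        (out ++ if lim = none ∧ Even stack.length then [pre ++ find D pre u] else [])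
    else .halt out

variable {find t}

theorem lastBranch_spec {D : Digraph V} {pre : List V} {u : V} {i j : ℕ}
    (h : lastBranch find t D pre u i = some j) : j < i ∧ Branches find t D pre u j := by
  induction i with
  | zero => simp [lastBranch] at h
  | succ i ih =>
    rw [lastBranch] at h
    split_ifs at h with hb
    · obtain rfl : i = j := by simpa using h
      exact ⟨by omega, hb⟩
    · have := ih h
      exact ⟨by omega, this.2⟩

/-- The walk through the tree of calls performs the calls of the algorithm. -/
theorem exists_next_iterate_eq_ret {D : Digraph V} {pre : List V} {u : V} {d : ℕ}
    {L : List (List V)} (h : EnumSTP find t D pre u d L) (stack : List (Frame V))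
    (out : List (List V)) (hd : stack.length = d)
    (hex : (∃ l, IsPathAvoiding D pre u t l) ∨ stack = []) :
    ∃ k, (TourState.next find t)^[k] (.run stack D pre u none out) = .ret stack (out ++ L) := by
  revert stack out
  refine EnumSTP.rec (find := find) (t := t)
    (motive_1 := fun D pre u d L _ => ∀ (stack : List (Frame V)) (out : List (List V)),
      stack.length = d → (∃ l, IsPathAvoiding D pre u t l) ∨ stack = [] →
      ∃ k, (TourState.next find t)^[k] (.run stack D pre u none out) = .ret stack (out ++ L))
    (motive_2 := fun D pre Q d i L _ => ∀ (u : V) (stack : List (Frame V)) (out : List (List V)),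
      stack.length = d → Q = find D pre u → (∃ l, IsPathAvoiding D pre u t l) →
      ∃ k, (TourState.next find t)^[k] (.resume find t stack D pre u i out) =
        .ret stack (out ++ L ++ if Odd d then [pre ++ Q] else [])) ?_ ?_ ?_ ?_ ?_ h
  · intro D pre u d hno stack out hd hex
    obtain rfl := hex.resolve_left hno
    exact ⟨1, by simp [TourState.next, hno, TourState.ret]⟩
  · intro D pre u d L hex _ ih stack out hd _
    obtain ⟨k, hk⟩ := ih u stack (out ++ if Even d then [pre ++ find D pre u] else []) hd rfl hex
    refine ⟨k + 1, ?_⟩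
    rw [Function.iterate_succ_apply, TourState.next, if_pos hex]
    simp only [Option.getD_none, true_and, hd]
    rw [hk]
    simp only [List.append_assoc]
  · rintro D pre Q d u stack out hd rfl hex
    exact ⟨0, by simp [TourState.resume, lastBranch, hd]⟩
  · rintro D pre Q d i v w L₁ L₂ hv hw hb _ _ ih₁ ih₂ u stack out hd rfl hex
    obtain ⟨k₁, h₁⟩ := ih₁ (⟨D, pre, u, i⟩ :: stack) out (by simp [hd]) (Or.inl hb)
    obtain ⟨k₂, h₂⟩ := ih₂ u stack (out ++ L₁) hd rfl hex
    have hres : TourState.resume find t stack D pre u (i + 1) out =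
        .run (⟨D, pre, u, i⟩ :: stack) (deleteArc D v w) (pre ++ (find D pre u).take i) v none
          out := by
      have : lastBranch find t D pre u (i + 1) = some i := if_pos ⟨v, w, hv, hw, hb⟩
      simp [TourState.resume, this, hv, hw]
    refine ⟨k₂ + 1 + k₁, ?_⟩
    rw [hres, Function.iterate_add_apply, h₁, Function.iterate_succ_apply, TourState.ret,
      TourState.next, if_pos hex]
    simp only [Option.getD_some, reduceCtorEq, false_and, if_false, List.append_nil]
    rw [h₂]
    simp only [List.append_assoc]
  · rintro D pre Q d i v w L hv hw hb _ ih u stack out hd rfl hex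
    obtain ⟨k, hk⟩ := ih u stack out hd rfl hex
    refine ⟨k, ?_⟩
    have : lastBranch find t D pre u (i + 1) = lastBranch find t D pre u i := by
      refine if_neg ?_
      rintro ⟨v', w', hv', hw', h'⟩
      obtain rfl : v = v' := by simpa [hv] using hv'
      obtain rfl : w = w' := by simpa [hw] using hw'
      exact hb h'
    rw [← hk]
    simp only [TourState.resume, this]

theorem exists_next_iterate_eq_halt {D : Digraph V} {s : V} {L : List (List V)}
    (h : AlgorithmOutputs find D s t L) :
    ∃ k, (TourState.next find t)^[k] (.run [] D [] s none []) = .halt L := by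
  exact exists_next_iterate_eq_ret h [] [] rfl (Or.inr rfl)

variable (find t)

/-- The walk halts or outputs a solution within `j` steps. -/
def Productive (a : TourState V) (j : ℕ) : Prop :=
  ∃ i ≤ j, ((TourState.next find t)^[i] a).IsHalt ∨
    a.out.length < ((TourState.next find t)^[i] a).out.length

variable {find t}

/-- A step without output either begins a call, which happens at odd depth if the current call
has only just begun, or returns from a call of even depth, which has begun earlier. -/
theorem next_cases (stack : List (Frame V)) (D : Digraph V) (pre : List V) (u : V)
    (lim : Option ℕ) (out : List (List V)) :
    Productive find t (.run stack D pre u lim out) 1 ∨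
    (∃ f D' pre' u', TourState.next find t (.run stack D pre u lim out) =
      .run (f :: stack) D' pre' u' none out ∧ (lim = none → Odd stack.length)) ∨
    (∃ f st, stack = f :: st ∧ Even stack.length ∧ lim ≠ none ∧
      TourState.next find t (.run stack D pre u lim out) =
        .run st f.D f.pre f.u (some f.i) out) := by
  by_cases hP : Productive find t (.run stack D pre u lim out) 1
  · exact Or.inl hP
  right
  have h1 : ¬ (TourState.next find t (.run stack D pre u lim out)).IsHalt :=
    fun h => hP ⟨1, le_rfl, Or.inl h⟩
  have h2 : (TourState.next find t (.run stack D pre u lim out)).out.length ≤ out.length := by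
    by_contra! h
    exact hP ⟨1, le_rfl, Or.inr h⟩
  have hex : ∃ l, IsPathAvoiding D pre u t l := by
    by_contra hno
    apply h1
    rw [TourState.next, if_neg hno]
    trivial
  rw [TourState.next, if_pos hex] at h1 h2 ⊢
  generalize lim.getD ((find D pre u).length - 1) = i at h1 h2 ⊢
  rw [TourState.resume] at h1 h2 ⊢
  cases hl : lastBranch find t D pre u i with
  | some j =>
    obtain ⟨-, v, w, hv, hw, -⟩ := lastBranch_spec hl
    simp only [hl, hv, hw, TourState.out] at h1 h2 ⊢
    left
    by_cases hc : lim = none ∧ Even stack.length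
    · simp [hc] at h2
    · rw [if_neg hc, List.append_nil]
      refine ⟨_, _, _, _, rfl, fun h => ?_⟩
      exact Nat.not_even_iff_odd.1 fun h' => hc ⟨h, h'⟩
  | none =>
    simp only [hl] at h1 h2 ⊢
    right
    cases stack with
    | nil => exact absurd trivial h1
    | cons f st =>
      simp only [TourState.ret, TourState.out] at h2 ⊢
      by_cases hc : lim = none ∧ Even (f :: st).length
      · rw [if_pos hc, List.length_append, List.length_append, List.length_singleton] at h2
        omega
      · by_cases ho : Odd (f :: st).length
        · rw [if_pos ho, List.length_append, List.length_append, List.length_singleton] at h2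
          omega
        · have he := Nat.not_odd_iff_even.1 ho
          refine ⟨f, st, rfl, he, fun h => hc ⟨h, he⟩, ?_⟩
          rw [if_neg hc, if_neg ho, List.append_nil, List.append_nil]

theorem Productive.mono {a : TourState V} {i j : ℕ} (h : Productive find t a i) (hij : i ≤ j) :
    Productive find t a j := by
  obtain ⟨k, hk, h⟩ := h
  exact ⟨k, hk.trans hij, h⟩

theorem Productive.of_next {a b : TourState V} {j : ℕ} (h : TourState.next find t a = b)
    (ho : b.out = a.out) (hb : Productive find t b j) : Productive find t a (j + 1) := by
  obtain ⟨k, hk, hb⟩ := hb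
  refine ⟨k + 1, by omega, ?_⟩
  rwa [Function.iterate_succ_apply, h, ← ho]

/-- Solutions are output when a call of even depth begins and when a call of odd depth ends, so
three consecutive steps always contain an output. -/
theorem productive_three (a : TourState V) : Productive find t a 3 := by
  have even_fresh : ∀ (stack : List (Frame V)) D pre u out, Even stack.length →
      Productive find t (.run stack D pre u none out) 1 := by
    intro stack D pre u out he
    rcases next_cases (find := find) (t := t) stack D pre u none out with
      h | ⟨f, D', pre', u', -, h⟩ | ⟨f, st, -, -, h, -⟩
    · exact h
    · exact absurd he (Nat.not_even_iff_odd.2 (h rfl))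
    · exact absurd rfl h
  have odd_any : ∀ (stack : List (Frame V)) D pre u lim out, Odd stack.length →
      Productive find t (.run stack D pre u lim out) 2 := by
    intro stack D pre u lim out ho
    rcases next_cases (find := find) (t := t) stack D pre u lim out with
      h | ⟨f, D', pre', u', h, -⟩ | ⟨f, st, -, he, -, -⟩
    · exact h.mono (by omega)
    · refine .of_next h rfl (even_fresh _ _ _ _ _ ?_)
      rw [List.length_cons, Nat.even_add_one]
      exact Nat.not_even_iff_odd.2 ho
    · exact absurd he (Nat.not_even_iff_odd.2 ho)
  cases a with
  | halt out => exact ⟨0, by omega, Or.inl trivial⟩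
  | run stack D pre u lim out =>
    rcases Nat.even_or_odd stack.length with he | ho
    · rcases next_cases (find := find) (t := t) stack D pre u lim out with
        h | ⟨f, D', pre', u', h, -⟩ | ⟨f, st, rfl, he, -, h⟩
      · exact h.mono (by omega)
      · refine .of_next h rfl (odd_any _ _ _ _ _ _ ?_)
        rw [List.length_cons]
        exact he.add_one
      · refine .of_next h rfl (odd_any _ _ _ _ _ _ ?_)
        rw [List.length_cons, Nat.even_add_one] at he
        exact Nat.not_even_iff_odd.1 he
    · exact (odd_any _ _ _ _ _ _ ho).mono (by omega)

end Tour

/-! ### The search program -/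

/-- `s'` agrees with `s` except for the registers in `R` and the arrays in `As`. -/
structure Agree (R : List Reg) (As : List Arr) (s s' : Store) : Prop where
  reg : ∀ r ∉ R, s'.reg r = s.reg r
  arr : ∀ A ∉ As, s'.arr A = s.arr A
  current : s'.current = s.current
  out : s'.out = s.out

theorem Agree.refl {R : List Reg} {As : List Arr} (s : Store) : Agree R As s s :=
  ⟨fun _ _ => rfl, fun _ _ => rfl, rfl, rfl⟩

theorem Agree.trans {R R' R'' : List Reg} {As As' As'' : List Arr} {s s' s'' : Store}
    (h : Agree R As s s') (h' : Agree R' As' s' s'') (hR : R ⊆ R'') (hR' : R' ⊆ R'')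
    (hA : As ⊆ As'') (hA' : As' ⊆ As'') : Agree R'' As'' s s'' :=
  ⟨fun r hr => (h'.reg r fun e => hr (hR' e)).trans (h.reg r fun e => hr (hR e)),
    fun A hr => (h'.arr A fun e => hr (hA' e)).trans (h.arr A fun e => hr (hA e)),
    h'.current.trans h.current, h'.out.trans h.out⟩

/-- The linked list that starts at `p` has the entries `l`; `0` is the end of a list. -/
def Linked (nxt : ℕ → ℕ) : ℕ → List ℕ → Prop
  | p, [] => p = 0
  | p, q :: l => p = q ∧ q ≠ 0 ∧ Linked nxt (nxt q) l

/-- The array `f` holds the stack `W`, with its top at the highest index. -/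
def StackIn {n : ℕ} (f : ℕ → ℕ) : List (Fin n) → Prop
  | [] => True
  | y :: W => f W.length = y ∧ StackIn f W

theorem StackIn.update {n : ℕ} {f : ℕ → ℕ} {W : List (Fin n)} (h : StackIn f W) {k a : ℕ}
    (hk : W.length ≤ k) : StackIn (Function.update f k a) W := by
  induction W with
  | nil => trivial
  | cons y W ih =>
    simp only [List.length_cons] at hk
    refine ⟨?_, ih h.2 (by omega)⟩
    rw [Function.update_of_ne (by omega)]
    exact h.1

section SearchProgram

variable {n : ℕ}

/-- The data that do not change after the initialisation: the constants, the arcs of `G` and the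
lists of the arcs that enter a vertex. -/
structure Static (N : ℕ) (G : Net n) (t : Fin n) (s : Store) : Prop where
  size_le : n + G.ids.length + 1 < N
  ids_lt : ∀ q ∈ G.ids, q + 1 < N
  zero : s.reg .zero = 0
  one : s.reg .one = 1
  two : s.reg .two = 2
  size : s.reg .size = n
  target : s.reg .target = t
  cap : s.reg .cap = N
  tail : ∀ q ∈ G.ids, s.arr .inp q = G.tl q
  head : ∀ q ∈ G.ids, s.arr .inp (q + 1) = G.hd q
  ins : ∀ y : Fin n, Linked (s.arr .nxt) (s.arr .first y) (G.ins y)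

theorem Static.congr {N : ℕ} {G : Net n} {t : Fin n} {s s' : Store} (h : Static N G t s)
    {R : List Reg} {As : List Arr} (ha : Agree R As s s')
    (hR : ∀ r ∈ [Reg.zero, .one, .two, .size, .target, .cap], r ∉ R := by decide)
    (hA : ∀ A ∈ [Arr.inp, .first, .nxt], A ∉ As := by decide) : Static N G t s' := by
  have h1 := ha.arr .inp (hA _ (by decide))
  have h2 := ha.arr .first (hA _ (by decide))
  have h3 := ha.arr .nxt (hA _ (by decide))
  refine ⟨h.size_le, h.ids_lt, ?_, ?_, ?_, ?_, ?_, ?_, ?_, ?_, ?_⟩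
  · rw [ha.reg _ (hR _ (by decide)), h.zero]
  · rw [ha.reg _ (hR _ (by decide)), h.one]
  · rw [ha.reg _ (hR _ (by decide)), h.two]
  · rw [ha.reg _ (hR _ (by decide)), h.size]
  · rw [ha.reg _ (hR _ (by decide)), h.target]
  · rw [ha.reg _ (hR _ (by decide)), h.cap]
  · rw [h1]; exact h.tail
  · rw [h1]; exact h.head
  · rw [h2, h3]; exact h.ins

open Classical in
/-- The array `del` marks the arcs of `G` that have been deleted in `D'`. -/
structure Marks (G : Net n) (D' : Digraph (Fin n)) (s : Store) : Prop where
  le : ∀ a b, D'.Adj a b → G.D.Adj a b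
  del : ∀ q ∈ G.ids, s.arr .del q = if D'.Adj (G.tl q) (G.hd q) then 0 else 1

open Classical in
/-- The array `blk` marks the vertices in `X`. -/
def Blocked (X : List (Fin n)) (s : Store) : Prop :=
  ∀ z : Fin n, s.arr .blk z = if z ∈ X then 1 else 0

/-- The arrays and registers of the search represent the search state `x`. -/
structure SearchRep (x : SearchState n) (s : Store) : Prop where
  cnt : ∀ z : Fin n, s.arr .cnt z = x.cnt z
  par : ∀ z : Fin n, s.arr .par z = x.par z
  work : StackIn (s.arr .work) x.work
  top : s.reg .top = x.work.length
  arcs : Linked (s.arr .nxt) (s.reg .arc) x.arcs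

theorem update_fin {f : ℕ → ℕ} {g : Fin n → ℕ} (h : ∀ z : Fin n, f z = g z) (y : Fin n) (a : ℕ)
    (z : Fin n) : Function.update f (y : ℕ) a (z : ℕ) = Function.update g y a z := by
  simp [Function.update_apply, Fin.ext_iff, h]

/-- Expand the vertex on top of the worklist. -/
def expandCmd : Cmd :=
  .seq (.sub .top .top .one) (.seq (.ld .vtx .work .top) (.ld .arc .first .vtx))

/-- Reach the vertex `nbr` for the first time through the arc `arc`. -/
def reachCmd : Cmd :=
  .seq (.st .cnt .nbr .one) (.seq (.ld .flag .blk .nbr) (.ite (.eq .flag .zero)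
    (.seq (.st .par .nbr .arc) (.seq (.st .work .top .nbr) (.add .top .top .one))) .skip))

/-- Scan the arc `arc` and proceed to the next arc. -/
def scanCmd : Cmd :=
  .seq (.ld .flag .del .arc) (.seq (.ite (.eq .flag .zero)
    (.seq (.ld .nbr .inp .arc) (.seq (.ld .mark .cnt .nbr)
      (.ite (.eq .mark .zero) reachCmd (.st .cnt .nbr .two)))) .skip)
    (.ld .arc .nxt .arc))

/-- One step of the search. -/
def searchStepCmd : Cmd := .ite (.eq .arc .zero) expandCmd scanCmd

/-- Search until neither an arc nor a vertex is left. Arc names are positive, so the search goes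
on as long as `arc + top` is positive. -/
def searchCmd : Cmd :=
  .seq (.add .val .arc .top) (.while (.lt .zero .val)
    (.seq searchStepCmd (.add .val .arc .top)))

/-- The registers and arrays that the search may change. -/
abbrev searchRegs : List Reg := [.val, .flag, .mark, .arc, .top, .vtx, .nbr]
abbrev searchArrs : List Arr := [.cnt, .par, .work]

variable {N M : ℕ} {G : Net n} {t : Fin n} {D' : Digraph (Fin n)} {X : List (Fin n)}
  {s : Store} {x : SearchState n} {k τ : ℕ} {Q : Store → ℕ → Prop}

theorem vc_searchStepCmd (hs : Static N G t s) (hm : Marks G D' s) (hb : Blocked X s)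
    (hr : SearchRep x s) (hi : SearchInvAt G D' X t x k) (hx : ¬ x.Done)
    (hQ : ∀ s' τ', Agree searchRegs searchArrs s s' → SearchRep (searchStep G D' X x) s' →
      τ' ≤ τ + 40 → Q s' τ') :
    vc N M searchStepCmd Q s τ := by
  have hN := hs.size_le
  have hi' := searchInvAt_step hi hx
  have hlen := hi.length_work_le
  have hlen' := hi'.length_work_le
  obtain ⟨Pd, Pq, hi, -⟩ := hi
  obtain ⟨cnt, par, work, arcs⟩ := x
  obtain ⟨hcnt, hpar, hwork, htop, harcs⟩ := hr
  rcases arcs with _ | ⟨q, arcs⟩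
  · rcases work with _ | ⟨y, W⟩
    · exact absurd ⟨rfl, rfl⟩ hx
    · have harc : s.reg .arc = 0 := harcs
      have h1 : s.reg .top - s.reg .one = W.length := by
        rw [htop, hs.one]; simp
      have h2 : s.arr .work W.length = y := hwork.1
      have hy := y.isLt
      simp only [List.length_cons] at hlen
      simp only [searchStepCmd, expandCmd, vc, Cond.Holds, harc, hs.zero, Store.reg_setR,
        Store.arr_setR, if_true, reduceCtorEq, if_false, h1, h2]
      refine ⟨fun _ => ⟨by omega, by omega, ?_⟩, fun h => absurd trivial h⟩
      refine hQ _ _ ⟨?_, ?_, rfl, rfl⟩ ⟨hcnt, hpar, hwork.2, ?_, ?_⟩ (by omega)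
      · intro r hr
        simp only [List.mem_cons, not_or] at hr
        simp [hr]
      · intro A hA; rfl
      · simp [searchStep]
      · simpa [searchStep] using hs.ins y
  · obtain ⟨harc, hq0, hnext⟩ := harcs
    have hqids := (hi.arcs_mem q (by simp)).1
    have hqN := hs.ids_lt q hqids
    have hdel := hm.del q hqids
    have htl := hs.tail q hqids
    have hz := (G.tl q).isLt
    have hct := hcnt (G.tl q)
    have hbt := hb (G.tl q)
    have hne : s.reg .arc ≠ 0 := by rw [harc]; exact hq0
    simp only [searchStepCmd, vc, Cond.Holds, hs.zero, hne, false_imp_iff, true_and,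
      not_false_eq_true, true_imp_iff]
    simp only [searchStep] at hQ hlen' ⊢
    simp only [scanCmd, reachCmd, vc, Cond.Holds, harc, Store.reg_setR, Store.arr_setR,
      Store.reg_setA, Store.arr_setA,
      if_true, reduceCtorEq, if_false, hs.zero, hs.one, hs.two, hdel, htl]
    refine ⟨by omega, ?_, ?_⟩
    · intro hadj
      have hadj : D'.Adj (G.tl q) (G.hd q) := by
        by_contra h
        simp [h] at hadj
      simp only [hadj, if_true] at hQ hlen'
      refine ⟨by omega, by omega, ?_, ?_⟩
      · intro h0
        have h0' : cnt (G.tl q) = 0 := by rw [← h0]; exact hct.symm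
        simp only [h0', if_true] at hQ hlen'
        refine ⟨by omega, by omega, ?_, ?_⟩
        · intro hX
          have hX : G.tl q ∉ X := by
            intro h
            simp [hbt, h] at hX
          simp only [hX, if_false, List.length_cons] at hQ hlen'
          refine ⟨by omega, by omega, by omega, by omega, ?_⟩
          refine hQ _ _ ⟨?_, ?_, rfl, rfl⟩ ⟨?_, ?_, ?_, ?_, ?_⟩ (by omega)
          · intro r hr
            simp only [List.mem_cons, not_or] at hr
            simp [hr]
          · intro A hA
            simp only [List.mem_cons, not_or] at hA
            simp [hA]
          · intro z
            simpa using update_fin hcnt (G.tl q) 1 z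
          · intro z
            simpa using update_fin hpar (G.tl q) q z
          · simp only [Store.arr_setR, Store.arr_setA, reduceCtorEq, if_false, if_true, htop]
            exact ⟨by simp, hwork.update le_rfl⟩
          · simp [htop]
          · simpa using hnext
        · intro hX
          have hX : G.tl q ∈ X := by
            by_contra h
            simp [hbt, h] at hX
          simp only [hX, if_true] at hQ
          refine ⟨by omega, ?_⟩
          refine hQ _ _ ⟨?_, ?_, rfl, rfl⟩ ⟨?_, ?_, ?_, ?_, ?_⟩ (by omega)
          · intro r hr
            simp only [List.mem_cons, not_or] at hr
            simp [hr]
          · intro A hA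
            simp only [List.mem_cons, not_or] at hA
            simp [hA]
          · intro z
            simpa using update_fin hcnt (G.tl q) 1 z
          · simpa using hpar
          · simpa using hwork
          · simp [htop]
          · simpa using hnext
      · intro h0
        have h0' : cnt (G.tl q) ≠ 0 := fun h => h0 (hct.trans h)
        simp only [h0', if_false] at hQ
        refine ⟨by omega, by omega, ?_⟩
        refine hQ _ _ ⟨?_, ?_, rfl, rfl⟩ ⟨?_, ?_, ?_, ?_, ?_⟩ (by omega)
        · intro r hr
          simp only [List.mem_cons, not_or] at hr
          simp [hr]
        · intro A hA
          simp only [List.mem_cons, not_or] at hA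
          simp [hA]
        · intro z
          simpa using update_fin hcnt (G.tl q) 2 z
        · simpa using hpar
        · simpa using hwork
        · simp [htop]
        · simpa using hnext
    · intro hadj
      have hadj : ¬ D'.Adj (G.tl q) (G.hd q) := by
        intro h
        simp [h] at hadj
      simp only [hadj, if_false] at hQ
      refine ⟨by omega, ?_⟩
      refine hQ _ _ ⟨?_, ?_, rfl, rfl⟩ ⟨hcnt, hpar, hwork, ?_, ?_⟩ (by omega)
      · intro r hr
        simp only [List.mem_cons, not_or] at hr
        simp [hr]
      · intro A hA; rfl
      · simp [htop]
      · simpa using hnext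

/-- The search program performs search steps until the search is finished. -/
theorem vc_searchCmd (hs : Static N G t s) (hm : Marks G D' s) (hb : Blocked X s)
    (hr : SearchRep x s) (hi : SearchInvAt G D' X t x k)
    (hQ : ∀ s' τ' j, Agree searchRegs searchArrs s s' →
      SearchRep ((searchStep G D' X)^[j] x) s' →
      SearchInvAt G D' X t ((searchStep G D' X)^[j] x) (k + j) →
      ((searchStep G D' X)^[j] x).Done → τ' ≤ τ + 50 * j + 10 → Q s' τ') :
    vc N M searchCmd Q s τ := by
  have hval : ∀ {s : Store} {x : SearchState n} {k : ℕ}, Static N G t s → SearchRep x s →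
      SearchInvAt G D' X t x k → s.reg .arc + s.reg .top ≤ 2 * N := by
    intro s x k hs hr hi
    have hN := hs.size_le
    have h1 := hi.length_work_le
    have h2 := hr.top
    have h3 : s.reg .arc < N := by
      have h3 := hr.arcs
      obtain ⟨Pd, Pq, hi, -⟩ := hi
      cases hx : x.arcs with
      | nil =>
        rw [hx] at h3
        have h3 : s.reg .arc = 0 := h3
        omega
      | cons q l =>
        rw [hx] at h3
        have h4 := hs.ids_lt q (hi.arcs_mem q (by simp [hx])).1
        have h5 : s.reg .arc = q := h3.1
        omega
    omega
  have hdone : ∀ {s : Store} {x : SearchState n}, SearchRep x s →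
      (s.reg .arc + s.reg .top = 0 ↔ x.Done) := by
    intro s x hr
    rw [Nat.add_eq_zero_iff, hr.top, List.length_eq_zero_iff, SearchState.Done, and_comm]
    refine and_congr_right fun _ => ?_
    have h3 := hr.arcs
    cases hx : x.arcs with
    | nil => rw [hx] at h3; exact iff_of_true h3 rfl
    | cons q l =>
      rw [hx] at h3
      exact iff_of_false (by rw [h3.1]; exact h3.2.1) (by simp)
  have hstore : ∀ s : Store, ∀ a, Agree searchRegs searchArrs s (s.setR .val a) := by
    intro s a
    refine ⟨fun r hr => ?_, fun _ _ => rfl, rfl, rfl⟩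
    simp only [List.mem_cons, not_or] at hr
    simp [hr]
  have hrep : ∀ {s : Store} {x : SearchState n} a, SearchRep x s → SearchRep x (s.setR .val a) :=
    fun a h => ⟨h.cnt, h.par, h.work, by simpa using h.top, by simpa using h.arcs⟩
  refine ⟨hval hs hr hi, ?_⟩
  refine vc_while (fun v s' τ' => ∃ j, Agree searchRegs searchArrs s s' ∧
      SearchRep ((searchStep G D' X)^[j] x) s' ∧
      SearchInvAt G D' X t ((searchStep G D' X)^[j] x) (k + j) ∧ τ' ≤ τ + 50 * j + 5 ∧
      s'.reg .val = s'.reg .arc + s'.reg .top ∧ v = n + G.ids.length - (k + j))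
    ⟨0, hstore _ _, hrep _ hr, hi, by omega, by simp, rfl⟩ ?_ ?_
  · rintro v s' τ' ⟨j, ha, hr', hi', hτ, hv, rfl⟩ hc
    have hs' : Static N G t s' := hs.congr ha
    have hm' : Marks G D' s' := ⟨hm.le, by rw [ha.arr .del (by decide)]; exact hm.del⟩
    have hb' : Blocked X s' := by
      unfold Blocked
      rw [ha.arr .blk (by decide)]
      exact hb
    have hnd : ¬ ((searchStep G D' X)^[j] x).Done := by
      rw [← hdone hr', ← hv]
      simp only [Cond.Holds, hs'.zero] at hc
      omega
    refine vc_searchStepCmd hs' hm' hb' hr' hi' hnd ?_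
    intro s'' τ'' ha' hr'' hτ'
    have hi'' := searchInvAt_step hi' hnd
    rw [← Function.iterate_succ_apply' (searchStep G D' X) j x] at hr'' hi''
    have hs'' := hs'.congr ha'
    refine ⟨hval hs'' hr'' hi'', n + G.ids.length - (k + (j + 1)), ?_, j + 1, ?_, hrep _ hr'', hi'',
      by omega, by simp, rfl⟩
    · have := hi''.le
      omega
    · exact (ha.trans ha' (List.Subset.refl _) (List.Subset.refl _) (List.Subset.refl _)
        (List.Subset.refl _)).trans (hstore _ _) (List.Subset.refl _) (List.Subset.refl _)
        (List.Subset.refl _) (List.Subset.refl _)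
  · rintro v s' τ' ⟨j, ha, hr', hi', hτ, hv, rfl⟩ hc
    have hs' : Static N G t s' := hs.congr ha
    refine hQ _ _ j ha hr' hi' ?_ (by omega)
    rw [← hdone hr', ← hv]
    simp only [Cond.Holds, hs'.zero] at hc
    omega

end SearchProgram

/-! ### The parts of the program for a call -/

section CallProgram

variable {n N M : ℕ} {G : Net n} {t : Fin n} {D' : Digraph (Fin n)} {X : List (Fin n)}
  {s : Store} {x : SearchState n} {k τ : ℕ} {Q : Store → ℕ → Prop}

/-- The array `f` begins with the vertices in `l`. -/
def ArrayIs (f : ℕ → ℕ) (l : List (Fin n)) : Prop := ∀ (j : ℕ) (v : Fin n), l[j]? = some v → f j = v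

theorem Marks.congr {s' : Store} {R : List Reg} {As : List Arr} (h : Marks G D' s)
    (ha : Agree R As s s') (hA : Arr.del ∉ As := by decide) : Marks G D' s' :=
  ⟨h.le, by rw [ha.arr _ hA]; exact h.del⟩

theorem Blocked.congr {s' : Store} {R : List Reg} {As : List Arr} (h : Blocked X s)
    (ha : Agree R As s s') (hA : Arr.blk ∉ As := by decide) : Blocked X s' := by
  unfold Blocked
  rw [ha.arr _ hA]
  exact h

/-- Reset the marks of blocked vertices, the counters and the search arcs. -/
def clearCmd : Cmd :=
  .seq (.const .ctr 0) (.while (.lt .ctr .cap)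
    (.seq (.st .blk .ctr .zero) (.seq (.st .cnt .ctr .zero) (.seq (.st .par .ctr .zero)
      (.add .ctr .ctr .one)))))

theorem vc_clearCmd (hs : Static N G t s)
    (hQ : ∀ s' τ', Agree [.ctr] [.blk, .cnt, .par] s s' →
      (∀ i < N, s'.arr .blk i = 0 ∧ s'.arr .cnt i = 0 ∧ s'.arr .par i = 0) →
      τ' ≤ τ + 20 * N + 10 → Q s' τ') :
    vc N M clearCmd Q s τ := by
  refine ⟨by omega, ?_⟩
  refine vc_while (fun v s' τ' => ∃ i ≤ N, Agree [.ctr] [.blk, .cnt, .par] s s' ∧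
      s'.reg .ctr = i ∧
      (∀ j < i, s'.arr .blk j = 0 ∧ s'.arr .cnt j = 0 ∧ s'.arr .par j = 0) ∧
      τ' ≤ τ + 20 * i + 5 ∧ v = N - i)
    (v := N) ⟨0, by omega, ?_, by simp, by simp, by omega, rfl⟩ ?_ ?_
  · refine ⟨fun r hr => ?_, fun _ _ => rfl, rfl, rfl⟩
    simp only [List.mem_cons, not_or] at hr
    simp [hr]
  · rintro v s' τ' ⟨i, hi, ha, hc, h0, hτ, rfl⟩ hlt
    have hs' := hs.congr ha
    simp only [Cond.Holds, hc, hs'.cap] at hlt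
    simp only [vc, Store.reg_setR, Store.reg_setA, hc, hs'.zero,
      hs'.one]
    refine ⟨hlt, hlt, hlt, by omega, N - (i + 1), by omega, i + 1, by omega,
      ha.trans (R' := [.ctr]) (As' := [.blk, .cnt, .par]) ⟨?_, ?_, rfl, rfl⟩
        (List.Subset.refl _) (List.Subset.refl _) (List.Subset.refl _) (List.Subset.refl _),
      by simp, ?_, by omega, rfl⟩
    · intro r hr
      simp only [List.mem_cons, not_or] at hr
      simp [hr]
    · intro A hA
      simp only [List.mem_cons, not_or] at hA
      simp [hA]
    · intro j hj
      by_cases hji : j = i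
      · simp [hji]
      · simpa [hji] using h0 j (by omega)
  · rintro v s' τ' ⟨i, hi, ha, hc, h0, hτ, rfl⟩ hlt
    have hs' := hs.congr ha
    simp only [Cond.Holds, hc, hs'.cap] at hlt
    exact hQ _ _ ha (fun j hj => h0 j (by omega)) (by omega)

/-- Block the first `bound` vertices of the path. -/
def blockCmd : Cmd :=
  .seq (.const .ctr 0) (.while (.lt .ctr .bound)
    (.seq (.ld .nbr .path .ctr) (.seq (.st .blk .nbr .one) (.add .ctr .ctr .one))))

theorem vc_blockCmd (hs : Static N G t s) {l : List (Fin n)} (hl : ArrayIs (s.arr .path) l)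
    (hb : s.reg .bound ≤ l.length) (hln : l.length ≤ n) (h0 : Blocked ([] : List (Fin n)) s)
    (hQ : ∀ s' τ', Agree [.ctr, .nbr] [.blk] s s' → Blocked (l.take (s.reg .bound)) s' →
      τ' ≤ τ + 20 * N + 10 → Q s' τ') :
    vc N M blockCmd Q s τ := by
  have hN := hs.size_le
  refine ⟨by omega, ?_⟩
  refine vc_while (fun v s' τ' => ∃ i ≤ s.reg .bound, Agree [.ctr, .nbr] [.blk] s s' ∧
      s'.reg .ctr = i ∧ Blocked (l.take i) s' ∧
      τ' ≤ τ + 20 * i + 5 ∧ v = s.reg .bound - i)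
    (v := s.reg .bound) ⟨0, by omega, ?_, by simp, h0, by omega, rfl⟩ ?_ ?_
  · refine ⟨fun r hr => ?_, fun _ _ => rfl, rfl, rfl⟩
    simp only [List.mem_cons, not_or] at hr
    simp [hr]
  · rintro v s' τ' ⟨i, hi, ha, hc, h0, hτ, rfl⟩ hlt
    have hs' := hs.congr ha
    have hb' := ha.reg .bound (by decide)
    simp only [Cond.Holds, hc, hb'] at hlt
    have hil : i < l.length := by omega
    have hpi : s'.arr .path i = l[i] := by
      rw [ha.arr .path (by decide)]
      exact hl i _ (List.getElem?_eq_getElem hil)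
    have hlt' := l[i].isLt
    simp only [vc, Store.reg_setR, Store.reg_setA, hc, hpi,
      hs'.one, if_true, reduceCtorEq, if_false]
    refine ⟨by omega, by omega, by omega, s.reg .bound - (i + 1), by omega, i + 1, by omega,
      ha.trans (R' := [.ctr, .nbr]) (As' := [.blk]) ⟨?_, ?_, rfl, rfl⟩
        (List.Subset.refl _) (List.Subset.refl _) (List.Subset.refl _) (List.Subset.refl _),
      by simp, ?_, by omega, rfl⟩
    · intro r hr
      simp only [List.mem_cons, not_or] at hr
      simp [hr]
    · intro A hA
      simp only [List.mem_cons, not_or] at hA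
      simp [hA]
    · intro z
      have h1 := h0 z
      rw [List.take_add_one, List.getElem?_eq_getElem hil]
      simp only [Store.arr_setA, Store.arr_setR, if_true, Function.update_apply, Option.toList_some,
        List.mem_append, List.mem_singleton, ← Fin.ext_iff]
      by_cases hz : z = l[i]
      · simp [hz]
      · simp [hz, h1]
  · rintro v s' τ' ⟨i, hi, ha, hc, h0, hτ, rfl⟩ hlt
    simp only [Cond.Holds, hc, ha.reg .bound (by decide)] at hlt
    obtain rfl : i = s.reg .bound := by omega
    exact hQ _ _ ha h0 (by omega)

/-- Unblock the vertex `vtx` and search from there. -/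
def startCmd : Cmd :=
  .seq (.st .blk .vtx .zero) (.seq (.st .cnt .vtx .one) (.seq (.st .work .zero .vtx)
    (.seq (.copy .top .one) (.seq (.copy .arc .zero) searchCmd))))

theorem vc_startCmd (hs : Static N G t s) (hm : Marks G D' s) {v : Fin n}
    (hv : s.reg .vtx = v) (hvX : v ∉ X)
    (hb : Blocked X s ∨ Blocked (X ++ [v]) s)
    {c p : Fin n → ℕ} (hc : ∀ z : Fin n, s.arr .cnt z = c z) (hp : ∀ z : Fin n, s.arr .par z = p z)
    (hx : x = ⟨Function.update c v 1, p, [v], []⟩) (hi : SearchInvAt G D' X t x k)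
    (hQ : ∀ s' τ' j, Agree searchRegs (.blk :: searchArrs) s s' → Blocked X s' →
      SearchRep ((searchStep G D' X)^[j] x) s' →
      SearchInvAt G D' X t ((searchStep G D' X)^[j] x) (k + j) →
      ((searchStep G D' X)^[j] x).Done → τ' ≤ τ + 50 * j + 40 → Q s' τ') :
    vc N M startCmd Q s τ := by
  have hN := hs.size_le
  have hvn := v.isLt
  simp only [startCmd, vc, Store.reg_setR, Store.reg_setA, hv, hs.zero, hs.one]
  refine ⟨by omega, by omega, by omega, ?_⟩
  set s₁ := ((((s.setA .blk v 0).setA .cnt v 1).setA .work 0 v).setR .top 1).setR .arc 0 with hs₁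
  have ha : Agree searchRegs (.blk :: searchArrs) s s₁ := by
    refine ⟨fun r hr => ?_, fun A hA => ?_, rfl, rfl⟩
    · simp only [List.mem_cons, not_or] at hr
      simp [hs₁, hr]
    · simp only [List.mem_cons, not_or] at hA
      simp [hs₁, hA]
  have hb₁ : Blocked X s₁ := by
    intro z
    by_cases hz : z = v
    · simp [hs₁, hz, hvX]
    · have hz' : (z : ℕ) ≠ v := fun e => hz (Fin.ext e)
      simp only [hs₁, Store.arr_setR, Store.arr_setA, reduceCtorEq, if_false, if_true,
        Function.update_of_ne hz']
      rcases hb with hb | hb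
      · exact hb z
      · simpa [hz] using hb z
  refine vc_searchCmd (x := x) (hs.congr ha) (hm.congr ha) hb₁ ?_ hi ?_
  · subst hx
    refine ⟨?_, ?_, ?_, ?_, ?_⟩
    · intro z
      simpa [hs₁] using update_fin hc v 1 z
    · intro z
      simpa [hs₁] using hp z
    · simp [StackIn]
    · simp
    · simp [Linked]
  · intro s' τ' j ha' hr hi' hd hτ
    exact hQ s' τ' j (ha.trans ha' (List.Subset.refl _) (List.Subset.refl _)
      (List.Subset.refl _) (List.subset_cons_self _ _)) (hb₁.congr ha') hr hi' hd (by omega)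

/-- The registers and arrays that a new search may change. -/
abbrev prepRegs : List Reg := .ctr :: searchRegs
abbrev prepArrs : List Arr := .blk :: searchArrs

/-- Search from the target, with the first `bound` vertices of the path blocked. -/
def prepCmd : Cmd :=
  .seq clearCmd (.seq blockCmd (.seq (.copy .vtx .target) startCmd))

theorem vc_prepCmd (hs : Static N G t s) (hm : Marks G D' s) {l : List (Fin n)}
    (hl : ArrayIs (s.arr .path) l) (hb : s.reg .bound ≤ l.length) (hln : l.length ≤ n)
    (hX : X = l.take (s.reg .bound)) (ht : t ∉ X)
    (hQ : ∀ s' τ' k, Agree prepRegs prepArrs s s' → Blocked X s' →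
      SearchRep (searchResult G D' X t) s' →
      SearchInvAt G D' X t (searchResult G D' X t) k → (searchResult G D' X t).Done →
      τ' ≤ τ + 40 * N + 50 * k + 80 → Q s' τ') :
    vc N M prepCmd Q s τ := by
  have hN := hs.size_le
  refine vc_clearCmd hs ?_
  intro s₁ τ₁ ha₁ h0 hτ₁
  have hs₁ := hs.congr ha₁
  have hbd := ha₁.reg .bound (by decide)
  refine vc_blockCmd (l := l) hs₁ ?_ ?_ hln ?_ ?_
  · rw [ha₁.arr .path (by decide)]
    exact hl
  · rw [hbd]
    exact hb
  · intro z
    have := z.isLt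
    simpa using (h0 z (by omega)).1
  · intro s₂ τ₂ ha₂ hb₂ hτ₂
    have hs₂ := hs₁.congr ha₂
    rw [hbd, ← hX] at hb₂
    have hc : ∀ z : Fin n, s₂.arr .cnt z = 0 ∧ s₂.arr .par z = 0 := by
      intro z
      have := z.isLt
      rw [ha₂.arr .cnt (by decide), ha₂.arr .par (by decide)]
      exact (h0 z (by omega)).2
    have ha₃ : Agree [.vtx] [] s₂ (s₂.setR .vtx (s₂.reg .target)) := by
      refine ⟨fun r hr => ?_, fun _ _ => rfl, rfl, rfl⟩
      simp only [List.mem_cons, not_or] at hr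
      simp [hr]
    refine vc_startCmd (x := .init t) (hs₂.congr ha₃) (((hm.congr ha₁).congr ha₂).congr ha₃)
      (by simpa using hs₂.target) ht (Or.inl (hb₂.congr ha₃)) (c := fun _ => 0) (p := fun _ => 0)
      (fun z => (hc z).1) (fun z => (hc z).2) rfl (searchInvAt_init ht) ?_
    intro s' τ' j ha' hb' hr hi hd hτ'
    rw [zero_add] at hi
    have he := eq_searchResult hi hd rfl
    rw [he] at hr hi hd
    refine hQ s' τ' j ?_ hb' hr hi hd (by omega)
    refine ((ha₁.trans ha₂ (R'' := prepRegs) (As'' := prepArrs) ?_ ?_ ?_ ?_).trans ha₃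
      (R'' := prepRegs) (As'' := prepArrs) ?_ ?_ ?_ ?_).trans ha' ?_ ?_ ?_ ?_ <;> decide

/-- Follow the search arcs from `vtx`, the vertex at the position `base` of the path, to the
target; record the vertices and the arcs of this path. -/
def extractCmd : Cmd :=
  .seq (.copy .pos .base) (.seq (.ld .arc .par .vtx) (.while (.lt .zero .arc)
    (.seq (.st .arcAt .pos .arc) (.seq (.add .val .arc .one) (.seq (.ld .vtx .inp .val)
      (.seq (.add .pos .pos .one) (.seq (.st .path .pos .vtx) (.ld .arc .par .vtx))))))))

/-- The arcs of the path `l` are recorded in the array `f`, from position `b` on. -/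
def ArcsAt (G : Net n) (f : ℕ → ℕ) (b : ℕ) (l : List (Fin n)) : Prop :=
  ∀ (j : ℕ) (v w : Fin n), l[j]? = some v → l[j + 1]? = some w →
    f (b + j) ∈ G.ids ∧ G.tl (f (b + j)) = v ∧ G.hd (f (b + j)) = w

theorem vc_extractCmd (hs : Static N G t s) {par : Fin n → ℕ}
    (hp : ∀ z : Fin n, s.arr .par z = par z) {pre l : List (Fin n)} {u : Fin n}
    (hl : Follows G par u l) (hpath : ArrayIs (s.arr .path) (pre ++ [u]))
    (hbase : s.reg .base = pre.length) (hu : s.reg .vtx = u)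
    (hlen : pre.length + l.length ≤ n)
    (hQ : ∀ s' τ', Agree [.pos, .arc, .val, .vtx] [.path, .arcAt] s s' →
      ArrayIs (s'.arr .path) (pre ++ l) → ArcsAt G (s'.arr .arcAt) pre.length l →
      s'.reg .pos + 1 = pre.length + l.length → τ' ≤ τ + 30 * N + 10 → Q s' τ') :
    vc N M extractCmd Q s τ := by
  have hN := hs.size_le
  have hun := u.isLt
  simp only [extractCmd, vc, Store.reg_setR, Store.arr_setR, hu, hp,
    reduceCtorEq, if_false, hbase]
  refine ⟨by omega, ?_⟩
  refine vc_while (fun v s' τ' => ∃ (l₁ l₂ : List (Fin n)) (y : Fin n), l = l₁ ++ l₂ ∧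
      Agree [.pos, .arc, .val, .vtx] [.path, .arcAt] s s' ∧ Follows G par y l₂ ∧
      s'.reg .pos = pre.length + l₁.length ∧ s'.reg .vtx = y ∧ s'.reg .arc = par y ∧
      ArrayIs (s'.arr .path) (pre ++ (l₁ ++ [y])) ∧
      ArcsAt G (s'.arr .arcAt) pre.length (l₁ ++ [y]) ∧ τ' ≤ τ + 30 * l₁.length + 8 ∧
      v = l₂.length)
    (v := l.length) ⟨[], l, u, rfl, ?_, hl, by simp, by simp [hu], by simp, by simpa using hpath,
      ?_, by simp, rfl⟩ ?_ ?_
  · refine ⟨fun r hr => ?_, fun _ _ => rfl, rfl, rfl⟩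
    simp only [List.mem_cons, not_or] at hr
    simp [hr]
  · rintro j v w - hw
    simp at hw
  · rintro v s' τ' ⟨l₁, l₂, y, hl12, ha, hf, hpos, hvtx, harc, hpa, haa, hτ, rfl⟩ hlt
    have hs' := hs.congr ha
    have hp' : ∀ z : Fin n, s'.arr .par z = par z := by
      rw [ha.arr .par (by decide)]; exact hp
    simp only [Cond.Holds, harc, hs'.zero] at hlt
    cases hf with
    | last h => omega
    | @step _ l₂ hq htl hf =>
      have h1 := hs.ids_lt _ hq
      have h2 := hs'.head _ hq
      have h3 := (G.hd (par y)).isLt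
      have h4 : l.length = l₁.length + (l₂.length + 1) := by rw [hl12]; simp
      have h5 : 0 < l₂.length := by cases hf <;> simp
      simp only [vc, Store.reg_setR, Store.reg_setA, Store.arr_setR, Store.arr_setA, hpos, harc,
        hs'.one,
        h2, hp', if_true, reduceCtorEq, if_false]
      refine ⟨by omega, by omega, by omega, by omega, by omega, by omega, l₂.length, by simp,
        l₁ ++ [y], l₂, G.hd (par y), by simp [hl12],
        ha.trans (R' := [.pos, .arc, .val, .vtx]) (As' := [.path, .arcAt]) ⟨?_, ?_, rfl, rfl⟩
        (List.Subset.refl _) (List.Subset.refl _) (List.Subset.refl _) (List.Subset.refl _),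
        hf, by simp; omega, by simp, by simp, ?_, ?_, by simp; omega, rfl⟩
      · intro r hr
        simp only [List.mem_cons, not_or] at hr
        simp [hr]
      · intro A hA
        simp only [List.mem_cons, not_or] at hA
        simp [hA]
      · intro j v hj
        have hjl : j < (pre ++ (l₁ ++ [y] ++ [G.hd (par y)])).length :=
          (List.getElem?_eq_some_iff.1 hj).1
        simp only [List.length_append, List.length_singleton] at hjl
        by_cases hje : j = pre.length + (l₁.length + 1)
        · subst hje
          rw [← List.append_assoc, List.getElem?_append_right (by simp)] at hj
          have : v = G.hd (par y) := by simpa using hj.symm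
          rw [← add_assoc, Function.update_self, this]
        · rw [Function.update_of_ne (by omega)]
          refine hpa j v ?_
          rw [← List.append_assoc, List.getElem?_append_left (by simp; omega)] at hj
          exact hj
      · intro j v w hv hw
        have hjl : j + 1 < (l₁ ++ [y] ++ [G.hd (par y)]).length :=
          (List.getElem?_eq_some_iff.1 hw).1
        simp only [List.length_append, List.length_singleton] at hjl
        rw [List.getElem?_append_left (by simp; omega)] at hv
        by_cases hje : j = l₁.length
        · subst hje
          have e1 : v = y := by simpa using hv.symm
          have e2 : w = G.hd (par y) := by
            rw [List.getElem?_append_right (by simp)] at hw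
            simpa using hw.symm
          rw [Function.update_self, e1, e2]
          exact ⟨hq, htl, rfl⟩
        · rw [Function.update_of_ne (by omega)]
          rw [List.getElem?_append_left (by simp; omega)] at hw
          exact haa j v w hv hw
  · rintro v s' τ' ⟨l₁, l₂, y, hl12, ha, hf, hpos, hvtx, harc, hpa, haa, hτ, rfl⟩ hlt
    have hs' := hs.congr ha
    simp only [Cond.Holds, harc, hs'.zero] at hlt
    cases hf with
    | last h =>
      subst hl12
      simp only [List.length_append, List.length_singleton] at hlen
      exact hQ _ _ ha hpa haa (by simp [hpos]; omega) (by omega)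
    | step hq htl hf => exact absurd hlt (by have := G.ne_zero _ hq; omega)

/-- Output the path at the positions up to `plen`. -/
def outputCmd : Cmd :=
  .seq (.const .ctr 0) (.seq (.add .bound .plen .one) (.seq (.while (.lt .ctr .bound)
    (.seq (.ld .val .path .ctr) (.seq (.write .val) (.add .ctr .ctr .one)))) .endSol))

theorem vc_outputCmd (hs : Static N G t s) {l : List (Fin n)}
    (hl : ArrayIs (s.arr .path) l) (hb : s.reg .plen + 1 = l.length) (hln : l.length ≤ n)
    (hcur : s.current = [])
    (hQ : ∀ s' τ', Agree [.ctr, .bound, .val] [] { s with out := s.out ++ [l.map Fin.val] } s' →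
      τ' ≤ τ + 20 * N + 10 → Q s' τ') :
    vc N M outputCmd Q s τ := by
  have hN := hs.size_le
  simp only [outputCmd, vc, Store.reg_setR, reduceCtorEq, if_false, hs.one]
  refine ⟨by omega, by omega, ?_⟩
  refine vc_while (fun v s' τ' => ∃ i ≤ l.length, Agree [.ctr, .bound, .val] []
      { s with current := (l.take i).map Fin.val } s' ∧
      s'.reg .ctr = i ∧ s'.reg .bound = l.length ∧
      τ' ≤ τ + 20 * i + 8 ∧ v = l.length - i)
    (v := l.length) ⟨0, by omega, ⟨?_, fun _ _ => rfl, ?_, rfl⟩, by simp, by simp [hb], by omega,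
      rfl⟩ ?_ ?_
  · intro r hr
    simp only [List.mem_cons, not_or] at hr
    simp [hr]
  · simp [hcur]
  · rintro v s' τ' ⟨i, hi, ha, hc, hbd, hτ, rfl⟩ hlt
    simp only [Cond.Holds, hc, hbd] at hlt
    have hone : s'.reg .one = 1 := by rw [ha.reg .one (by decide)]; exact hs.one
    have hpi : s'.arr .path i = l[i] := by
      rw [ha.arr .path (by decide)]
      exact hl i _ (List.getElem?_eq_getElem hlt)
    simp only [vc, Store.reg_setR, Store.reg_emit, hc, hpi,
      hone, if_true, reduceCtorEq, if_false]
    refine ⟨by omega, by omega, l.length - (i + 1), by omega, i + 1, by omega,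
      ⟨?_, ?_, ?_, ?_⟩, by simp, by simpa using hbd, by omega, rfl⟩
    · intro r hr
      have h1 := ha.reg r hr
      simp only [List.mem_cons, not_or] at hr
      simpa [hr] using h1
    · intro A hA
      simpa using ha.arr A hA
    · have h1 := ha.current
      simp only at h1
      simp only [Store.current_setR, Store.current_emit, h1]
      rw [List.take_add_one, List.getElem?_eq_getElem hlt, List.map_append]
      rfl
    · simpa using ha.out
  · rintro v s' τ' ⟨i, hi, ha, hc, hbd, hτ, rfl⟩ hlt
    simp only [Cond.Holds, hc, hbd] at hlt
    obtain rfl : i = l.length := by omega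
    refine hQ _ _ ⟨ha.reg, ha.arr, ?_, ?_⟩ (by omega)
    · simp [hcur]
    · have h1 := ha.current
      have h2 := ha.out
      simp only [List.take_length] at h1 h2
      simp [h1, h2]

end CallProgram

/-! ### The loop of a call -/

section Branch

variable {n N M : ℕ} {G : Net n} {t : Fin n} {D' : Digraph (Fin n)}
  {s : Store} {x : SearchState n} {k τ : ℕ} {Q : Store → ℕ → Prop}

/-- With `vtx` the vertex at the position `pos` and `mark` the number of its arcs to reached
vertices, stop the loop, or else unblock the vertex and search on. -/
def branchTailCmd : Cmd :=
  .ite (.eq .mark .two) (.seq (.copy .low .pos) (.const .found 1))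
    (.seq (.ld .arc .arcAt .pos) (.seq (.st .par .vtx .arc) startCmd))

/-- Find the largest position of the current call below `lim` for which a recursive call is to
be made. The loop condition fails as soon as `low` has been set to `pos`. -/
def branchLoopCmd : Cmd :=
  .seq (.copy .pos .plen) (.seq (.copy .low .base) (.seq (.const .found 0) (.while (.lt .low .pos)
    (.seq (.sub .pos .pos .one) (.seq (.ld .vtx .path .pos) (.seq (.const .mark 0)
      (.seq (.ite (.lt .pos .lim) (.ld .mark .cnt .vtx) .skip) branchTailCmd)))))))

/-- The registers that the loop may change. -/
abbrev branchRegs : List Reg := .pos :: .low :: .found :: searchRegs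

theorem lastBranch_eq_of_forall_not {find : PathRule (Fin n)} {pre : List (Fin n)} {u : Fin n}
    {i I : ℕ} (h : ∀ j < I, i ≤ j → ¬ Branches find t D' pre u j) :
    lastBranch find t D' pre u I = lastBranch find t D' pre u (min I i) := by
  induction I with
  | zero => simp
  | succ I ih =>
    by_cases hi : i ≤ I
    · rw [lastBranch, if_neg (h I (by omega) hi), ih fun j hj => h j (by omega)]
      congr 1
      omega
    · rw [min_eq_left (by omega)]

/-- The invariant of the loop, which has been entered at the time `τ`: either all positions from
`pos` on have been tested in vain and the search with the vertices before `pos` blocked is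
finished, or the loop has found the position for the next recursive call. -/
def BranchInv (N : ℕ) (G : Net n) (t : Fin n) (D' : Digraph (Fin n)) (find : PathRule (Fin n))
    (pre : List (Fin n)) (u : Fin n) (l : List (Fin n)) (I τ : ℕ) (s : Store) (τ' : ℕ) : Prop :=
  (s.reg .found = 0 ∧ s.reg .low = pre.length ∧ ∃ i x k, i ≤ l.length - 1 ∧
    s.reg .pos = pre.length + i ∧ Blocked (pre ++ l.take i) s ∧ SearchRep x s ∧
    SearchInvAt G D' (pre ++ l.take i) t x k ∧ x.Done ∧
    lastBranch find t D' pre u I = lastBranch find t D' pre u (min I i) ∧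
    τ' + 100 * i ≤ τ + 50 * k + 100 * (l.length - 1) + 10) ∨
  (s.reg .found = 1 ∧ s.reg .low = s.reg .pos ∧ τ' ≤ τ + 150 * N + 15 ∧
    ∃ j, lastBranch find t D' pre u I = some j ∧ s.reg .pos = pre.length + j)

theorem vc_branchLoopCmd {find : PathRule (Fin n)} (hs : Static N G t s) (hm : Marks G D' s)
    {pre l : List (Fin n)} {u : Fin n} (hl : l = find D' pre u)
    (hpl : IsPathAvoiding D' pre u t l) (hpath : ArrayIs (s.arr .path) (pre ++ l))
    (harcs : ArcsAt G (s.arr .arcAt) pre.length l) (hbase : s.reg .base = pre.length)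
    (hplen : s.reg .plen + 1 = pre.length + l.length) (hlen : pre.length + l.length ≤ n)
    (hb : Blocked (pre ++ l.take (l.length - 1)) s) (hr : SearchRep x s)
    (hi : SearchInvAt G D' (pre ++ l.take (l.length - 1)) t x k) (hd : x.Done) {I : ℕ}
    (hlim : ∀ i < l.length - 1, (pre.length + i < s.reg .lim ↔ i < I))
    (hQ : ∀ s' τ', Agree branchRegs prepArrs s s' → τ' ≤ τ + 150 * N + 20 →
      (s'.reg .found = 1 ∧
        ∃ j, lastBranch find t D' pre u I = some j ∧ s'.reg .pos = pre.length + j) ∨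
      (s'.reg .found = 0 ∧ lastBranch find t D' pre u I = none) → Q s' τ') :
    vc N M branchLoopCmd Q s τ := by
  have hN := hs.size_le
  have hlpos := hpl.length_pos
  refine ⟨by omega, ?_⟩
  refine vc_while (fun v s' τ' => Agree branchRegs prepArrs s s' ∧
      v = s'.reg .pos - s'.reg .low ∧
      BranchInv N G t D' find pre u l I τ s' τ')
    (v := s.reg .plen - s.reg .base) ⟨?_, by simp, Or.inl ?_⟩ ?_ ?_
  · refine ⟨fun r hr => ?_, fun _ _ => rfl, rfl, rfl⟩
    simp only [List.mem_cons, not_or] at hr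
    simp [hr]
  · refine ⟨by simp, by simpa using hbase, l.length - 1, x, k, le_rfl, by simp; omega, hb,
      ⟨hr.cnt, hr.par, hr.work, by simpa using hr.top, by simpa using hr.arcs⟩, hi, hd, ?_,
      by omega⟩
    refine lastBranch_eq_of_forall_not ?_
    rintro j - hj ⟨v, w, -, hw, -⟩
    rw [← hl] at hw
    have := (List.getElem?_eq_some_iff.1 hw).1
    omega
  · rintro v s' τ' ⟨ha, rfl, ⟨hf, hlow, i, x, k', hil, hpos, hb, hr, hi, hd, hlast, hτ⟩ |
      ⟨hf, hlow, -⟩⟩ hlt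
    swap
    · simp [Cond.Holds, hlow] at hlt
    simp only [Cond.Holds, hlow, hpos] at hlt
    obtain ⟨i, rfl⟩ : ∃ i', i = i' + 1 := ⟨i - 1, by omega⟩
    have hs' := hs.congr ha
    have hm' := hm.congr ha
    have hv : l[i]? = some (l[i]'(by omega)) := List.getElem?_eq_getElem _
    have hw : l[i + 1]? = some (l[i + 1]'(by omega)) := List.getElem?_eq_getElem _
    generalize l[i]'(by omega) = v at hv
    generalize l[i + 1]'(by omega) = w at hw
    have htk : l.take (i + 1) = l.take i ++ [v] := by rw [List.take_add_one, hv]; rfl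
    have hpi : s'.arr .path (pre.length + i) = v := by
      rw [ha.arr .path (by decide)]
      refine hpath _ _ ?_
      rw [List.getElem?_append_right (by omega), Nat.add_sub_cancel_left, hv]
    have hvn := v.isLt
    have hbr : Branches find t D' pre u i ↔ x.cnt v = 2 := by
      rw [← branch_iff_cnt_eq_two hpl hv hw hi hd hm.le]
      constructor
      · rintro ⟨v', w', hv', hw', h⟩
        rw [← hl] at hv' hw' h
        obtain rfl : v = v' := by simpa [hv] using hv'
        obtain rfl : w = w' := by simpa [hw] using hw'
        exact h
      · intro h
        exact ⟨v, w, by rwa [← hl], by rwa [← hl], by rwa [← hl]⟩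
    have hk' := hi.le
    have tail : ∀ s₁ τ₁, Agree [.pos, .vtx, .mark] [] s' s₁ → s₁.reg .pos = pre.length + i →
        s₁.reg .vtx = v → (s₁.reg .mark = 2 ↔ i < I ∧ x.cnt v = 2) → τ₁ ≤ τ' + 20 →
        vc N M branchTailCmd (fun s' τ' => ∃ v' < pre.length + (i + 1) - pre.length,
          Agree branchRegs prepArrs s s' ∧
          v' = s'.reg .pos - s'.reg .low ∧
          BranchInv N G t D' find pre u l I τ s' τ')
          s₁ τ₁ := by
      intro s₁ τ₁ ha₁ hpos₁ hvtx₁ hmark₁ hτ₁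
      have hs₁ := hs'.congr ha₁
      have ha₀₁ : Agree branchRegs prepArrs s s₁ := by
        refine ha.trans ha₁ ?_ ?_ ?_ ?_ <;> decide
      have harc₁ : s₁.arr .arcAt (pre.length + i) ∈ G.ids ∧
          G.tl (s₁.arr .arcAt (pre.length + i)) = v ∧
          G.hd (s₁.arr .arcAt (pre.length + i)) = w := by
        rw [ha₀₁.arr .arcAt (by decide)]
        exact harcs i v w hv hw
      obtain ⟨q, hq⟩ : ∃ q, s₁.arr .arcAt (pre.length + i) = q := ⟨_, rfl⟩
      rw [hq] at harc₁
      obtain ⟨hqid, hqtl, hqhd⟩ := harc₁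
      simp only [branchTailCmd, vc, Cond.Holds, hs₁.two, hmark₁, Store.reg_setR,
        hpos₁, hq, hvtx₁, reduceCtorEq, if_false, if_true]
      refine ⟨fun h => ⟨by omega, 0, by omega, ?_, by simp, Or.inr ⟨by simp, by simp [hpos₁],
        by omega, i, ?_, by simp [hpos₁]⟩⟩, fun h => ⟨by omega, by omega, ?_⟩⟩
      · refine ha₀₁.trans (R' := branchRegs) (As' := []) ⟨?_, fun _ _ => rfl, rfl, rfl⟩
          (List.Subset.refl _) (List.Subset.refl _) (List.Subset.refl _) (List.nil_subset _)
        intro r hr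
        simp only [List.mem_cons, not_or] at hr
        simp [hr]
      · rw [hlast, min_eq_right (by omega), lastBranch, if_pos (hbr.2 h.2)]
      · have htk' : pre ++ l.take (i + 1) = pre ++ l.take i ++ [v] := by
          rw [htk, List.append_assoc]
        rw [htk'] at hi hb
        have hvX : v ∉ pre ++ l.take i :=
          fun hm => (hpl.drop_take hv).avoids v (List.mem_of_mem_head? (hpl.drop_take hv).head) hm
        have hwr := (reached_iff_exists_path hi hd hm.le w).2 (by
          rw [← htk']
          exact ⟨_, hpl.drop_take hw⟩)
        have hi₂ := searchInvAt_restart hi hd hvX hqid hqtl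
          (hqhd ▸ hpl.adj_getElem hv hw) (hqhd ▸ hwr.1) (hqhd ▸ hwr.2)
        have ha₂ : Agree [.arc] [.par] s₁ ((s₁.setR .arc q).setA .par v q) := by
          refine ⟨fun r hr => ?_, fun A hA => ?_, rfl, rfl⟩
          · simp only [List.mem_cons, not_or] at hr
            simp [hr]
          · simp only [List.mem_cons, not_or] at hA
            simp [hA]
        have ha₀₂ : Agree [.pos, .vtx, .mark, .arc] [.par] s'
            ((s₁.setR .arc q).setA .par v q) := by
          refine ha₁.trans ha₂ ?_ ?_ ?_ ?_ <;> decide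
        refine vc_startCmd (X := pre ++ l.take i) (hs₁.congr ha₂) (hm'.congr ha₀₂)
          (by simpa using hvtx₁) hvX (Or.inr (hb.congr ha₀₂)) (c := x.cnt)
          (p := Function.update x.par v q) ?_ ?_ rfl hi₂ ?_
        · intro z
          rw [ha₀₂.arr .cnt (by decide)]
          exact hr.cnt z
        · intro z
          have hp₁ : ∀ z : Fin n, s₁.arr .par z = x.par z := by
            rw [ha₁.arr .par (by decide)]
            exact hr.par
          simpa using update_fin hp₁ v q z
        · intro s₃ τ₃ j ha₃ hb₃ hr₃ hi₃ hd₃ hτ₃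
          have ha₂₃ : Agree (.vtx :: .mark :: searchRegs) prepArrs s₁ s₃ := by
            refine ha₂.trans ha₃ ?_ ?_ ?_ ?_ <;> decide
          have ha₀₃ : Agree branchRegs prepArrs s s₃ := by
            refine ha₀₁.trans ha₂₃ ?_ ?_ ?_ ?_ <;> decide
          have hpos₃ : s₃.reg .pos = pre.length + i := by
            rw [ha₂₃.reg .pos (by decide), hpos₁]
          have hlow₃ : s₃.reg .low = pre.length := by
            rw [ha₂₃.reg .low (by decide), ha₁.reg .low (by decide), hlow]
          have hf₃ : s₃.reg .found = 0 := by
            rw [ha₂₃.reg .found (by decide), ha₁.reg .found (by decide), hf]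
          refine ⟨i, by omega, ha₀₃, by omega, Or.inl ⟨hf₃, hlow₃, i, _, k' + j, by omega, hpos₃,
            hb₃, hr₃, hi₃, hd₃, ?_, by omega⟩⟩
          rw [hlast]
          by_cases hiI : i < I
          · rw [min_eq_right (by omega), min_eq_right (by omega), lastBranch, if_neg]
            exact fun hB => h ⟨hiI, hbr.1 hB⟩
          · rw [min_eq_left (by omega), min_eq_left (by omega)]
    have hv1 : pre.length + (i + 1) - s'.reg .one = pre.length + i := by rw [hs'.one]; omega
    have hcv : s'.arr .cnt v = x.cnt v := hr.cnt v
    simp only [vc, Cond.Holds, Store.reg_setR, Store.arr_setR, hpos, hlow, hv1, hpi, hcv,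
      reduceCtorEq, if_false, if_true]
    have hlim' : s'.reg .lim = s.reg .lim := ha.reg .lim (by decide)
    have hlimi := hlim i (by omega)
    refine ⟨by omega, by omega, fun h => ⟨by omega, ?_⟩, fun h => ?_⟩
    · refine tail _ _ ⟨?_, fun _ _ => rfl, rfl, rfl⟩ (by simp) (by simp) ?_ (by omega)
      · intro r hr
        simp only [List.mem_cons, not_or] at hr
        simp [hr]
      · have : i < I := hlimi.1 (hlim' ▸ h)
        simp [this]
    · refine tail _ _ ⟨?_, fun _ _ => rfl, rfl, rfl⟩ (by simp) (by simp) ?_ (by omega)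
      · intro r hr
        simp only [List.mem_cons, not_or] at hr
        simp [hr]
      · have : ¬ i < I := fun h' => h (hlim' ▸ hlimi.2 h')
        simp [this]
  · rintro v s' τ' ⟨ha, rfl, ⟨hf, hlow, i, x, k', hil, hpos, hb, hr, hi, hd, hlast, hτ⟩ |
      ⟨hf, hlow, hτ, hj⟩⟩ hlt
    · simp only [Cond.Holds, hlow, hpos] at hlt
      obtain rfl : i = 0 := by omega
      have := hi.le
      refine hQ s' _ ha (by omega) (Or.inr ⟨hf, ?_⟩)
      rw [hlast]
      simp [lastBranch]
    · exact hQ s' _ ha (by omega) (Or.inl ⟨hf, hj⟩)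

end Branch

/-! ### One step of the walk through the tree of calls -/

section Event

variable {n N M : ℕ} {G : Net n} {t : Fin n} {D' : Digraph (Fin n)}
  {s : Store} {τ : ℕ} {Q : Store → ℕ → Prop} {stack : List (Frame (Fin n))}
  {pre l : List (Fin n)} {u : Fin n} {lim : Option ℕ} {out : List (List (Fin n))}

/-- The arrays `E` and `B` hold the suspended calls of the call in the graph `D'` with the path
`path`: for every suspended call the arc that it has deleted and the number of vertices before
its own end vertex. -/
def StackRep (G : Net n) (E B : ℕ → ℕ) :
    Digraph (Fin n) → List (Fin n) → List (Frame (Fin n)) → Prop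
  | _, _, [] => True
  | D', path, f :: st =>
    (∀ a b, f.D.Adj a b → G.D.Adj a b) ∧ E st.length ∈ G.ids ∧
    f.D.Adj (G.tl (E st.length)) (G.hd (E st.length)) ∧
    D' = deleteArc f.D (G.tl (E st.length)) (G.hd (E st.length)) ∧
    B st.length = f.pre.length ∧ f.pre ++ [f.u] <+: path ∧
    path.length = f.pre.length + f.i + 1 ∧ StackRep G E B f.D (f.pre ++ [f.u]) st

open Classical in
/-- The arcs that have not been deleted. -/
noncomputable def liveArcs (G : Net n) (D' : Digraph (Fin n)) : Finset ℕ :=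
  G.ids.toFinset.filter fun q => D'.Adj (G.tl q) (G.hd q)

/-- The part of a state that does not concern the path. Every suspended call has deleted an arc,
so `room` bounds the height of the stack by the number of arcs. -/
structure StateRep (N : ℕ) (G : Net n) (t : Fin n) (stack : List (Frame (Fin n)))
    (D' : Digraph (Fin n)) (pre : List (Fin n)) (u : Fin n) (out : List (List (Fin n)))
    (s : Store) : Prop where
  static : Static N G t s
  marks : Marks G D' s
  notMem : t ∉ pre
  base : s.reg .base = pre.length
  depth : s.reg .depth = stack.length
  parity : s.reg .parity = stack.length % 2
  fin : s.reg .fin = 0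
  current : s.current = []
  out_eq : s.out = out.map fun l => l.map Fin.val
  frames : StackRep G (s.arr .stackArc) (s.arr .stackBase) D' (pre ++ [u]) stack
  room : stack.length + (liveArcs G D').card ≤ G.ids.length

/-- The store represents a running state of the walk through the tree of calls. The registers
count positions along the whole path `pre ++ l`; `lim = none` is encoded by `n`, which is larger
than every position. -/
structure RunRep (N : ℕ) (G : Net n) (t : Fin n) (stack : List (Frame (Fin n)))
    (D' : Digraph (Fin n)) (pre : List (Fin n)) (u : Fin n) (lim : Option ℕ)
    (out : List (List (Fin n))) (s : Store) : Prop
    extends StateRep N G t stack D' pre u out s where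
  nodup : (pre ++ [u]).Nodup
  path : ArrayIs (s.arr .path) (pre ++ [u])
  lim_eq : s.reg .lim = lim.elim n (pre.length + ·)
  lim_lt : ∀ i ∈ lim, pre.length + i < n

/-- The store represents a call that has found the path `l`. -/
structure CallRep (N : ℕ) (G : Net n) (t : Fin n) (stack : List (Frame (Fin n)))
    (D' : Digraph (Fin n)) (pre : List (Fin n)) (u : Fin n) (l : List (Fin n))
    (out : List (List (Fin n))) (s : Store) : Prop
    extends StateRep N G t stack D' pre u out s where
  isPath : IsPathAvoiding D' pre u t l
  nodup : (pre ++ l).Nodup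
  path : ArrayIs (s.arr .path) (pre ++ l)
  arcs : ArcsAt G (s.arr .arcAt) pre.length l
  plen : s.reg .plen + 1 = pre.length + l.length

/-- The store represents a state of the walk through the tree of calls. -/
def TourRep (N : ℕ) (G : Net n) (t : Fin n) : TourState (Fin n) → Store → Prop
  | .run stack D' pre u lim out, s => RunRep N G t stack D' pre u lim out s
  | .halt out, s => s.reg .fin ≠ s.reg .zero ∧ s.out = out.map fun l => l.map Fin.val

/-- The registers and arrays on which `StateRep` depends. -/
abbrev stateRegs : List Reg :=
  [.zero, .one, .two, .size, .target, .cap, .base, .depth, .parity, .fin]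
abbrev stateArrs : List Arr := [.inp, .first, .nxt, .del, .stackArc, .stackBase]

theorem StateRep.congr {s' : Store} {out' : List (List (Fin n))}
    {o : List (List ℕ)} (h : StateRep N G t stack D' pre u out s)
    {R : List Reg} {As : List Arr} (ha : Agree R As { s with out := o } s')
    (ho : o = out'.map fun l => l.map Fin.val)
    (hR : ∀ r ∈ stateRegs, r ∉ R := by decide) (hA : ∀ A ∈ stateArrs, A ∉ As := by decide) :
    StateRep N G t stack D' pre u out' s' := by
  have hs : Static N G t { s with out := o } :=
    ⟨h.static.size_le, h.static.ids_lt, h.static.zero, h.static.one, h.static.two, h.static.size,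
      h.static.target, h.static.cap, h.static.tail, h.static.head, h.static.ins⟩
  refine ⟨hs.congr ha ?_ ?_, ⟨h.marks.le, ?_⟩, h.notMem, ?_, ?_, ?_, ?_, ?_, ?_, ?_, h.room⟩
  · exact fun r hr => hR r ((by decide :
      [Reg.zero, .one, .two, .size, .target, .cap] ⊆ stateRegs) hr)
  · exact fun A hA' => hA A ((by decide : [Arr.inp, .first, .nxt] ⊆ stateArrs) hA')
  · rw [ha.arr _ (hA _ (by decide))]; exact h.marks.del
  · rw [ha.reg _ (hR _ (by decide))]; exact h.base
  · rw [ha.reg _ (hR _ (by decide))]; exact h.depth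
  · rw [ha.reg _ (hR _ (by decide))]; exact h.parity
  · rw [ha.reg _ (hR _ (by decide))]; exact h.fin
  · rw [ha.current]; exact h.current
  · rw [ha.out]; exact ho
  · rw [ha.arr .stackArc (hA _ (by decide)), ha.arr .stackBase (hA _ (by decide))]; exact h.frames

theorem CallRep.congr {s' : Store} {out' : List (List (Fin n))}
    {o : List (List ℕ)} (h : CallRep N G t stack D' pre u l out s)
    {R : List Reg} {As : List Arr} (ha : Agree R As { s with out := o } s')
    (ho : o = out'.map fun l => l.map Fin.val)
    (hR : ∀ r ∈ .plen :: stateRegs, r ∉ R := by decide)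
    (hA : ∀ A ∈ .path :: .arcAt :: stateArrs, A ∉ As := by decide) :
    CallRep N G t stack D' pre u l out' s' := by
  refine ⟨h.toStateRep.congr ha ho (fun r hr => hR r (List.mem_cons_of_mem _ hr))
    (fun A hA' => hA A (List.mem_cons_of_mem _ (List.mem_cons_of_mem _ hA'))), h.isPath, h.nodup,
    ?_, ?_, ?_⟩
  · rw [ha.arr _ (hA _ (by simp))]; exact h.path
  · rw [ha.arr _ (hA _ (by simp))]; exact h.arcs
  · rw [ha.reg _ (hR _ (by simp))]; exact h.plen

theorem ArrayIs.prefix {f : ℕ → ℕ} {l l' : List (Fin n)} (h : ArrayIs f l) (hl : l' <+: l) :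
    ArrayIs f l' := by
  obtain ⟨r, rfl⟩ := hl
  intro j v hj
  refine h j v ?_
  rw [List.getElem?_append_left (List.getElem?_eq_some_iff.1 hj).1, hj]

theorem StackRep.update {E B : ℕ → ℕ} {path : List (Fin n)} (h : StackRep G E B D' path stack)
    {k : ℕ} (hk : stack.length ≤ k) (a b : ℕ) :
    StackRep G (Function.update E k a) (Function.update B k b) D' path stack := by
  induction stack generalizing D' path with
  | nil => trivial
  | cons f st ih =>
    simp only [List.length_cons] at hk
    have hne : st.length ≠ k := by omega
    obtain ⟨h1, h2, h3, h4, h5, h6, h7, h8⟩ := h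
    refine ⟨h1, ?_⟩
    rw [Function.update_of_ne hne, Function.update_of_ne hne]
    exact ⟨h2, h3, h4, h5, h6, h7, ih h8 (by omega)⟩

theorem deleteArc_adj_iff (D₀ : Digraph (Fin n)) {q q' : ℕ}
    (hq : q ∈ G.ids) (hq' : q' ∈ G.ids) :
    (deleteArc D₀ (G.tl q) (G.hd q)).Adj (G.tl q') (G.hd q') ↔
      D₀.Adj (G.tl q') (G.hd q') ∧ q' ≠ q := by
  refine and_congr_right fun _ => not_congr ⟨fun h => G.inj _ hq' _ hq h.1 h.2, ?_⟩
  rintro rfl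
  exact ⟨rfl, rfl⟩

theorem card_liveArcs_deleteArc {D₀ : Digraph (Fin n)} {q : ℕ}
    (hq : q ∈ G.ids) (hadj : D₀.Adj (G.tl q) (G.hd q)) :
    (liveArcs G (deleteArc D₀ (G.tl q) (G.hd q))).card + 1 = (liveArcs G D₀).card := by
  classical
  have : liveArcs G (deleteArc D₀ (G.tl q) (G.hd q)) = (liveArcs G D₀).erase q := by
    ext q'
    simp only [liveArcs, Finset.mem_filter, Finset.mem_erase, List.mem_toFinset]
    constructor
    · rintro ⟨h1, h2⟩
      have := (deleteArc_adj_iff D₀ hq h1).1 h2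
      exact ⟨this.2, h1, this.1⟩
    · rintro ⟨h1, h2, h3⟩
      exact ⟨h2, (deleteArc_adj_iff D₀ hq h2).2 ⟨h3, h1⟩⟩
  rw [this]
  exact Finset.card_erase_add_one (by simp [liveArcs, hq, hadj])

/-- Begin the recursive call for the position `pos`. -/
def pushCmd : Cmd :=
  .seq (.ld .arc .arcAt .pos) (.seq (.st .del .arc .one) (.seq (.st .stackArc .depth .arc)
    (.seq (.st .stackBase .depth .base) (.seq (.add .depth .depth .one)
      (.seq (.sub .parity .one .parity) (.seq (.copy .base .pos) (.copy .lim .size)))))))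

/-- The new call begins with a path that is already in the array `path`, and its deleted arc pays
for its place on the stack. -/
theorem vc_pushCmd (h : CallRep N G t stack D' pre u l out s) {j : ℕ} {v w : Fin n}
    (hpos : s.reg .pos = pre.length + j) (hv : l[j]? = some v) (hw : l[j + 1]? = some w)
    (hQ : ∀ s' τ', RunRep N G t (⟨D', pre, u, j⟩ :: stack) (deleteArc D' v w) (pre ++ l.take j) v
      none out s' → τ' ≤ τ + 40 → Q s' τ') :
    vc N M pushCmd Q s τ := by
  classical
  have hs := h.static
  have hN := hs.size_le
  have hlen : pre.length + l.length ≤ n := by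
    simpa using h.nodup.length_le_card
  have hj := (List.getElem?_eq_some_iff.1 hw).1
  obtain ⟨hq, htl, hhd⟩ := h.arcs j v w hv hw
  obtain ⟨q, hqe⟩ : ∃ q, s.arr .arcAt (pre.length + j) = q := ⟨_, rfl⟩
  rw [hqe] at hq htl hhd
  subst htl hhd
  have hqN := hs.ids_lt q hq
  have hadj := h.isPath.adj_getElem hv hw
  have hroom := h.room
  have hlive := card_liveArcs_deleteArc hq hadj
  have htake : (l.take j).length = j := by rw [List.length_take]; omega
  have htk : pre ++ l.take j ++ [G.tl q] = pre ++ l.take (j + 1) := by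
    rw [List.take_add_one, hv, List.append_assoc]; rfl
  have hsub : pre ++ l.take (j + 1) <+: pre ++ l :=
    List.prefix_append_right_inj _ |>.2 (List.take_prefix _ _)
  obtain ⟨l', hl'⟩ := h.isPath.exists_cons
  simp only [pushCmd, vc, Store.reg_setR, Store.reg_setA, hpos, hqe, h.depth,
    h.base, h.parity, hs.one, hs.size, if_true, reduceCtorEq, if_false]
  refine ⟨by omega, by omega, by omega, by omega, by omega, hQ _ _ ⟨⟨?_, ⟨?_, ?_⟩, ?_, ?_, ?_, ?_,
    ?_, h.current, h.out_eq, ?_, ?_⟩, ?_, ?_, ?_, by simp⟩ (by omega)⟩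
  · refine hs.congr (R := [.arc, .depth, .parity, .base, .lim])
      (As := [.del, .stackArc, .stackBase]) ⟨fun r hr => ?_, fun A hA => ?_, rfl, h.out_eq ▸ rfl⟩
    · simp only [List.mem_cons, not_or] at hr
      simp [hr]
    · simp only [List.mem_cons, not_or] at hA
      simp [hA]
  · exact fun a b hab => h.marks.le a b hab.1
  · intro q' hq'
    have h1 := h.marks.del q' hq'
    simp only [deleteArc_adj_iff D' hq hq']
    by_cases he : q' = q
    · simp [he]
    · simpa [he] using h1
  · rw [List.mem_append, not_or]
    refine ⟨h.notMem, fun hm => ?_⟩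
    obtain ⟨j', hj', he⟩ := List.mem_take_iff_getElem.1 hm
    have := h.isPath.getElem?_eq_last (List.getElem?_eq_some_iff.2 ⟨_, he⟩)
    omega
  · simp [htake]
  · simp
  · simp only [Store.reg_setR, reduceCtorEq, if_false, if_true, List.length_cons]
    omega
  · simpa using h.fin
  · have hst := h.frames.update le_rfl q pre.length
    simp only [StackRep, Store.arr_setR, Store.arr_setA, reduceCtorEq, if_true, if_false,
      Function.update_self, true_and]
    refine ⟨h.marks.le, hq, hadj, ?_, by simp [htake, Nat.add_assoc], hst⟩
    rw [htk, hl', List.take_succ_cons]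
    exact ⟨l'.take j, by simp⟩
  · simp only [List.length_cons]
    omega
  · rw [htk]
    exact h.nodup.sublist hsub.sublist
  · rw [htk]
    simpa using h.path.prefix hsub
  · simp

/-- Resume the suspended call on top of the stack. -/
def popCmd : Cmd :=
  .seq (.sub .depth .depth .one) (.seq (.ld .arc .stackArc .depth) (.seq (.st .del .arc .zero)
    (.seq (.copy .lim .base) (.seq (.ld .base .stackBase .depth) (.sub .parity .one .parity)))))

/-- Return from a call. -/
def returnCmd : Cmd :=
  .seq (.ite (.eq .parity .one) outputCmd .skip) (.ite (.eq .depth .zero) (.copy .fin .one) popCmd)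

/-- The path of a suspended call is a prefix of the path of the call that returns, so the array
`path` need not be restored. -/
theorem vc_popCmd (h : CallRep N G t stack D' pre u l out s)
    (hQ : ∀ s' τ', TourRep N G t (.ret stack out) s' → τ' ≤ τ + 30 → Q s' τ') :
    vc N M (.ite (.eq .depth .zero) (.copy .fin .one) popCmd) Q s τ := by
  classical
  have hs := h.static
  have hN := hs.size_le
  simp only [vc, Cond.Holds, h.depth, hs.zero]
  cases stack with
  | nil =>
    refine ⟨fun _ => hQ _ _ ⟨by simp [hs.zero, hs.one], h.out_eq⟩ (by omega), fun h => absurd rfl h⟩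
  | cons f st =>
    obtain ⟨h1, h2, h3, h4, h5, h6, h7, h8⟩ := h.frames
    obtain ⟨q, hqe⟩ : ∃ q, s.arr .stackArc st.length = q := ⟨_, rfl⟩
    rw [hqe] at h2 h3 h4
    have hqN := hs.ids_lt q h2
    have hroom := h.room
    have hlive := card_liveArcs_deleteArc h2 h3
    rw [← h4] at hlive
    simp only [List.length_cons] at hroom
    obtain ⟨l', hl'⟩ := h.isPath.exists_cons
    have hpre : pre ++ [u] <+: pre ++ l := by
      rw [hl']
      exact ⟨l', by simp⟩
    have hlen : pre.length + 1 ≤ n := by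
      have := (h.nodup.sublist hpre.sublist).length_le_card
      simpa using this
    have hfpre : f.pre <+: pre := by
      refine List.prefix_of_prefix_length_le ((List.prefix_append _ _).trans h6)
        (List.prefix_append _ _) ?_
      simp only [List.length_append, List.length_singleton] at h7
      omega
    refine ⟨fun h => absurd h (by simp), fun _ => ?_⟩
    have hd1 : st.length + 1 - 1 = st.length := rfl
    have hpar : 1 - (st.length + 1) % 2 = st.length % 2 := by omega
    simp only [popCmd, vc, Store.reg_setR, Store.reg_setA, Store.arr_setR, Store.arr_setA, hqe,
      h.depth, h.base, h.parity, hs.one, List.length_cons, hd1, hpar, h5, hs.zero, if_true,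
      reduceCtorEq, if_false]
    refine ⟨by omega, by omega, by omega, hQ _ _ ⟨⟨?_, ⟨h1, ?_⟩, ?_, ?_, ?_, ?_,
      ?_, h.current, h.out_eq, ?_, ?_⟩, ?_, ?_, ?_, ?_⟩ (by omega)⟩
    · refine hs.congr (R := [.arc, .depth, .parity, .base, .lim])
        (As := [.del]) ⟨fun r hr => ?_, fun A hA => ?_, rfl, h.out_eq ▸ rfl⟩
      · simp only [List.mem_cons, not_or] at hr
        simp [hr]
      · simp only [List.mem_cons, not_or] at hA
        simp [hA]
    · intro q' hq'
      have h1' := h.marks.del q' hq'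
      rw [h4] at h1'
      simp only [deleteArc_adj_iff f.D h2 hq'] at h1'
      by_cases he : q' = q
      · simp [he, h3]
      · simpa [he] using h1'
    · exact fun hm => h.notMem (hfpre.subset hm)
    · simp
    · simp
    · simp
    · simpa using h.fin
    · simpa using h8
    · omega
    · exact (h.nodup.sublist hpre.sublist).sublist h6.sublist
    · simpa using h.path.prefix (h6.trans hpre)
    · simp only [List.length_append, List.length_singleton] at h7
      simp; omega
    · intro i hi
      obtain rfl : f.i = i := by simpa using hi
      simp only [List.length_append, List.length_singleton] at h7
      omega

theorem vc_outputCmd_call (h : CallRep N G t stack D' pre u l out s)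
    (hQ : ∀ s' τ', Agree [.ctr, .bound, .val] []
      { s with out := s.out ++ [(pre ++ l).map Fin.val] } s' →
      CallRep N G t stack D' pre u l (out ++ [pre ++ l]) s' → τ' ≤ τ + 20 * N + 10 → Q s' τ') :
    vc N M outputCmd Q s τ := by
  refine vc_outputCmd h.static h.path (by simpa using h.plen)
    (by simpa using h.nodup.length_le_card) h.current ?_
  intro s' τ' ha hτ
  exact hQ s' τ' ha (h.congr ha (by simp [h.out_eq])) hτ

theorem vc_returnCmd (h : CallRep N G t stack D' pre u l out s)
    (hQ : ∀ s' τ', TourRep N G t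
      (.ret stack (out ++ if Odd stack.length then [pre ++ l] else [])) s' →
      τ' ≤ τ + 20 * N + 50 → Q s' τ') :
    vc N M returnCmd Q s τ := by
  have hodd : s.reg .parity = s.reg .one ↔ Odd stack.length := by
    rw [h.parity, h.static.one, Nat.odd_iff]
  refine ⟨fun hc => ?_, fun hc => ?_⟩
  · rw [if_pos (hodd.1 hc)] at hQ
    refine vc_outputCmd_call h fun s' τ' _ h' hτ => vc_popCmd h' fun s'' τ'' h'' hτ' => ?_
    exact hQ _ _ h'' (by omega)
  · rw [if_neg (hodd.not.1 hc), List.append_nil] at hQ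
    refine vc_popCmd h fun s'' τ'' h'' hτ' => hQ _ _ h'' (by omega)

/-- The part of a call that follows the first search. -/
def callCmd : Cmd :=
  .seq extractCmd (.seq (.copy .plen .pos) (.seq (.ite (.eq .lim .size)
    (.ite (.eq .parity .zero) outputCmd .skip) .skip) (.seq (.copy .bound .plen) (.seq prepCmd
      (.seq branchLoopCmd (.ite (.eq .found .one) pushCmd returnCmd))))))

/-- Proceed to the beginning of the next recursive call or to the next return from a call. -/
def eventCmd : Cmd :=
  .seq (.copy .bound .base) (.seq prepCmd (.seq (.ld .vtx .path .base) (.seq (.ld .mark .cnt .vtx)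
    (.ite (.eq .mark .zero) (.copy .fin .one) callCmd))))

/-- What a call does after it has found its path and has perhaps output it. -/
theorem vc_callCmd_tail (h : CallRep N G t stack D' pre u l out s)
    (hl : l = G.find t D' pre u) {I : ℕ}
    (hlim : ∀ i < l.length - 1, (pre.length + i < s.reg .lim ↔ i < I))
    (hQ : ∀ s' τ', TourRep N G t (.resume (G.find t) t stack D' pre u I out) s' →
      τ' ≤ τ + 300 * N + 300 → Q s' τ') :
    vc N M (.seq (.copy .bound .plen) (.seq prepCmd
      (.seq branchLoopCmd (.ite (.eq .found .one) pushCmd returnCmd)))) Q s τ := by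
  have hlen : pre.length + l.length ≤ n := by
    simpa using h.nodup.length_le_card
  have hplen := h.plen
  have hlpos := h.isPath.length_pos
  have ha₁ : Agree [.bound] [] s (s.setR .bound (s.reg .plen)) := by
    refine ⟨fun r hr => ?_, fun _ _ => rfl, rfl, rfl⟩
    simp only [List.mem_cons, not_or] at hr
    simp [hr]
  have hX : pre ++ l.take (l.length - 1) =
      (pre ++ l).take ((s.setR .bound (s.reg .plen)).reg .bound) := by
    have : s.reg .plen = pre.length + (l.length - 1) := by omega
    simp only [Store.reg_setR, if_true, this]
    rw [List.take_length_add_append]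
  have htX : t ∉ pre ++ l.take (l.length - 1) := by
    rw [List.mem_append, not_or]
    refine ⟨h.notMem, fun hm => ?_⟩
    obtain ⟨j', hj', he⟩ := List.mem_take_iff_getElem.1 hm
    have := h.isPath.getElem?_eq_last (List.getElem?_eq_some_iff.2 ⟨_, he⟩)
    omega
  refine vc_prepCmd (X := pre ++ l.take (l.length - 1)) (l := pre ++ l) (h.static.congr ha₁)
    (h.marks.congr ha₁) (by simpa using h.path) (by simp; omega) (by simpa using hlen) hX htX ?_
  intro s₂ τ₂ k ha₂ hb₂ hr₂ hi₂ hd₂ hτ₂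
  have hk := hi₂.le
  have hN := h.static.size_le
  have ha₀₂ : Agree (.bound :: prepRegs) prepArrs s s₂ := by
    refine ha₁.trans ha₂ ?_ ?_ ?_ ?_ <;> decide
  have h₂ : CallRep N G t stack D' pre u l out s₂ := h.congr (o := s.out) ha₀₂ h.out_eq
  refine vc_branchLoopCmd (find := G.find t) h₂.static h₂.marks hl h₂.isPath h₂.path h₂.arcs h₂.base
    h₂.plen hlen hb₂ hr₂ hi₂ hd₂ (I := I) ?_ ?_
  · rw [ha₀₂.reg .lim (by decide)]
    exact hlim
  · intro s₃ τ₃ ha₃ hτ₃ hres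
    have h₃ : CallRep N G t stack D' pre u l out s₃ := h₂.congr (o := s₂.out) ha₃ h₂.out_eq
    rw [TourState.resume] at hQ
    simp only [vc, Cond.Holds, h₃.static.one]
    rcases hres with ⟨hf, j, hj, hpos⟩ | ⟨hf, hnone⟩
    · obtain ⟨-, v, w, hv, hw, -⟩ := lastBranch_spec hj
      rw [hj] at hQ
      simp only [hv, hw] at hQ
      rw [← hl] at hv hw hQ
      refine ⟨fun _ => vc_pushCmd h₃ hpos hv hw fun s' τ' h' hτ' => hQ s' τ' h' (by omega),
        fun h => absurd hf h⟩
    · rw [hnone] at hQ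
      simp only at hQ
      rw [← hl] at hQ
      refine ⟨fun h => by omega, fun _ => vc_returnCmd h₃ fun s' τ' h' hτ' =>
        hQ s' τ' h' (by omega)⟩

/-- The machine simulates one step of the walk in linear time: it makes two searches in all, one for
the path and one that is continued through the whole loop. -/
theorem vc_eventCmd (h : RunRep N G t stack D' pre u lim out s)
    (hQ : ∀ s' τ', TourRep N G t (TourState.next (G.find t) t (.run stack D' pre u lim out)) s' →
      τ' ≤ τ + 500 * N + 500 → Q s' τ') :
    vc N M eventCmd Q s τ := by
  have hN := h.static.size_le
  have hlen : pre.length + 1 ≤ n := by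
    simpa using h.nodup.length_le_card
  have hu : u ∉ pre := by
    have := h.nodup
    rw [List.nodup_append'] at this
    exact fun hm => this.2.2 hm (by simp)
  have ha₁ : Agree [.bound] [] s (s.setR .bound (s.reg .base)) := by
    refine ⟨fun r hr => ?_, fun _ _ => rfl, rfl, rfl⟩
    simp only [List.mem_cons, not_or] at hr
    simp [hr]
  refine vc_prepCmd (X := pre) (l := pre ++ [u]) (h.static.congr ha₁) (h.marks.congr ha₁)
    (by simpa using h.path) (by simp [h.base]) (by simpa using hlen) (by simp [h.base])
    h.notMem ?_
  intro s₂ τ₂ k ha₂ hb₂ hr₂ hi₂ hd₂ hτ₂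
  have hk := hi₂.le
  have ha₀₂ : Agree (.bound :: prepRegs) prepArrs s s₂ := by
    refine ha₁.trans ha₂ ?_ ?_ ?_ ?_ <;> decide
  have h₂ : StateRep N G t stack D' pre u out s₂ := h.toStateRep.congr (o := s.out) ha₀₂ h.out_eq
  have hpath₂ : ArrayIs (s₂.arr .path) (pre ++ [u]) := by
    rw [ha₀₂.arr .path (by decide)]
    exact h.path
  have hpu : s₂.arr .path pre.length = u := hpath₂ _ _ (by simp)
  have hun := u.isLt
  have hreach := reached_iff_exists_path hi₂ hd₂ h₂.marks.le u
  have hcnt := hr₂.cnt u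
  simp only [vc, Cond.Holds, Store.reg_setR, Store.arr_setR, h₂.base, hpu, hcnt, h₂.static.zero,
    if_true, reduceCtorEq, if_false]
  refine ⟨by omega, by omega, fun h0 => ?_, fun h0 => ?_⟩
  · have hno : ¬ ∃ l, IsPathAvoiding D' pre u t l := fun he => (hreach.2 he).2 h0
    rw [TourState.next, if_neg hno] at hQ
    exact hQ _ _ ⟨by simp [h₂.static.one, h₂.static.zero], h₂.out_eq⟩ (by omega)
  · have hex := hreach.1 ⟨hu, h0⟩
    rw [TourState.next, if_pos hex] at hQ
    have hfol := Net.follows_find hi₂ hu h0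
    have hval := Net.find_valid G t D' pre u hex
    obtain ⟨l, hl⟩ : ∃ l, l = G.find t D' pre u := ⟨_, rfl⟩
    rw [← hl] at hfol hval hQ
    have hnd : (pre ++ l).Nodup := by
      rw [List.nodup_append']
      have := h.nodup
      rw [List.nodup_append'] at this
      exact ⟨this.1, hval.nodup, fun x hx hx' => hval.avoids x hx' hx⟩
    have hlenl : pre.length + l.length ≤ n := by
      simpa using hnd.length_le_card
    obtain ⟨s₃, hs₃⟩ : ∃ s₃, s₃ = (s₂.setR .vtx u).setR .mark
        ((searchResult G D' pre t).cnt u) := ⟨_, rfl⟩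
    rw [← hs₃]
    have ha₃ : Agree [.vtx, .mark] [] s₂ s₃ := by
      refine ⟨fun r hr => ?_, fun A hA => ?_, by simp [hs₃], by simp [hs₃]⟩
      · simp only [List.mem_cons, not_or] at hr
        simp [hs₃, hr]
      · simp [hs₃]
    have h₃ : StateRep N G t stack D' pre u out s₃ := h₂.congr (o := s₂.out) ha₃ h₂.out_eq
    refine vc_extractCmd h₃.static (par := (searchResult G D' pre t).par) ?_ hfol ?_ h₃.base
      (by simp [hs₃]) hlenl ?_
    · rw [ha₃.arr .par (by decide)]
      exact hr₂.par
    · rw [ha₃.arr .path (by decide)]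
      exact hpath₂
    intro s₄ τ₄ ha₄ hp₄ harcs₄ hpos₄ hτ₄
    have ha₅ : Agree [.plen] [] s₄ (s₄.setR .plen (s₄.reg .pos)) := by
      refine ⟨fun r hr => ?_, fun _ _ => rfl, rfl, rfl⟩
      simp only [List.mem_cons, not_or] at hr
      simp [hr]
    obtain ⟨s₅, hs₅⟩ : ∃ s₅, s₅ = s₄.setR .plen (s₄.reg .pos) := ⟨_, rfl⟩
    simp only [vc]
    rw [← hs₅] at ha₅ ⊢
    have h₄ : StateRep N G t stack D' pre u out s₄ := h₃.congr (o := s₃.out) ha₄ h₃.out_eq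
    have h₅ : CallRep N G t stack D' pre u l out s₅ := by
      refine ⟨h₄.congr (o := s₄.out) ha₅ h₄.out_eq, hval, hnd, ?_, ?_, by simp [hs₅, hpos₄]⟩
      · rw [ha₅.arr .path (by decide)]
        exact hp₄
      · rw [ha₅.arr .arcAt (by decide)]
        exact harcs₄
    have hlim₅ : s₅.reg .lim = lim.elim n (pre.length + ·) := by
      rw [ha₅.reg .lim (by decide), ha₄.reg .lim (by decide), ha₃.reg .lim (by decide),
        ha₀₂.reg .lim (by decide), h.lim_eq]
    have hlimI : ∀ i < l.length - 1,
        (pre.length + i < s₅.reg .lim ↔ i < lim.getD (l.length - 1)) := by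
      intro i hi
      rw [hlim₅]
      cases lim with
      | none => simp only [Option.elim_none, Option.getD_none]; omega
      | some i₀ => simp
    have hfresh : s₅.reg .lim = s₅.reg .size ↔ lim = none := by
      rw [hlim₅, h₅.static.size]
      cases hl' : lim with
      | none => simp
      | some i₀ =>
        have := h.lim_lt i₀ hl'
        simp only [Option.elim_some, reduceCtorEq, iff_false]
        omega
    have heven : s₅.reg .parity = s₅.reg .zero ↔ Even stack.length := by
      rw [h₅.parity, h₅.static.zero, Nat.even_iff]
    simp only [Cond.Holds, hfresh, heven]
    refine ⟨fun hc => ⟨fun hc' => ?_, fun hc' => ?_⟩, fun hc => ?_⟩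
    · rw [if_pos ⟨hc, hc'⟩] at hQ
      refine vc_outputCmd_call h₅ fun s₆ τ₆ ha₆ h₆ hτ₆ => ?_
      refine vc_callCmd_tail h₆ hl (I := lim.getD (l.length - 1)) ?_ fun s' τ' h' hτ' =>
        hQ s' τ' h' (by omega)
      rw [ha₆.reg .lim (by decide)]
      exact hlimI
    · rw [if_neg fun h => hc' h.2, List.append_nil] at hQ
      exact vc_callCmd_tail h₅ hl (I := lim.getD (l.length - 1)) hlimI fun s' τ' h' hτ' =>
        hQ s' τ' h' (by omega)
    · rw [if_neg fun h => hc h.1, List.append_nil] at hQ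
      exact vc_callCmd_tail h₅ hl (I := lim.getD (l.length - 1)) hlimI fun s' τ' h' hτ' =>
        hQ s' τ' h' (by omega)

end Event

/-! ### Delay of the walk -/

section Delay

variable {A M B B' r : ℕ} {L : List (List ℕ)} {c : Config}

/-- The run from `c` stays safe, halts with the output `L`, and from any moment on completes a
further solution or halts within time `B`. -/
structure Config.Enumerating (A M B : ℕ) (L : List (List ℕ)) (c : Config) : Prop where
  safe : ∀ k, (Config.step^[k] c).Safe A M
  delay : ∀ k, ∃ j ≤ k + B, (Config.step^[j] c).Halted ∨
    (Config.step^[k] c).out.length < (Config.step^[j] c).out.length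
  result : ∃ k, (Config.step^[k] c).Halted ∧ (Config.step^[k] c).out = L

/-- The run from `c` completes a further solution or halts within time `B`. -/
def Config.Soon (B : ℕ) (c : Config) : Prop :=
  ∃ j ≤ B, (Config.step^[j] c).Halted ∨ c.out.length < (Config.step^[j] c).out.length

theorem Config.step_of_halted (h : c.Halted) : c.step = c := by
  have h' : c.todo = [] := h
  rw [Config.step, h']

theorem Config.iterate_step_of_halted (h : c.Halted) (k : ℕ) : Config.step^[k] c = c :=
  Function.iterate_fixed (Config.step_of_halted h) k

theorem Config.length_out_le_step (c : Config) : c.out.length ≤ c.step.out.length := by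
  unfold Config.step
  split <;> simp

theorem Config.length_out_le_iterate (c : Config) (k : ℕ) :
    c.out.length ≤ (Config.step^[k] c).out.length := by
  induction k with
  | zero => exact le_rfl
  | succ k ih =>
    rw [Function.iterate_succ_apply']
    exact ih.trans (Config.length_out_le_step _)

theorem Config.Enumerating.soon (h : c.Enumerating A M B L) : c.Soon B := by
  simpa [Config.Soon] using h.delay 0

theorem Config.Enumerating.mono (h : c.Enumerating A M B L) (hB : B ≤ B') :
    c.Enumerating A M B' L := by
  refine ⟨h.safe, fun k => ?_, h.result⟩
  obtain ⟨j, hj, hd⟩ := h.delay k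
  exact ⟨j, by omega, hd⟩

theorem Config.Enumerating.of_halted (h : c.Halted) (hs : ∀ a, c.reg a < M ∧ c.mem a < M) :
    c.Enumerating A M B c.out := by
  refine ⟨fun k => ?_, fun k => ⟨k, by omega, Or.inl ?_⟩, ⟨0, h, rfl⟩⟩
  · rw [Config.iterate_step_of_halted h]
    refine ⟨fun a ha => ?_, hs⟩
    have h' : c.todo = [] := h
    simp [Config.address, h'] at ha
  · rwa [Config.iterate_step_of_halted h]

/-- A run of at most `r` steps may precede. -/
theorem Config.Enumerating.of_run {j : ℕ} (hs : ∀ i < j, (Config.step^[i] c).Safe A M)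
    (hj : j ≤ r) (hsoon : (Config.step^[j] c).Soon B') (hB : B' + r ≤ B)
    (h : (Config.step^[j] c).Enumerating A M B L) : c.Enumerating A M B L := by
  have hlate : ∀ k, j ≤ k → Config.step^[k] c = Config.step^[k - j] (Config.step^[j] c) := by
    intro k hk
    rw [← Function.iterate_add_apply, Nat.sub_add_cancel hk]
  refine ⟨fun k => ?_, fun k => ?_, ?_⟩
  · rcases lt_or_ge k j with hk | hk
    · exact hs k hk
    · rw [hlate k hk]
      exact h.safe _
  · rcases lt_or_ge k j with hk | hk
    · obtain ⟨i, hi, hd⟩ := hsoon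
      refine ⟨i + j, by omega, ?_⟩
      rw [Function.iterate_add_apply]
      refine hd.imp id fun hd => lt_of_le_of_lt ?_ hd
      have := Config.length_out_le_iterate (Config.step^[k] c) (j - k)
      rwa [← Function.iterate_add_apply, Nat.sub_add_cancel hk.le] at this
    · obtain ⟨i, hi, hd⟩ := h.delay (k - j)
      refine ⟨i + j, by omega, ?_⟩
      rwa [hlate k hk, Function.iterate_add_apply]
  · obtain ⟨k, hk⟩ := h.result
    exact ⟨k + j, by rwa [Function.iterate_add_apply]⟩

/-- A preliminary program of running time below `r` adds at most `r` to the delay. -/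
theorem Config.Enumerating.seq {p q : Prog} {σ : Mach} (hb : σ.Bdd M)
    (h : WP1 A M p (fun σ' j => j < r ∧
      (σ'.Bdd M → (σ'.cfg [q]).Enumerating A M B L)) σ 0) :
    (σ.cfg [.seq p q]).Enumerating A M (B + r) L := by
  obtain ⟨j, σ', h1, h2, h3, h4, h5⟩ := h hb [q]
  have h5 := h5 h3
  have hstep : Config.step^[j + 1] (σ.cfg [.seq p q]) = σ'.cfg [q] := by
    rw [Function.iterate_succ_apply]
    exact h1
  refine Config.Enumerating.of_run (B' := B) (j := j + 1) (r := r) ?_ (by omega) ?_ le_rfl ?_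
  · rintro (_ | i) hi
    · exact ⟨by simp [Config.address, Mach.cfg], hb⟩
    · rw [Function.iterate_succ_apply]
      exact h2 i (by omega)
  · rw [hstep]
    exact h5.soon
  · rw [hstep]
    exact h5.mono (by omega)

end Delay

section MainLoop

variable {n N M : ℕ} {G : Net n} {t : Fin n}

/-- Walk through the tree of calls until the main call returns. -/
def mainLoopCmd : Cmd := .while (.eq .fin .zero) eventCmd

/-- The configuration represents a state of the walk through the tree of calls. -/
def HeadRep (N M : ℕ) (G : Net n) (t : Fin n) : TourState (Fin n) → Config → Prop
  | .run stack D' pre u lim out, c => ∃ σ s, c = σ.cfg [mainLoopCmd.compile] ∧ σ.Bdd M ∧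
      Rep N M s σ ∧ RunRep N G t stack D' pre u lim out s
  | .halt out, c => ∃ σ : Mach, c = σ.cfg [] ∧ σ.Bdd M ∧
      σ.out = out.map fun l => l.map Fin.val

theorem HeadRep.out {a : TourState (Fin n)} {c : Config} (h : HeadRep N M G t a c) :
    c.out = a.out.map fun l => l.map Fin.val := by
  cases a with
  | run =>
    obtain ⟨σ, s, rfl, -, h1, h2⟩ := h
    exact h1.out.trans h2.out_eq
  | halt =>
    obtain ⟨σ, rfl, -, h1⟩ := h
    exact h1

theorem HeadRep.halted {a : TourState (Fin n)} {c : Config} (h : HeadRep N M G t a c)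
    (ha : a.IsHalt) : c.Halted := by
  cases a with
  | run => exact ha.elim
  | halt =>
    obtain ⟨σ, rfl, -, -⟩ := h
    rfl

/-- The machine simulates a step of the walk in linear time. -/
theorem HeadRep.next {a : TourState (Fin n)} {c : Config} (h : HeadRep N M G t a c) :
    ∃ j ≤ 700 * N, HeadRep N M G t (TourState.next (G.find t) t a) (Config.step^[j] c) ∧
      ∀ i < j, (Config.step^[i] c).Safe (12 * N) M := by
  cases a with
  | halt out => exact ⟨0, by omega, h, by simp⟩
  | run stack D' pre u lim out =>
    obtain ⟨σ, s, rfl, hb, hrep, hrun⟩ := h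
    have h4 := hrep.four_le
    have hwp := vc_sound (N := N) (M := M) eventCmd (fun s' τ' =>
      TourRep N G t (TourState.next (G.find t) t (.run stack D' pre u lim out)) s' ∧
      τ' ≤ 500 * N + 500) s 0 (vc_eventCmd hrun fun s' τ' h1 h2 => ⟨h1, by omega⟩) σ hrep hb
      [mainLoopCmd.compile]
    have hfirst : (σ.cfg [mainLoopCmd.compile]).step =
        σ.cfg [eventCmd.compile, mainLoopCmd.compile] := by
      have hc : (Cond.compile (.eq .fin .zero)).holds σ.reg = true :=
        (hrep.holds_iff _).2 (hrun.fin.trans hrun.static.zero.symm)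
      simp [mainLoopCmd, Cmd.compile, Config.step, Mach.cfg, hc]
    obtain ⟨j, σ', h1, h2, h3, s', hrep', htour, hj⟩ := hwp
    rw [zero_add] at hj
    have hrunto : Config.step^[j + 1] (σ.cfg [mainLoopCmd.compile]) =
        σ'.cfg [mainLoopCmd.compile] := by
      rw [Function.iterate_succ_apply, hfirst, h1]
    have hsafe : ∀ i < j + 1,
        (Config.step^[i] (σ.cfg [mainLoopCmd.compile])).Safe (12 * N) M := by
      rintro (_ | i) hi
      · exact ⟨by simp [Config.address, Mach.cfg, mainLoopCmd, Cmd.compile], hb⟩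
      · rw [Function.iterate_succ_apply, hfirst]
        exact h2 i (by omega)
    cases hnext : TourState.next (G.find t) t (.run stack D' pre u lim out) with
    | run =>
      rw [hnext] at htour
      refine ⟨j + 1, by omega, ?_, hsafe⟩
      rw [hrunto]
      exact ⟨σ', s', rfl, h3, hrep', htour⟩
    | halt out' =>
      rw [hnext] at htour
      refine ⟨j + 1 + 1, by omega, ?_, ?_⟩
      · rw [Function.iterate_succ_apply', hrunto]
        refine ⟨σ', ?_, h3, hrep'.out.trans htour.2⟩
        have hc : (Cond.compile (.eq .fin .zero)).holds σ'.reg = false := by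
          rw [← Bool.not_eq_true, hrep'.holds_iff]
          exact htour.1
        simp [mainLoopCmd, Cmd.compile, Config.step, Mach.cfg, hc]
      · intro i hi
        rcases Nat.lt_succ_iff_lt_or_eq.1 hi with hi | rfl
        · exact hsafe i hi
        · rw [hrunto]
          exact ⟨by simp [Config.address, Mach.cfg, mainLoopCmd, Cmd.compile], h3⟩

theorem HeadRep.iterate_next {a : TourState (Fin n)} {c : Config} (h : HeadRep N M G t a c)
    (k : ℕ) : ∃ j ≤ k * (700 * N),
      HeadRep N M G t ((TourState.next (G.find t) t)^[k] a) (Config.step^[j] c) := by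
  induction k with
  | zero => exact ⟨0, by omega, h⟩
  | succ k ih =>
    obtain ⟨j, hj, h'⟩ := ih
    obtain ⟨j', hj', h'', -⟩ := h'.next
    refine ⟨j' + j, by rw [Nat.succ_mul]; omega, ?_⟩
    rwa [Function.iterate_succ_apply', Function.iterate_add_apply]

/-- By `productive_three`, three steps of time `700 * N` suffice. -/
theorem HeadRep.soon {a : TourState (Fin n)} {c : Config} (h : HeadRep N M G t a c) :
    c.Soon (2100 * N) := by
  obtain ⟨i, hi, hp⟩ := productive_three (find := G.find t) (t := t) a
  obtain ⟨j, hj, h'⟩ := h.iterate_next i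
  refine ⟨j, hj.trans ((Nat.mul_le_mul_right _ hi).trans (by omega)), ?_⟩
  refine hp.imp h'.halted fun hp => ?_
  rw [h.out, h'.out, List.length_map, List.length_map]
  exact hp

/-- The delay is at most the time of four steps: the step under way and three further ones. -/
theorem HeadRep.enumerating {a : TourState (Fin n)} {c : Config} (h : HeadRep N M G t a c)
    {k : ℕ} {L : List (List (Fin n))} (hk : (TourState.next (G.find t) t)^[k] a = .halt L) :
    c.Enumerating (12 * N) M (2800 * N) (L.map fun l => l.map Fin.val) := by
  induction k generalizing a c with
  | zero =>
    obtain rfl : a = .halt L := hk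
    have hc := Config.Enumerating.of_halted (A := 12 * N) (M := M) (B := 2800 * N)
      (h.halted trivial) (by obtain ⟨σ, rfl, hb, -⟩ := h; exact hb)
    rwa [h.out] at hc
  | succ k ih =>
    rw [Function.iterate_succ_apply] at hk
    obtain ⟨j, hj, h', hs⟩ := h.next
    exact .of_run hs hj h'.soon (by omega) (ih h' hk)

end MainLoop

/-! ### Initialisation -/

section Layout

variable {A M N k : ℕ} {σ : Mach} {τ : ℕ} {Q : Mach → ℕ → Prop}

/-- Compute the first addresses of `k + 1` arrays, of the length stored in the register `cap`. -/
def basesProg : ℕ → Prog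
  | 0 => .const 1 0
  | k + 1 => .seq (basesProg k) (.add (k + 2) (k + 1) Reg.cap.idx)

theorem wp1_basesProg (hk : k ≤ 11) (hN : 12 * N ≤ M) (hpos : 0 < N)
    (hcap : σ.reg Reg.cap.idx = N)
    (hQ : ∀ σ' τ', (∀ i ≤ k, σ'.reg (i + 1) = i * N) → (∀ x > k + 1, σ'.reg x = σ.reg x) →
      σ'.mem = σ.mem → σ'.current = σ.current → σ'.out = σ.out → τ' ≤ τ + 2 * k + 1 → Q σ' τ') :
    WP1 A M (basesProg k) Q σ τ := by
  induction k generalizing τ Q with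
  | zero =>
    refine wp1_const (by omega) (hQ _ _ ?_ ?_ rfl rfl rfl (by omega))
    · intro i hi
      obtain rfl : i = 0 := by omega
      simp
    · intro x hx
      exact Function.update_of_ne (by omega) _ _
  | succ k ih =>
    refine wp1_seq (ih (by omega) fun σ' τ' h1 h2 h3 h4 h5 h6 => ?_)
    have hc : σ'.reg Reg.cap.idx = N := by
      rw [h2 _ (by simp only [Reg.idx]; omega), hcap]
    have hm : (k + 1 + 1) * N ≤ 12 * N := Nat.mul_le_mul_right _ (by omega)
    have hk1 := h1 k le_rfl
    have he : σ'.reg (k + 1) + σ'.reg Reg.cap.idx = (k + 1) * N := by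
      rw [hk1, hc, Nat.succ_mul]
    refine wp1_add ?_ (hQ _ _ ?_ ?_ h3 h4 h5 (by omega))
    · rw [he]
      rw [Nat.succ_mul] at hm
      omega
    · intro i hi
      rcases Nat.lt_succ_iff_lt_or_eq.1 (Nat.lt_succ_of_le hi) with hi | rfl
      · rw [← h1 i (by omega)]
        exact Function.update_of_ne (by omega) _ _
      · rw [he]
        exact Function.update_self _ _ _
    · intro x hx
      rw [← h2 x (by omega)]
      exact Function.update_of_ne (by omega) _ _

/-- Read `n` and the number `m` of arcs and lay out arrays of length `n + 2 * m + 4`. -/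
def layoutProg : Prog :=
  .seq (.const 0 0) (.seq (.load Reg.size.idx 0) (.seq (.const 0 1) (.seq (.load Reg.one.idx 0)
    (.seq (.add 0 Reg.size.idx Reg.one.idx) (.seq (.add 0 0 Reg.one.idx)
      (.seq (.const Reg.one.idx 4) (.seq (.add Reg.cap.idx 0 Reg.one.idx) (basesProg 11))))))))

theorem wp1_layoutProg (hN : σ.mem 0 + 2 * σ.mem 1 + 4 = N) (hM : 12 * N ≤ M)
    (hQ : ∀ σ' s τ', Rep N M s σ' → s.reg .size = σ.mem 0 → s.reg .cap = N →
      (∀ A i, s.arr A i = σ.mem (A.pos * N + i)) → s.current = σ.current → s.out = σ.out →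
      τ' ≤ τ + 50 → Q σ' τ') :
    WP1 (12 * N) M layoutProg Q σ τ := by
  refine wp1_seq (wp1_const (by omega) (wp1_seq (wp1_load (by simp; omega)
    (wp1_seq (wp1_const (by omega) (wp1_seq (wp1_load (by simp; omega)
    (wp1_seq (wp1_add (by simp [Reg.idx]; omega) (wp1_seq (wp1_add (by simp [Reg.idx]; omega)
    (wp1_seq (wp1_const (by omega) (wp1_seq (wp1_add (by simp [Reg.idx]; omega)
    (wp1_basesProg (N := N) le_rfl hM (by omega) ?_ ?_))))))))))))))))
  · simp [Reg.idx]
    omega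
  · intro σ' τ' h1 h2 h3 h4 h5 h6
    refine hQ σ' ⟨fun x => σ'.reg x.idx, fun A i => σ'.mem (A.pos * N + i), σ'.current, σ'.out⟩ τ'
      ⟨by omega, hM, fun _ => rfl, ?_, fun _ _ _ => rfl, rfl, rfl⟩ ?_ ?_ ?_ h4 h5 (by omega)
    · intro A
      rw [Arr.idx, add_comm, h1 _ A.pos_le]
    · simp [h2, Reg.idx]
    · simp [h2, Reg.idx]
      omega
    · simp [h3]

end Layout

section Instance

variable {n : ℕ} {es : List (Fin n × Fin n)} {s t : Fin n} {D : Digraph (Fin n)}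

theorem length_flatMap_pairs (es : List (Fin n × Fin n)) :
    (es.flatMap fun e => [e.1.val, e.2.val]).length = 2 * es.length := by
  induction es with
  | nil => rfl
  | cons e es ih => simp only [List.flatMap_cons, List.length_append, List.length_cons, ih,
      List.length_nil]; omega

theorem length_encode : (encode es s t).length = 4 + 2 * es.length := by
  simp only [encode, List.length_append, length_flatMap_pairs, List.length_cons, List.length_nil]

theorem getD_flatMap_pairs (es : List (Fin n × Fin n)) {k : ℕ} {e : Fin n × Fin n}
    (h : es[k]? = some e) :
    (es.flatMap fun e => [e.1.val, e.2.val]).getD (2 * k) 0 = e.1 ∧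
    (es.flatMap fun e => [e.1.val, e.2.val]).getD (2 * k + 1) 0 = e.2 := by
  induction es generalizing k with
  | nil => simp at h
  | cons a es ih =>
    cases k with
    | zero =>
      obtain rfl : a = e := by simpa using h
      exact ⟨rfl, rfl⟩
    | succ k => exact ih (by simpa using h)

theorem getD_encode {k : ℕ} {e : Fin n × Fin n} (h : es[k]? = some e) :
    (encode es s t).getD (4 + 2 * k) 0 = e.1 ∧ (encode es s t).getD (4 + 2 * k + 1) 0 = e.2 := by
  have := getD_flatMap_pairs es h
  rw [encode, List.getD_append_right _ _ _ _ (by simp), List.getD_append_right _ _ _ _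
    (by simp; omega)]
  simp only [List.length_cons, List.length_nil]
  rwa [show 4 + 2 * k - (0 + 1 + 1 + 1 + 1) = 2 * k by omega,
    show 4 + 2 * k + 1 - (0 + 1 + 1 + 1 + 1) = 2 * k + 1 by omega]

/-- The arc number `k` of the input is named by its address `4 + 2 * k`. -/
def arcIds (k : ℕ) : List ℕ := (List.range k).map fun i => 4 + 2 * i

theorem mem_arcIds {k q : ℕ} : q ∈ arcIds k ↔ ∃ i < k, 4 + 2 * i = q := by
  simp [arcIds]

theorem arcIds_succ (k : ℕ) : arcIds (k + 1) = arcIds k ++ [4 + 2 * k] := by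
  simp [arcIds, List.range_succ]

/-- The directed graph of the input. The default value `(s, s)` concerns only numbers that are
not names of arcs. -/
def Net.ofInput (hes : ListsArcs es D) (s : Fin n) : Net n where
  D := D
  ids := arcIds es.length
  tl q := (es.getD ((q - 4) / 2) (s, s)).1
  hd q := (es.getD ((q - 4) / 2) (s, s)).2
  nodup := List.nodup_range.map fun a b h => by omega
  ne_zero q hq := by
    obtain ⟨i, -, rfl⟩ := mem_arcIds.1 hq
    omega
  adj_iff u v := by
    rw [← hes.2, List.mem_iff_getElem?]
    constructor
    · rintro ⟨i, hi⟩
      refine ⟨4 + 2 * i, mem_arcIds.2 ⟨i, (List.getElem?_eq_some_iff.1 hi).1, rfl⟩, ?_⟩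
      rw [show (4 + 2 * i - 4) / 2 = i by omega, List.getD_eq_getElem?_getD, hi]
      exact ⟨rfl, rfl⟩
    · rintro ⟨q, hq, h1, h2⟩
      obtain ⟨i, hi, rfl⟩ := mem_arcIds.1 hq
      refine ⟨i, ?_⟩
      rw [show (4 + 2 * i - 4) / 2 = i by omega, List.getD_eq_getElem _ _ hi] at h1 h2
      rw [List.getElem?_eq_getElem hi, ← h1, ← h2]
  inj q hq q' hq' h1 h2 := by
    obtain ⟨i, hi, rfl⟩ := mem_arcIds.1 hq
    obtain ⟨j, hj, rfl⟩ := mem_arcIds.1 hq'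
    rw [show (4 + 2 * i - 4) / 2 = i by omega, show (4 + 2 * j - 4) / 2 = j by omega,
      List.getD_eq_getElem _ _ hi, List.getD_eq_getElem _ _ hj] at h1 h2
    rw [hes.1.getElem_inj_iff.1 (Prod.ext h1 h2)]

theorem Linked.update {f : ℕ → ℕ} {p k a : ℕ} {l : List ℕ} (h : Linked f p l) (hk : k ∉ l) :
    Linked (Function.update f k a) p l := by
  induction l generalizing p with
  | nil => exact h
  | cons q l ih =>
    obtain ⟨h1, h2, h3⟩ := h
    refine ⟨h1, h2, ?_⟩
    rw [Function.update_of_ne fun e => hk (by simp [e])]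
    exact ih h3 fun hm => hk (List.mem_cons_of_mem _ hm)

/-- Add the arc `arc` to the list of the arcs that enter its head. -/
def linkCmd : Cmd :=
  .seq (.add .pos .arc .one) (.seq (.ld .nbr .inp .pos) (.seq (.ld .mark .first .nbr)
    (.seq (.st .nxt .arc .mark) (.seq (.st .first .nbr .arc) (.add .arc .arc .two)))))

/-- Initialise constants, the lists of the arcs that enter a vertex, and the main call. -/
def initCmd : Cmd :=
  .seq (.const .zero 0) (.seq (.const .one 1) (.seq (.const .two 2) (.seq (.const .arc 3)
    (.seq (.ld .target .inp .arc) (.seq (.ld .vtx .inp .two) (.seq (.ld .top .inp .one)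
    (.seq (.add .top .top .top) (.seq (.const .arc 4) (.seq (.add .top .top .arc)
    (.seq (.while (.lt .arc .top) linkCmd) (.seq (.copy .base .zero) (.seq (.copy .lim .size)
    (.seq (.copy .depth .zero) (.seq (.copy .parity .zero) (.seq (.copy .fin .zero)
    (.st .path .zero .vtx))))))))))))))))

variable {N M τ : ℕ} {G : Net n} {σ₀ : Store} {Q : Store → ℕ → Prop}

theorem vc_linkLoop {m : ℕ} (hG : G.ids = arcIds m) (hmN : 2 * m + 4 ≤ N) (hn : n ≤ N)
    (hone : σ₀.reg .one = 1) (htwo : σ₀.reg .two = 2) (harc : σ₀.reg .arc = 4)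
    (htop : σ₀.reg .top = 4 + 2 * m) (hhead : ∀ q ∈ G.ids, σ₀.arr .inp (q + 1) = G.hd q)
    (hfirst : ∀ i < n, σ₀.arr .first i = 0)
    (hQ : ∀ s' τ', Agree [.pos, .nbr, .mark, .arc] [.nxt, .first] σ₀ s' →
      (∀ y : Fin n, Linked (s'.arr .nxt) (s'.arr .first y) (G.ins y)) →
      τ' ≤ τ + 30 * m + 1 → Q s' τ') :
    vc N M (.while (.lt .arc .top) linkCmd) Q σ₀ τ := by
  refine vc_while (v := m) (fun v s' τ' => ∃ k, k + v = m ∧ s'.reg .arc = 4 + 2 * k ∧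
    Agree [.pos, .nbr, .mark, .arc] [.nxt, .first] σ₀ s' ∧ τ' ≤ τ + 30 * k ∧
    ∀ y : Fin n, Linked (s'.arr .nxt) (s'.arr .first y)
      ((arcIds k).filter fun q => G.hd q = y).reverse) ?_ ?_ ?_
  · exact ⟨0, by omega, harc, .refl _, by omega, fun y => hfirst y y.isLt⟩
  · rintro v s' τ' ⟨k, hk, hak, ha, hτ, hl⟩ hc
    have htop' := ha.reg .top (by decide)
    have hone' := ha.reg .one (by decide)
    have htwo' := ha.reg .two (by decide)
    have hc : s'.reg .arc < s'.reg .top := hc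
    have hkm : k < m := by omega
    have hmem : 4 + 2 * k ∈ G.ids := hG ▸ mem_arcIds.2 ⟨k, hkm, rfl⟩
    have hinp : s'.arr .inp (4 + 2 * k + 1) = G.hd (4 + 2 * k) := by
      rw [ha.arr .inp (by decide), hhead _ hmem]
    have hlt := (G.hd (4 + 2 * k)).isLt
    have hnot : 4 + 2 * k ∉ arcIds k := by
      rw [mem_arcIds]
      rintro ⟨i, hi, he⟩
      omega
    simp only [linkCmd, vc, Store.reg_setR, Store.arr_setR, Store.reg_setA, Store.arr_setA, hak,
      hone', hone, htwo', htwo, hinp, if_true, reduceCtorEq, if_false]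
    refine ⟨by omega, by omega, by omega, by omega, by omega, by omega, v - 1, by omega, k + 1,
      by omega, by omega, ?_, by omega, fun y => ?_⟩
    · refine ⟨fun r hr => ?_, fun B hB => ?_, ha.current, ha.out⟩
      · rw [← ha.reg r hr]
        simp only [List.mem_cons, not_or] at hr
        simp [hr]
      · rw [← ha.arr B hB]
        simp only [List.mem_cons, not_or] at hB
        simp [hB]
    · have hly := (hl y).update (k := 4 + 2 * k)
        (a := s'.arr .first (G.hd (4 + 2 * k))) (by simp [hnot])
      simp only [arcIds_succ, List.filter_append]
      by_cases hy : G.hd (4 + 2 * k) = y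
      · subst hy
        simp only [List.filter_cons, List.filter_nil, decide_true, if_true,
          List.reverse_append, List.reverse_singleton, List.singleton_append,
          Function.update_self]
        refine ⟨rfl, by omega, ?_⟩
        rw [Function.update_self]
        exact hly
      · have hy' : (y : ℕ) ≠ (G.hd (4 + 2 * k) : ℕ) := fun e => hy (Fin.ext e.symm)
        simpa [hy, Function.update_of_ne hy'] using hly
  · rintro v s' τ' ⟨k, hk, hak, ha, hτ, hl⟩ hc
    have htop' := ha.reg .top (by decide)
    have hc : ¬ s'.reg .arc < s'.reg .top := hc
    obtain rfl : k = m := by omega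
    refine hQ s' _ ha (fun y => ?_) (by omega)
    rw [Net.ins, hG]
    exact hl y

theorem vc_initCmd (hes : ListsArcs es D) (hN : n + 2 * es.length + 4 = N)
    (hsize : σ₀.reg .size = n) (hcap : σ₀.reg .cap = N)
    (hinp : ∀ i, σ₀.arr .inp i = (encode es s t).getD i 0)
    (hzero : ∀ A, A ≠ .inp → ∀ i, σ₀.arr A i = 0)
    (hcur : σ₀.current = []) (hout : σ₀.out = [])
    (hQ : ∀ s' τ', RunRep N (Net.ofInput hes s) t [] D [] s none [] s' →
      τ' ≤ τ + 20 * N + 100 → Q s' τ') :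
    vc N M initCmd Q σ₀ τ := by
  classical
  have hsn := s.isLt
  obtain ⟨G, hG⟩ : ∃ G, G = Net.ofInput hes s := ⟨_, rfl⟩
  have hids : G.ids = arcIds es.length := by rw [hG]; rfl
  have hD : G.D = D := by rw [hG]; rfl
  have hlen : G.ids.length = es.length := by simp [hids, arcIds]
  have hends : ∀ q ∈ G.ids, (encode es s t).getD q 0 = G.tl q ∧
      (encode es s t).getD (q + 1) 0 = G.hd q := by
    intro q hq
    rw [hids] at hq
    obtain ⟨i, hi, rfl⟩ := mem_arcIds.1 hq
    have := getD_encode (s := s) (t := t) (List.getElem?_eq_getElem hi)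
    rw [hG]
    simp only [Net.ofInput, show (4 + 2 * i - 4) / 2 = i by omega, List.getD_eq_getElem _ _ hi]
    exact this
  have i1 : σ₀.arr .inp 1 = es.length := by rw [hinp]; rfl
  have i2 : σ₀.arr .inp 2 = s := by rw [hinp]; rfl
  have i3 : σ₀.arr .inp 3 = t := by rw [hinp]; rfl
  rw [← hG] at hQ
  simp only [initCmd, vc, Store.reg_setR, Store.arr_setR, i1, i2, i3, if_true, reduceCtorEq,
    if_false]
  refine ⟨by omega, by omega, by omega, by omega, by omega, by omega, by omega, by omega,
    by omega, by omega, ?_⟩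
  refine vc_linkLoop hids (by omega) (by omega) (by simp) (by simp) (by simp) (by simp; omega)
    (fun q hq => (hinp _).trans (hends q hq).2) (fun i _ => by simp [hzero]) ?_
  intro s₁ τ₁ ha hl hτ
  have hr : ∀ r ∉ [Reg.pos, .nbr, .mark, .arc], _ := ha.reg
  simp only [Store.reg_setR] at hr
  have h0 : s₁.reg .zero = 0 := by rw [hr .zero (by decide)]; simp
  have h1 : s₁.reg .one = 1 := by rw [hr .one (by decide)]; simp
  have h2 : s₁.reg .two = 2 := by rw [hr .two (by decide)]; simp
  have h3 : s₁.reg .size = n := by rw [hr .size (by decide)]; simp [hsize]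
  have h4 : s₁.reg .target = t := by rw [hr .target (by decide)]; simp
  have h5 : s₁.reg .cap = N := by rw [hr .cap (by decide)]; simp [hcap]
  have h6 : s₁.reg .vtx = s := by rw [hr .vtx (by decide)]; simp
  have hinp₁ : s₁.arr .inp = σ₀.arr .inp := ha.arr .inp (by decide)
  have hdel₁ : s₁.arr .del = σ₀.arr .del := ha.arr .del (by decide)
  simp only [h0, h3, h6]
  refine ⟨by omega, hQ _ _ ⟨⟨⟨?_, ?_, ?_, ?_, ?_, ?_, ?_, ?_, ?_, ?_, ?_⟩, ⟨?_, ?_⟩, ?_, ?_, ?_, ?_,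
    ?_, ?_, ?_, ?_, ?_⟩, ?_, ?_, ?_, ?_⟩ ?_⟩
  · omega
  · intro q hq
    rw [hids] at hq
    obtain ⟨i, hi, rfl⟩ := mem_arcIds.1 hq
    omega
  · simp [h0]
  · simp [h1]
  · simp [h2]
  · simp [h3]
  · simp [h4]
  · simp [h5]
  · intro q hq
    simpa [hinp₁, hinp] using (hends q hq).1
  · intro q hq
    simpa [hinp₁, hinp] using (hends q hq).2
  · simpa using hl
  · rw [hD]
    exact fun _ _ h => h
  · intro q hq
    have : D.Adj (G.tl q) (G.hd q) := by
      rw [← hD, G.adj_iff]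
      exact ⟨q, hq, rfl, rfl⟩
    simp [this, hdel₁, hzero]
  · simp
  · simp
  · simp
  · simp
  · simp
  · simpa [hcur] using ha.current
  · simpa [hout] using ha.out
  · trivial
  · simp only [List.length_nil, zero_add]
    exact (Finset.card_filter_le _ _).trans G.ids.toFinset_card_le
  · simp
  · intro j v hj
    cases j with
    | zero =>
      obtain rfl : s = v := by simpa using hj
      simp
    | succ j => simp at hj
  · simp
  · simp
  · omega

/-- The whole program for directed graphs. -/
def enumProg : Prog := .seq (.seq layoutProg initCmd.compile) mainLoopCmd.compile

theorem enumProg_enumerating (hes : ListsArcs es D) {σ : Mach} (hb : σ.Bdd M)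
    (hmem : σ.mem = fun a => (encode es s t).getD a 0) (hcur : σ.current = []) (hout : σ.out = [])
    (hM : 12 * (n + 2 * es.length + 4) ≤ M) {L : List (List (Fin n))}
    (hL : AlgorithmOutputs ((Net.ofInput hes s).find t) D s t L) :
    (σ.cfg [enumProg]).Enumerating (12 * (n + 2 * es.length + 4)) M
      (2900 * (n + 2 * es.length + 4)) (L.map fun l => l.map Fin.val) := by
  obtain ⟨N, hN⟩ : ∃ N, n + 2 * es.length + 4 = N := ⟨_, rfl⟩
  rw [hN] at hM ⊢
  obtain ⟨k, hk⟩ := exists_next_iterate_eq_halt hL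
  refine (Config.Enumerating.seq (B := 2800 * N) (r := 100 * N) hb ?_).mono (by omega)
  refine wp1_seq (wp1_layoutProg (N := N) ?_ hM fun σ₁ s₁ τ₁ hrep h1 h2 h3 h4 h5 h6 => ?_)
  · rw [hmem]
    exact hN
  refine wp1_mono (vc_sound initCmd (fun s' τ' => RunRep N (Net.ofInput hes s) t [] D [] s none []
    s' ∧ τ' ≤ τ₁ + 20 * N + 100) s₁ τ₁ (vc_initCmd hes hN ?_ h2 ?_ ?_ (h4.trans hcur)
    (h5.trans hout) fun s' τ' hr hτ => ⟨hr, hτ⟩) σ₁ hrep) ?_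
  · rw [h1, hmem]
    rfl
  · intro i
    rw [h3, hmem]
    simp [Arr.pos]
  · intro A hA i
    have hpos : 1 ≤ A.pos := by
      cases A <;> first | exact absurd rfl hA | decide
    have := Nat.mul_le_mul_right N hpos
    rw [h3, hmem]
    exact List.getD_eq_default _ _ (by rw [length_encode]; omega)
  · rintro σ₂ τ₂ ⟨s₂, hrep₂, hrun, hτ⟩
    have := hrep.four_le
    refine ⟨by omega, fun hb₂ => ?_⟩
    exact HeadRep.enumerating (a := .run [] D [] s none []) ⟨σ₂, s₂, rfl, hb₂, hrep₂, hrun⟩ hk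

end Instance

/-! ### Undirected graphs -/

section Undirected

variable {n A M N : ℕ} {es : List (Fin n × Fin n)} {s t : Fin n}

theorem listsArcs_symmetric {G : SimpleGraph (Fin n)} (h : ListsEdges es G) :
    ListsArcs (es ++ es.map Prod.swap) (symmetricDigraph G) := by
  have hadj : ∀ u v, (u, v) ∈ es → G.Adj u v := fun u v huv =>
    (h.2 s(u, v)).1 (List.mem_map_of_mem huv)
  have hinj : ∀ e ∈ es, ∀ e' ∈ es, s(e.1, e.2) = s(e'.1, e'.2) → e = e' := fun e he e' he' hee =>
    List.inj_on_of_nodup_map h.1 he he' hee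
  refine ⟨?_, fun u v => ?_⟩
  · rw [List.nodup_append']
    refine ⟨h.1.of_map, h.1.of_map.map Prod.swap_injective, fun e he he' => ?_⟩
    obtain ⟨e', he'', rfl⟩ := List.mem_map.1 he'
    have := hinj _ he e' he'' Sym2.eq_swap
    have hne := (hadj e'.1 e'.2 he'').ne
    exact hne (congrArg Prod.snd this)
  · have hmem : (u, v) ∈ es ++ es.map Prod.swap ↔ (u, v) ∈ es ∨ (v, u) ∈ es := by
      simp [List.mem_append]
    rw [hmem]
    refine ⟨fun hm => hm.elim (hadj u v) fun hm => (hadj v u hm).symm, fun huv => ?_⟩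
    obtain ⟨e, he, hee⟩ := List.mem_map.1 ((h.2 s(u, v)).2 huv)
    rcases Sym2.eq_iff.1 hee with ⟨rfl, rfl⟩ | ⟨rfl, rfl⟩
    · exact Or.inl he
    · exact Or.inr he

/-- Read an arc of the input. -/
def readArcProg : Prog :=
  .seq (.load 6 3) (.seq (.add 3 3 1) (.seq (.load 7 3) (.add 3 3 1)))

/-- Append the arc with exchanged ends. -/
def appendArcProg : Prog :=
  .seq (.store 5 7) (.seq (.add 5 5 1) (.seq (.store 5 6) (.add 5 5 1)))

/-- Replace every edge of the input by two arcs. Register `2` holds twice the number of edges,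
which is the new number of arcs, and the registers `3`, `4` and `5` hold the reading position, the
end of the original input and the writing position. -/
def symmetrizeProg : Prog :=
  .seq (.const 1 1) (.seq (.load 2 1) (.seq (.add 2 2 2) (.seq (.store 1 2) (.seq (.const 3 4)
    (.seq (.add 4 3 2) (.seq (.copy 5 4) (.while (.lt 3 4) (.seq readArcProg appendArcProg))))))))

theorem update_getD_length (l : List ℕ) (x : ℕ) :
    Function.update (fun a => l.getD a 0) l.length x = fun a => (l ++ [x]).getD a 0 := by
  funext a
  rcases lt_trichotomy a l.length with h | rfl | h
  · rw [Function.update_of_ne h.ne, List.getD_append _ _ _ _ h]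
  · simp
  · rw [Function.update_of_ne h.ne', List.getD_eq_default _ _ h.le,
      List.getD_eq_default _ _ (by simpa using h)]

/-- The memory when the first `k` arcs have been appended with exchanged ends. -/
def symmetrized (es : List (Fin n × Fin n)) (s t : Fin n) (k : ℕ) : List ℕ :=
  [n, 2 * es.length, s.val, t.val] ++
    (es ++ (es.take k).map Prod.swap).flatMap fun e => [e.1.val, e.2.val]

theorem length_symmetrized {k : ℕ} (hk : k ≤ es.length) :
    (symmetrized es s t k).length = 4 + 2 * es.length + 2 * k := by
  simp only [symmetrized, List.length_append, length_flatMap_pairs, List.length_cons,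
    List.length_nil, List.length_map, List.length_take]
  omega

theorem getD_symmetrized {i k : ℕ} {e : Fin n × Fin n} (h : es[i]? = some e) :
    (symmetrized es s t k).getD (4 + 2 * i) 0 = e.1 ∧
    (symmetrized es s t k).getD (4 + 2 * i + 1) 0 = e.2 := by
  have h' : (es ++ (es.take k).map Prod.swap)[i]? = some e := by
    rw [List.getElem?_append_left (List.getElem?_eq_some_iff.1 h).1, h]
  have := getD_flatMap_pairs _ h'
  rw [symmetrized, List.getD_append_right _ _ _ _ (by simp), List.getD_append_right _ _ _ _
    (by simp; omega)]
  simp only [List.length_cons, List.length_nil]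
  rwa [show 4 + 2 * i - (0 + 1 + 1 + 1 + 1) = 2 * i by omega,
    show 4 + 2 * i + 1 - (0 + 1 + 1 + 1 + 1) = 2 * i + 1 by omega]

theorem symmetrized_succ {k : ℕ} {e : Fin n × Fin n} (h : es[k]? = some e) :
    symmetrized es s t (k + 1) = symmetrized es s t k ++ [e.2.val] ++ [e.1.val] := by
  simp [symmetrized, List.take_add_one, h]

theorem symmetrized_zero : symmetrized es s t 0 =
    (encode es s t).set 1 (2 * es.length) := by
  simp [symmetrized, encode]

theorem symmetrized_length :
    symmetrized es s t es.length = encode (es ++ es.map Prod.swap) s t := by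
  simp [symmetrized, encode, two_mul]

theorem wp1_readArcProg {σ : Mach} {Q : Mach → ℕ → Prop} {τ p : ℕ} (hA : p + 1 < A)
    (hM : p + 2 < M) (r1 : σ.reg 1 = 1) (r3 : σ.reg 3 = p)
    (hQ : ∀ σ' τ', σ'.reg 1 = 1 → σ'.reg 3 = p + 2 → σ'.reg 4 = σ.reg 4 → σ'.reg 5 = σ.reg 5 →
      σ'.reg 6 = σ.mem p → σ'.reg 7 = σ.mem (p + 1) → σ'.mem = σ.mem →
      σ'.current = σ.current → σ'.out = σ.out → τ' ≤ τ + 7 → Q σ' τ') :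
    WP1 A M readArcProg Q σ τ := by
  refine wp1_seq (wp1_load (by omega) ?_)
  refine wp1_seq (wp1_add (by simp [r1, r3]; omega) ?_)
  refine wp1_seq (wp1_load (by simp [r1, r3]; omega) ?_)
  refine wp1_add (by simp [r1, r3]; omega) ?_
  exact hQ _ _ (by simp [r1]) (by simp [r1, r3]) (by simp) (by simp) (by simp [r3])
    (by simp [r1, r3]) rfl rfl rfl (by omega)

theorem wp1_appendArcProg {σ : Mach} {Q : Mach → ℕ → Prop} {τ p : ℕ} (hA : p + 1 < A)
    (hM : p + 2 < M) (r1 : σ.reg 1 = 1) (r5 : σ.reg 5 = p)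
    (hQ : ∀ σ' τ', σ'.reg 1 = 1 → σ'.reg 3 = σ.reg 3 → σ'.reg 4 = σ.reg 4 → σ'.reg 5 = p + 2 →
      σ'.mem = Function.update (Function.update σ.mem p (σ.reg 7)) (p + 1) (σ.reg 6) →
      σ'.current = σ.current → σ'.out = σ.out → τ' ≤ τ + 7 → Q σ' τ') :
    WP1 A M appendArcProg Q σ τ := by
  refine wp1_seq (wp1_store (by omega) ?_)
  refine wp1_seq (wp1_add (by simp [r1, r5]; omega) ?_)
  refine wp1_seq (wp1_store (by simp [r1, r5]; omega) ?_)
  refine wp1_add (by simp [r1, r5]; omega) ?_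
  exact hQ _ _ (by simp [r1]) (by simp) (by simp) (by simp [r1, r5]) (by simp [r1, r5])
    rfl rfl (by omega)

theorem wp1_symmetrizeProg {σ : Mach} {Q : Mach → ℕ → Prop} {τ : ℕ}
    (hA : 4 + 4 * es.length ≤ A) (hM : 4 + 4 * es.length < M)
    (hmem : σ.mem = fun a => (encode es s t).getD a 0)
    (hQ : ∀ σ' τ', (σ'.mem = fun a => (encode (es ++ es.map Prod.swap) s t).getD a 0) →
      σ'.current = σ.current → σ'.out = σ.out → τ' ≤ τ + 20 * es.length + 20 → Q σ' τ') :
    WP1 A M symmetrizeProg Q σ τ := by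
  have h1 : σ.mem 1 = es.length := by rw [hmem]; rfl
  have hmem' : Function.update σ.mem 1 (2 * es.length) =
      fun a => (symmetrized es s t 0).getD a 0 := by
    rw [hmem]
    funext a
    have hl : (encode es s t).length = 4 + 2 * es.length := length_encode
    simp only [symmetrized_zero, Function.update_apply, List.getD_eq_getElem?_getD,
      List.getElem?_set]
    by_cases ha : a = 1
    · subst ha
      simp [hl, show 1 < 4 + 2 * es.length by omega]
    · simp [ha, Ne.symm ha]
  refine wp1_seq (wp1_const (by omega) ?_)
  refine wp1_seq (wp1_load (by simp; omega) ?_)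
  refine wp1_seq (wp1_add (by simp [h1]; omega) ?_)
  refine wp1_seq (wp1_store (by simp; omega) ?_)
  refine wp1_seq (wp1_const (by omega) ?_)
  refine wp1_seq (wp1_add (by simp [h1]; omega) ?_)
  refine wp1_seq (wp1_copy ?_)
  refine wp1_while (v := es.length) (fun v σ' τ' => ∃ k, k + v = es.length ∧ σ'.reg 1 = 1 ∧
    σ'.reg 3 = 4 + 2 * k ∧ σ'.reg 4 = 4 + 2 * es.length ∧ σ'.reg 5 = 4 + 2 * es.length + 2 * k ∧
    (σ'.mem = fun a => (symmetrized es s t k).getD a 0) ∧ σ'.current = σ.current ∧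
    σ'.out = σ.out ∧ τ' ≤ τ + 20 * k + 15) ?_ ?_ ?_
  · refine ⟨0, by omega, by simp, by simp, by simp [h1]; omega, by simp [h1]; omega, ?_, rfl, rfl,
      by omega⟩
    rw [← hmem']
    simp [h1, two_mul]
  · rintro v σ' τ' ⟨k, hk, r1, r3, r4, r5, hm, hc, ho, hτ⟩ hlt
    have hlt : σ'.reg 3 < σ'.reg 4 := by simpa [Test.holds] using hlt
    have hkl : k < es.length := by omega
    obtain ⟨m1, m2⟩ := getD_symmetrized (s := s) (t := t) (k := k) (List.getElem?_eq_getElem hkl)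
    have hlen := length_symmetrized (s := s) (t := t) hkl.le
    refine wp1_seq (wp1_readArcProg (p := 4 + 2 * k) (by omega) (by omega) r1 r3 ?_)
    intro σ₁ τ₁ p1 p3 p4 p5 p6 p7 pm pc po hτ₁
    refine wp1_appendArcProg (p := 4 + 2 * es.length + 2 * k) (by omega) (by omega) p1
      (p5.trans r5) ?_
    intro σ₂ τ₂ q1 q3 q4 q5 qm qc qo hτ₂
    refine ⟨v - 1, by omega, k + 1, by omega, q1, by omega, by omega, by omega, ?_,
      qc.trans (pc.trans hc), qo.trans (po.trans ho), by omega⟩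
    rw [qm, pm, p6, p7, hm]
    beta_reduce
    rw [m1, m2, symmetrized_succ (List.getElem?_eq_getElem hkl),
      ← update_getD_length, ← update_getD_length, List.length_append, hlen,
      List.length_singleton]
  · rintro v σ' τ' ⟨k, hk, r1, r3, r4, r5, hm, hc, ho, hτ⟩ hlt
    have hlt : ¬ σ'.reg 3 < σ'.reg 4 := by simpa [Test.holds] using hlt
    obtain rfl : k = es.length := by omega
    rw [symmetrized_length] at hm
    exact hQ _ _ hm hc ho (by omega)

end Undirected

/-! ### Resource bounds -/

section Bounds

variable {n A M B C : ℕ} {es : List (Fin n × Fin n)} {s t : Fin n} {D : Digraph (Fin n)}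

theorem ListsArcs.length_le (h : ListsArcs es D) : es.length ≤ n * n := by
  simpa using h.1.length_le_card

/-- A graph on `n` vertices has at most `n ^ 2` arcs, so the addresses are polynomial in `n` and
have `O(log n)` bits. -/
theorem word_bound {m : ℕ} (hC : 9 ≤ C) (hn : 0 < n) (hm : m ≤ n * n) :
    12 * (n + 2 * m + 4) ≤ 2 ^ (C * (Nat.log 2 n + 1)) := by
  have h1 : n < 2 ^ (Nat.log 2 n + 1) := Nat.lt_pow_succ_log_self (by norm_num) n
  obtain ⟨P, hP⟩ : ∃ P, P = 2 ^ (Nat.log 2 n + 1) := ⟨_, rfl⟩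
  rw [← hP] at h1
  have h2 : 2 ≤ P := by
    rw [hP, pow_succ]
    have := Nat.one_le_two_pow (n := Nat.log 2 n)
    omega
  have h3 : n * n ≤ P * P := Nat.mul_le_mul h1.le h1.le
  have h4 : n ≤ n * n := Nat.le_mul_of_pos_left n hn
  have h5 : 1 ≤ n * n := Nat.mul_pos hn hn
  calc 12 * (n + 2 * m + 4) ≤ 2 ^ 7 * (P * P) := by omega
    _ ≤ P ^ 7 * (P * P) := Nat.mul_le_mul_right _ (Nat.pow_le_pow_left h2 7)
    _ = P ^ 9 := by ring
    _ ≤ P ^ C := Nat.pow_le_pow_right (by omega) hC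
    _ = 2 ^ (C * (Nat.log 2 n + 1)) := by rw [hP, ← pow_mul, mul_comm]

theorem init_bdd (h : n + 2 * es.length + 4 ≤ M) :
    (⟨fun _ => 0, fun a => (encode es s t).getD a 0, [], []⟩ : Mach).Bdd M := by
  have hs := s.isLt
  have ht := t.isLt
  refine fun a => ⟨by simp only; omega, ?_⟩
  simp only
  rcases lt_or_ge a (encode es s t).length with ha | ha
  · rw [List.getD_eq_getElem _ _ ha]
    have hmem := List.getElem_mem ha
    generalize (encode es s t)[a] = x at hmem
    simp only [encode, List.cons_append, List.nil_append, List.mem_cons, List.mem_flatMap,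
      List.not_mem_nil, or_false] at hmem
    rcases hmem with rfl | rfl | rfl | rfl | ⟨e, -, rfl | rfl⟩
    · omega
    · omega
    · omega
    · omega
    · have := e.1.isLt
      omega
    · have := e.2.isLt
      omega
  · rw [List.getD_eq_default _ _ ha]
    omega

theorem Config.Enumerating.linear {p : Prog} {L : List (List (Fin n))}
    (h : (p.init (encode es s t)).Enumerating A (2 ^ (C * (Nat.log 2 n + 1))) B
      (L.map fun l => l.map Fin.val))
    (hA : A ≤ C * (n + es.length)) (hB : B ≤ C * (n + es.length)) :
    p.LinearDelayLinearSpace C es s t L := by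
  refine ⟨h.result, fun k => ?_, fun k a ha => ((h.safe k).1 a ha).trans_le hA,
    fun k a => (h.safe k).2 a⟩
  obtain ⟨j, hj, hd⟩ := h.delay k
  exact ⟨j, by omega, hd⟩

end Bounds

end PathEnum

open PathEnum
theorem mainTheorem2 :
    -- correctness of the algorithm on directed graphs, however the paths `Q` are found
    (∀ (n : ℕ) (D : Digraph (Fin n)) (s t : Fin n) (find : PathRule (Fin n)), find.Valid t →
      (∃ L, AlgorithmOutputs find D s t L) ∧
      ∀ L, AlgorithmOutputs find D s t L → Enumerates L (IsDiPath D s t)) ∧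
    -- correctness of the algorithm on undirected graphs
    (∀ (n : ℕ) (G : SimpleGraph (Fin n)) (s t : Fin n) (find : PathRule (Fin n)), find.Valid t →
      (∃ L, AlgorithmOutputs find (symmetricDigraph G) s t L) ∧
      ∀ L, AlgorithmOutputs find (symmetricDigraph G) s t L →
        Enumerates L (IsUndirPath G s t)) ∧
    -- linear delay and linear space on directed graphs
    (∃ (p : Prog) (C : ℕ), ∀ (n : ℕ) (D : Digraph (Fin n)) (es : List (Fin n × Fin n))
      (s t : Fin n), ListsArcs es D →
      ∃ (find : PathRule (Fin n)) (L : List (List (Fin n))), find.Valid t ∧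
        AlgorithmOutputs find D s t L ∧ p.LinearDelayLinearSpace C es s t L) ∧
    -- linear delay and linear space on undirected graphs
    (∃ (p : Prog) (C : ℕ), ∀ (n : ℕ) (G : SimpleGraph (Fin n)) (es : List (Fin n × Fin n))
      (s t : Fin n), ListsEdges es G →
      ∃ (find : PathRule (Fin n)) (L : List (List (Fin n))), find.Valid t ∧
        AlgorithmOutputs find (symmetricDigraph G) s t L ∧
        p.LinearDelayLinearSpace C es s t L) := by
  -- The arrays have length `n + 2 * m + 4`, or `n + 4 * m + 4` in the undirected case, which is at
  -- most `5 * (n + m)` since `s` is a vertex; the constant `30000` absorbs this factor and `2900`.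
  refine ⟨fun n D s t find hf => ⟨exists_enumSTP hf D [] s 0, fun L hL =>
    algorithmOutputs_enumerates hf hL⟩, fun n G s t find hf =>
    ⟨exists_enumSTP hf _ [] s 0, fun L hL => ?_⟩, ⟨enumProg, 30000, ?_⟩,
    ⟨.seq symmetrizeProg enumProg, 30000, ?_⟩⟩
  · have := algorithmOutputs_enumerates hf hL
    exact ⟨this.1, fun l => (this.2 l).trans (isDiPath_symmetricDigraph_iff G s t l)⟩
  · intro n D es s t hes
    have hn : 0 < n := s.pos
    have hf := (Net.ofInput hes s).find_valid t
    obtain ⟨L, hL⟩ := exists_enumSTP hf D [] s 0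
    have hM := word_bound (C := 30000) (by norm_num) hn hes.length_le
    refine ⟨_, L, hf, hL, Config.Enumerating.linear
      (enumProg_enumerating hes (init_bdd (s := s) (t := t) (by omega)) rfl rfl rfl hM hL) ?_ ?_⟩
    · omega
    · omega
  · intro n G es s t hes
    have hn : 0 < n := s.pos
    have hes' := listsArcs_symmetric hes
    have hf := (Net.ofInput hes' s).find_valid t
    obtain ⟨L, hL⟩ := exists_enumSTP hf (symmetricDigraph G) [] s 0
    have hM := word_bound (C := 30000) (by norm_num) hn hes'.length_le
    have hlen : (es ++ es.map Prod.swap).length = 2 * es.length := by simp [two_mul]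
    rw [hlen] at hM
    refine ⟨_, L, hf, hL, Config.Enumerating.linear (A := 12 * (n + 2 * (2 * es.length) + 4))
      (B := 2900 * (n + 2 * (2 * es.length) + 4) + (20 * es.length + 21))
      (Config.Enumerating.seq (σ := ⟨fun _ => 0, fun a => (encode es s t).getD a 0, [], []⟩)
        (init_bdd (by omega)) (wp1_symmetrizeProg (es := es) (s := s) (t := t) (by omega)
          (by omega) rfl fun σ τ hm hc ho hτ => ⟨by omega, fun hb => ?_⟩)) ?_ ?_⟩
    · have := enumProg_enumerating hes' hb hm hc ho (by rwa [hlen]) hL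
      rwa [hlen] at this
    · omega
    · omega
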